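/- Let $M$ be a compact $C^\infty$ Riemannian manifold without boundary, with a metric $d_M$ inducing its topology, let $(\Omega,d_\Omega)$ be a compact metric space, and let $\theta:\Omega\to\Omega$ be a homeomorphism. Let $\omega\mapsto f_\omega$ be a continuous map from $\Omega$ to the space of $C^2$ diffeomorphisms of $M$ with the $C^2$ topology, and put $$\phi:M\times\Omega\to M\times\Omega,\qquad \phi(x,\omega)=(f_\omega x,\theta\omega).$$ Assume: (a) $\theta$ is equicontinuous: there are $c>1$ and $\delta>0$ such that $\frac1c d_\Omega(\omega_1,\omega_2)\le d_\Omega(\theta^n\omega_1,\theta^n\omega_2)\le c\,d_\Omega(\omega_1,\omega_2)$ for all $n\in\mathbb Z$ and all $\omega_1,\omega_2\in\Omega$ with $d_\Omega(\omega_1,\omega_2)<\delta$. (b) $\phi$ is transitive: there is $p\in M\times\Omega$ whose orbit $\{\phi^n(p):n\in\mathbb Z\}$ is dense in $M\times\Omega$. (c) $\phi$ is Anosov on fibers: there are $\lambda_0>0$ and, for every $(x,\omega)\in M\times\Omega$, a splitting $T_xM=E^u_{(x,\omega)}\oplus E^s_{(x,\omega)}$ depending continuously on $(x,\omega)$, with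 $\dim E^u_{(x,\omega)}>0$, $Df_\omega(x)E^\tau_{(x,\omega)}=E^\tau_{\phi(x,\omega)}$ for $\tau=u,s$, $|Df_\omega(x)\xi|\ge e^{\lambda_0}|\xi|$ for all $\xi\in E^u_{(x,\omega)}$, and $|Df_\omega(x)\eta|\le e^{-\lambda_0}|\eta|$ for all $\eta\in E^s_{(x,\omega)}$, where $|\cdot|$ is the norm of the Riemannian metric. For $h:\Omega\to M$ write $\mathrm{graph}(h)=\{(h(\omega),\omega):\omega\in\Omega\}\subset M\times\Omega$. A full random periodic orbit of $\phi$ of period $n\ge1$ is a family $\{\mathrm{graph}(g_i)\}_{i\in\mathbb Z/n\mathbb Z}$ with Borel measurable maps $g_i:\Omega\to M$ such that $\phi(\mathrm{graph}(g_i))=\mathrm{graph}(g_{i+1})$ for all $i\in\mathbb Z/n\mathbb Z$; each of its members is called a full random periodic point of $\phi$. Then for every continuous map $g:\Omega\to M$ and every $\epsilon>0$ there is a Borel measurable map $\tilde g:\Omega\to M$ such that $\mathrm{graph}(\tilde g)$ is a full random periodic point of $\phi$ and $$\sup_{\omega\in\Omega} d_M(g(\omega),\tilde g(\omega))\le\epsilon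 .$$ -/

import Mathlib

open scoped Bundle Manifold ContDiff Topology

/-! Quasi-periodically forced systems `φ (x, w) = (f_w x, θ w)` on `M × Ω`. Here `M` is a closed
`C^∞` manifold modelled on a finite-dimensional real vector space `E` (without boundary) and `Ω` is
a compact metric space. -/

namespace QPForced

section CTwoTopology

variable {E : Type*} [NormedAddCommGroup E] [NormedSpace ℝ E]
  {M : Type*} [TopologicalSpace M] [ChartedSpace E M]

/-- Given `C^∞` charts `a`, `b` of `M` and a compact set `K` in the domain of `a`, the set of all
`C^2` diffeomorphisms `h` that map `K` into the domain of `b` and whose expression in these charts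
is, together with its derivatives of order at most `2`, within `ε` of that of `f` on `K`. -/
def cTwoNhd (f : M ≃ₘ^2⟮𝓘(ℝ, E), 𝓘(ℝ, E)⟯ M) (a b : OpenPartialHomeomorph M E) (K : Set M)
    (ε : ℝ) : Set (M ≃ₘ^2⟮𝓘(ℝ, E), 𝓘(ℝ, E)⟯ M) :=
  {h | (∀ x ∈ K, h x ∈ b.source) ∧
    ∀ x ∈ K, ∀ k : ℕ, k ≤ 2 →
      ‖iteratedFDeriv ℝ k (fun y => b (h (a.symm y))) (a x) -
        iteratedFDeriv ℝ k (fun y => b (f (a.symm y))) (a x)‖ < ε}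

/-- The `C^2` topology on the set of `C^2` diffeomorphisms of `M`. -/
instance cTwoTopology : TopologicalSpace (M ≃ₘ^2⟮𝓘(ℝ, E), 𝓘(ℝ, E)⟯ M) :=
  TopologicalSpace.generateFrom
    {N | ∃ (f : M ≃ₘ^2⟮𝓘(ℝ, E), 𝓘(ℝ, E)⟯ M) (a b : OpenPartialHomeomorph M E) (K : Set M) (ε : ℝ),
      a ∈ IsManifold.maximalAtlas 𝓘(ℝ, E) ∞ M ∧ b ∈ IsManifold.maximalAtlas 𝓘(ℝ, E) ∞ M ∧
      IsCompact K ∧ K ⊆ a.source ∧ (∀ x ∈ K, f x ∈ b.source) ∧ 0 < ε ∧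
      N = cTwoNhd f a b K ε}

end CTwoTopology

section Driving

variable {Ω : Type*} [MetricSpace Ω]

/-- Equicontinuity of the homeomorphism `θ`: all iterates, forward and backward, distort small
distances by a factor of at most `c`. -/
def IsEquicontinuous (θ : Ω ≃ₜ Ω) : Prop :=
  ∃ c : ℝ, 1 < c ∧ ∃ δ : ℝ, 0 < δ ∧ ∀ w₁ w₂ : Ω, dist w₁ w₂ < δ → ∀ n : ℤ,
    (1 / c) * dist w₁ w₂ ≤ dist ((θ ^ n) w₁) ((θ ^ n) w₂) ∧
      dist ((θ ^ n) w₁) ((θ ^ n) w₂) ≤ c * dist w₁ w₂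

end Driving

section System

variable {E : Type*} [NormedAddCommGroup E] [NormedSpace ℝ E]
  {M : Type*} [TopologicalSpace M] [ChartedSpace E M]
  {Ω : Type*} [TopologicalSpace Ω]

/-- The skew product `φ (x, w) = (f_w x, θ w)`, as a bijection of `M × Ω`. -/
noncomputable def skewProduct (f : Ω → M ≃ₘ^2⟮𝓘(ℝ, E), 𝓘(ℝ, E)⟯ M) (θ : Ω ≃ₜ Ω) : Equiv.Perm (M × Ω) where
  toFun p := (f p.2 p.1, θ p.2)
  invFun p := ((f (θ.symm p.2)).symm p.1, θ.symm p.2)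
  left_inv p := by simp
  right_inv p := by simp

/-- Transitivity: some (two-sided) orbit is dense. -/
def IsTransitive (φ : Equiv.Perm (M × Ω)) : Prop :=
  ∃ p : M × Ω, Dense (Set.range fun n : ℤ => (φ ^ n) p)

variable [IsManifold 𝓘(ℝ, E) ∞ M]

/-- The subspaces `F x w ⊆ T_x M` depend continuously on `(x, w)`: near every point of `M × Ω`
they have a basis consisting of continuous vector fields along the fibers. -/
def IsContinuousSubbundle (F : ∀ x : M, Ω → Submodule ℝ (TangentSpace 𝓘(ℝ, E) x)) : Prop :=
  ∀ p₀ : M × Ω, ∃ U ∈ 𝓝 p₀, ∃ (k : ℕ) (v : Fin k → ∀ x : M, Ω → TangentSpace 𝓘(ℝ, E) x),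
    (∀ i, ContinuousOn
      (fun p : M × Ω => (⟨p.1, v i p.1 p.2⟩ : TangentBundle 𝓘(ℝ, E) M)) U) ∧
    ∀ p ∈ U, LinearIndependent ℝ (fun i => v i p.1 p.2) ∧
      Submodule.span ℝ (Set.range fun i => v i p.1 p.2) = F p.1 p.2

/-- The system is Anosov on fibers. The norm is that of the Riemannian metric of `M`. -/
def IsAnosovOnFibers [Bundle.RiemannianBundle (fun x : M => TangentSpace 𝓘(ℝ, E) x)]
    (f : Ω → M ≃ₘ^2⟮𝓘(ℝ, E), 𝓘(ℝ, E)⟯ M) (θ : Ω ≃ₜ Ω) : Prop :=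
  ∃ (Eu Es : ∀ x : M, Ω → Submodule ℝ (TangentSpace 𝓘(ℝ, E) x)) (lam : ℝ), 0 < lam ∧
    IsContinuousSubbundle Eu ∧ IsContinuousSubbundle Es ∧
    ∀ (x : M) (w : Ω),
      IsCompl (Eu x w) (Es x w) ∧
      0 < Module.finrank ℝ (Eu x w) ∧
      (Eu x w).map (mfderiv 𝓘(ℝ, E) 𝓘(ℝ, E) (f w) x).toLinearMap = Eu (f w x) (θ w) ∧
      (Es x w).map (mfderiv 𝓘(ℝ, E) 𝓘(ℝ, E) (f w) x).toLinearMap = Es (f w x) (θ w) ∧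
      (∀ ξ ∈ Eu x w, Real.exp lam * ‖ξ‖ ≤ ‖mfderiv 𝓘(ℝ, E) 𝓘(ℝ, E) (f w) x ξ‖) ∧
      (∀ η ∈ Es x w, ‖mfderiv 𝓘(ℝ, E) 𝓘(ℝ, E) (f w) x η‖ ≤ Real.exp (-lam) * ‖η‖)

end System

section RandomPeriodic

variable {M Ω : Type*}

/-- The graph of `g : Ω → M`, as a subset of `M × Ω`. -/
def graph (g : Ω → M) : Set (M × Ω) := {p | p.1 = g p.2}

variable [MeasurableSpace M] [MeasurableSpace Ω]

/-- The graphs of `g i`, `i` modulo `n`, form a full random periodic orbit of `φ` of period `n`. -/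
def IsFullRandomPeriodicOrbit (φ : M × Ω → M × Ω) (n : ℕ) (g : ZMod n → Ω → M) : Prop :=
  0 < n ∧ (∀ i, Measurable (g i)) ∧ ∀ i, φ '' graph (g i) = graph (g (i + 1))

/-- `S` is a full random periodic point: a member of some full random periodic orbit. -/
def IsFullRandomPeriodicPoint (φ : M × Ω → M × Ω) (S : Set (M × Ω)) : Prop :=
  ∃ (n : ℕ) (g : ZMod n → Ω → M), IsFullRandomPeriodicOrbit φ n g ∧ ∃ i, S = graph (g i)

end RandomPeriodic

end QPForced

/-! The continuous section `g` is first made a member of a measurable periodic family of almost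
invariant sections. Hyperbolicity along the fibers then replaces this family by an invariant one
nearby.

The second half is classical. Along pseudo-orbits in the fibers, the maps read in suitable charts
are small Lipschitz perturbations of linear maps with a uniformly hyperbolic splitting. A
contraction argument on two-sided sequences gives shadowing (`exists_shadowing`) and expansivity
(`exists_expansive`). Shadowing is applied over every `w` separately; by uniqueness the shadowing
orbits inherit invariance, periodicity and measurability (`exists_periodic_orbit_of_pseudo_orbit`).

The first half needs closed pseudo-orbits through many points over many base points, all of one
length `n`, with `θ ^ n` uniformly close to the identity. Transitivity joins any two points of a
fiber by such a chain, but at a time depending on the points, and no mixing is assumed that would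
make the times agree. Therefore `exists_simultaneous_closed_chains` discretizes: on finitely many
states it considers the relations realized by chains at arbitrarily precise return times of the
base. Equicontinuity transports chains to nearby base orbits with slightly larger jumps, so these
relations compose. The growth of the jumps is removed by a pigeonhole argument over jump sizes. What
remains is a statement about finite sets, `IsRecurrentFamily.exists_reflexive`: such a family
contains a reflexive relation, that is, all states return to themselves at one common time. -/

namespace QPForced

/-! ### Combinatorics of recurrent families of relations on a finite set. -/

section FiniteRelations

variable {V : Type*}

/-- A family of total relations on `V`, closed under composition up to enlargement (with the two
orders of composition realized simultaneously), whose reachability relation is symmetric. -/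
structure IsRecurrentFamily (T : Set (V → V → Prop)) : Prop where
  nonempty : T.Nonempty
  total : ∀ A ∈ T, ∀ x, ∃ y, A x y
  comp : ∀ A ∈ T, ∀ B ∈ T, ∃ C ∈ T, (∀ x y z, A x y → B y z → C x z) ∧
    ∀ x y z, B x y → A y z → C x z
  back : ∀ A ∈ T, ∀ x y, A x y → ∃ B ∈ T, B y x

/-- Two states merge if some relation of the family relates both of them to a common state. -/
def Merge (T : Set (V → V → Prop)) (x y : V) : Prop := ∃ A ∈ T, ∃ z, A x z ∧ A y z

/-- A finite family of states, no two of which merge. -/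
def IsSeparatedFamily (T : Set (V → V → Prop)) {r : ℕ} (s : Fin r → V) : Prop :=
  ∀ i j, i ≠ j → ¬ Merge T (s i) (s j)

variable {T : Set (V → V → Prop)}

lemma Merge.symm {x y : V} (h : Merge T x y) : Merge T y x := by
  obtain ⟨A, hA, z, h1, h2⟩ := h
  exact ⟨A, hA, z, h2, h1⟩

lemma IsSeparatedFamily.cons {r : ℕ} {s : Fin r → V} (hs : IsSeparatedFamily T s) {x : V}
    (hx : ∀ i, ¬ Merge T x (s i)) : IsSeparatedFamily T (Fin.cons x s : Fin (r + 1) → V) := by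
  intro i j
  refine Fin.cases ?_ (fun i => ?_) i <;> refine Fin.cases ?_ (fun j => ?_) j
  · simp
  · intro _; simpa using hx j
  · intro _ h; exact hx i (by simpa using h.symm)
  · intro hij; simpa using hs i j (by simpa using hij)

lemma IsSeparatedFamily.exists_merge {r : ℕ} {s : Fin r → V} (hs : IsSeparatedFamily T s)
    (hr : ∀ s : Fin (r + 1) → V, ¬ IsSeparatedFamily T s) (x : V) : ∃ i, Merge T x (s i) := by
  by_contra! h
  exact hr _ (hs.cons h)

namespace IsRecurrentFamily

variable (hT : IsRecurrentFamily T)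
include hT

lemma merge_refl (x : V) : Merge T x x := by
  obtain ⟨A, hA⟩ := hT.nonempty
  obtain ⟨y, hy⟩ := hT.total A hA x
  exact ⟨A, hA, y, hy, hy⟩

/-- Merging pulls back along a common relation by composition, so separation pushes forward. That
merging itself pushes forward is `merge_step`, which lies deeper. -/
lemma merge_of_step {A : V → V → Prop} (hA : A ∈ T) {x x' y y' : V} (hx : A x x') (hy : A y y')
    (h : Merge T x' y') : Merge T x y := by
  obtain ⟨B, hB, z, h1, h2⟩ := h
  obtain ⟨C, hC, hC1, -⟩ := hT.comp A hA B hB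
  exact ⟨C, hC, z, hC1 _ _ _ hx h1, hC1 _ _ _ hy h2⟩

lemma isSeparatedFamily_step {A : V → V → Prop} (hA : A ∈ T) {r : ℕ} {s s' : Fin r → V}
    (hs : IsSeparatedFamily T s) (h : ∀ i, A (s i) (s' i)) : IsSeparatedFamily T s' :=
  fun i j hij hm => hs i j hij (hT.merge_of_step hA (h i) (h j) hm)

lemma exists_maximal_separatedFamily [Finite V] :
    ∃ r, (∃ s : Fin r → V, IsSeparatedFamily T s) ∧
      ∀ s : Fin (r + 1) → V, ¬ IsSeparatedFamily T s := by
  classical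
  have := Fintype.ofFinite V
  by_contra! h
  have key : ∀ r, ∃ s : Fin r → V, IsSeparatedFamily T s := by
    intro r
    induction r with
    | zero => exact ⟨Fin.elim0, fun i => i.elim0⟩
    | succ r ih => exact h r ih
  obtain ⟨s, hs⟩ := key (Fintype.card V + 1)
  have hinj : Function.Injective s := by
    intro i j hij
    by_contra hne
    exact hs i j hne (hij ▸ hT.merge_refl _)
  simpa using Fintype.card_le_of_injective s hinj

/-- This is why `comp` asks for both orders at once: following `A` by `B` for one pair and `B` by
`A` for the other makes both pairs merge under a single relation, in "equal time". -/
lemma exists_common_step {A B : V → V → Prop} (hA : A ∈ T) (hB : B ∈ T) {x y z w u v : V}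
    (h1 : A x u) (h2 : A y u) (h3 : B z v) (h4 : B w v) :
    ∃ C ∈ T, ∃ u' v', C x u' ∧ C y u' ∧ C z v' ∧ C w v' := by
  obtain ⟨C, hC, hC1, hC2⟩ := hT.comp A hA B hB
  obtain ⟨u', hu⟩ := hT.total B hB u
  obtain ⟨v', hv⟩ := hT.total A hA v
  exact ⟨C, hC, u', v', hC1 _ _ _ h1 hu, hC1 _ _ _ h2 hu, hC2 _ _ _ h3 hv, hC2 _ _ _ h4 hv⟩

/-- The choice of successors of a finite family of states, one of them being prescribed. -/
lemma exists_step_family {A : V → V → Prop} (hA : A ∈ T) {r : ℕ} (s : Fin r → V) (i : Fin r)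
    {x : V} (hx : A (s i) x) : ∃ t : Fin r → V, t i = x ∧ ∀ k, A (s k) (t k) := by
  choose t ht using fun k => hT.total A hA (s k)
  refine ⟨Function.update t i x, by simp, fun k => ?_⟩
  by_cases hk : k = i
  · subst hk; simpa using hx
  · simpa [hk] using ht k

/-- Suppose `i ≠ j`. Symmetry of reachability lets some `C` move `s i` to `x`, and the rest of the
family along with it, to a separated family `t`. A further step `F` takes `x` to `z₁`, shared with
`s i`, and also to `z₂`, shared with `s j`. Then `z₂` can be added to the image of `t`, against
maximality: it does not merge with `z₁`, because `s i` and `s j` do not merge, nor with the other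
members, because they come from states not merging with `x`. -/
lemma eq_of_merge_of_maximal {r : ℕ} {s : Fin r → V} (hs : IsSeparatedFamily T s)
    (hr : ∀ s : Fin (r + 1) → V, ¬ IsSeparatedFamily T s) {x : V} {i j : Fin r}
    (hi : Merge T x (s i)) (hj : Merge T x (s j)) : i = j := by
  by_contra hij
  obtain ⟨A, hA, y, hxy, hsy⟩ := hi
  obtain ⟨B, hB, w, hxw, hsw⟩ := hj
  obtain ⟨D, hD, hyx⟩ := hT.back A hA x y hxy
  obtain ⟨C, hC, hC1, -⟩ := hT.comp A hA D hD
  have hsx : C (s i) x := hC1 _ _ _ hsy hyx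
  obtain ⟨F, hF, z₁, z₂, h1, h2, h3, h4⟩ := hT.exists_common_step hA hB hxy hsy hxw hsw
  obtain ⟨t, hti, ht⟩ := hT.exists_step_family hC s i hsx
  have hsep := hT.isSeparatedFamily_step hC hs ht
  obtain ⟨u, hui, hu⟩ := hT.exists_step_family hF t i (x := z₁) (by rw [hti]; exact h1)
  refine hr _ ((hT.isSeparatedFamily_step hF hsep hu).cons (x := z₂) ?_)
  intro k hk
  by_cases hki : k = i
  · subst hki
    rw [hui] at hk
    exact hs _ _ hij (hT.merge_of_step hF h2 h4 hk.symm)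
  · have h5 : Merge T x (t k) := hT.merge_of_step hF h3 (hu k) hk
    rw [← hti] at h5
    exact hsep _ _ (Ne.symm hki) h5

/-- Every state merges with exactly one member of a maximal family, so the right-hand side is
visibly transitive; this is how transitivity of merging is obtained. -/
lemma merge_iff_of_maximal {r : ℕ} {s : Fin r → V} (hs : IsSeparatedFamily T s)
    (hr : ∀ s : Fin (r + 1) → V, ¬ IsSeparatedFamily T s) (x y : V) :
    Merge T x y ↔ ∃ i, Merge T x (s i) ∧ Merge T y (s i) := by
  constructor
  · rintro ⟨A, hA, z, hxz, hyz⟩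
    choose t ht using fun k => hT.total A hA (s k)
    obtain ⟨i, hi⟩ := (hT.isSeparatedFamily_step hA hs ht).exists_merge hr z
    exact ⟨i, hT.merge_of_step hA hxz (ht i) hi, hT.merge_of_step hA hyz (ht i) hi⟩
  · rintro ⟨i, ⟨A, hA, z, hxz, hsz⟩, B, hB, w, hyw, hsw⟩
    obtain ⟨C, hC, z', w', h1, h2, h3, h4⟩ := hT.exists_common_step hA hB hxz hsz hyw hsw
    obtain ⟨t, hti, ht⟩ := hT.exists_step_family hC s i h2
    obtain ⟨k, hk⟩ := (hT.isSeparatedFamily_step hC hs ht).exists_merge hr w'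
    have h5 := hT.merge_of_step hC h3 (ht k) hk
    have h6 : Merge T y (s i) := ⟨B, hB, w, hyw, hsw⟩
    have h7 := hT.eq_of_merge_of_maximal hs hr h5 h6
    subst h7
    rw [hti] at hk
    exact hT.merge_of_step hC h1 h3 hk.symm

lemma merge_trans [Finite V] {x y z : V} (hxy : Merge T x y) (hyz : Merge T y z) :
    Merge T x z := by
  obtain ⟨r, ⟨s, hs⟩, hr⟩ := hT.exists_maximal_separatedFamily
  rw [hT.merge_iff_of_maximal hs hr] at hxy hyz ⊢
  obtain ⟨i, hxi, hyi⟩ := hxy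
  obtain ⟨j, hyj, hzj⟩ := hyz
  have := hT.eq_of_merge_of_maximal hs hr hyi hyj
  subst this
  exact ⟨i, hxi, hzj⟩

/-- The image of a maximal family is again maximal, and a state keeps the index of the member with
which it merges. -/
lemma merge_step [Finite V] {A : V → V → Prop} (hA : A ∈ T) {x x' y y' : V} (hx : A x x')
    (hy : A y y') (h : Merge T x y) : Merge T x' y' := by
  obtain ⟨r, ⟨s, hs⟩, hr⟩ := hT.exists_maximal_separatedFamily
  choose t ht using fun k => hT.total A hA (s k)
  have hts := hT.isSeparatedFamily_step hA hs ht
  obtain ⟨i, hi⟩ := hts.exists_merge hr x'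
  obtain ⟨j, hj⟩ := hts.exists_merge hr y'
  have h1 := hT.merge_of_step hA hx (ht i) hi
  have h2 := hT.merge_of_step hA hy (ht j) hj
  have := hT.eq_of_merge_of_maximal hs hr h1 (hT.merge_trans h h2)
  subst this
  exact hT.merge_trans hi hj.symm

lemma equivalence_merge [Finite V] : Equivalence (Merge T) :=
  ⟨hT.merge_refl, Merge.symm, hT.merge_trans⟩

/-- Some relation of the family relates all states of each merging class to one common state. -/
lemma exists_selection [Finite V] :
    ∃ A ∈ T, ∃ h : V → V, (∀ x, A x (h x)) ∧ ∀ x y, Merge T x y → h x = h y := by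
  classical
  have := Fintype.ofFinite V
  have hne : ∃ n, ∃ A ∈ T, ∃ h : V → V, (∀ x, A x (h x)) ∧ (Finset.univ.image h).card = n := by
    obtain ⟨A, hA⟩ := hT.nonempty
    choose h hh using hT.total A hA
    exact ⟨_, A, hA, h, hh, rfl⟩
  -- Take a selection whose image is smallest. Two distinct merging values in it could be identified
  -- by one more step.
  obtain ⟨A, hA, h, hh, hcard⟩ := Nat.find_spec hne
  refine ⟨A, hA, h, hh, fun x y hxy => ?_⟩
  by_contra hne'
  obtain ⟨B, hB, z, hxz, hyz⟩ := hT.merge_step hA (hh x) (hh y) hxy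
  choose b hb using hT.total B hB
  let g : V → V := fun v => if v = h x ∨ v = h y then z else b v
  have hg : ∀ v, B v (g v) := by
    intro v
    by_cases hv : v = h x ∨ v = h y
    · simp only [g, hv, if_true]
      rcases hv with rfl | rfl <;> assumption
    · simpa only [g, hv, if_false] using hb v
  obtain ⟨C, hC, hC1, -⟩ := hT.comp A hA B hB
  refine Nat.find_min hne (m := (Finset.univ.image (g ∘ h)).card) ?_
    ⟨C, hC, g ∘ h, fun v => hC1 _ _ _ (hh v) (hg _), rfl⟩
  rw [← hcard, ← Finset.image_image]
  refine lt_of_le_of_ne Finset.card_image_le fun heq => hne' ?_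
  rw [Finset.card_image_iff] at heq
  exact heq (by simp) (by simp) (by simp [g])

/-- The permutation of the merging classes induced by a relation of the family. -/
lemma exists_classMap [Finite V] {A : V → V → Prop} (hA : A ∈ T) :
    ∃ σ : Equiv.Perm (Quotient (⟨Merge T, hT.equivalence_merge⟩ : Setoid V)),
      ∀ x y, A x y → (Quotient.mk _ y) = σ (Quotient.mk _ x) := by
  choose a ha using hT.total A hA
  let S : Setoid V := ⟨Merge T, hT.equivalence_merge⟩
  let σ : Quotient S → Quotient S := Quotient.map a fun x y h => hT.merge_step hA (ha x) (ha y) h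
  have hinj : Function.Injective σ := by
    intro p q
    refine Quotient.inductionOn₂ p q fun x y h => ?_
    exact Quotient.sound (hT.merge_of_step hA (ha x) (ha y) (Quotient.exact h))
  refine ⟨Equiv.ofBijective σ (Finite.injective_iff_bijective.1 hinj), fun x y h => ?_⟩
  exact Quotient.sound (hT.merge_step hA h (ha x) (hT.merge_refl x))

/-- For every state `k`, some relation of the family preserves all merging classes and relates all
states of the class of `k` to `k`. -/
lemma exists_relation_to [Finite V] (k : V) :
    ∃ C ∈ T, (∀ x y, C x y → Merge T x y) ∧ ∀ x, Merge T x k → C x k := by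
  obtain ⟨A, hA, h, hh, hconst⟩ := hT.exists_selection
  -- Returning from `h k` to `k` turns the collapse of the class of `k` onto `h k` into a collapse
  -- onto `k`.
  obtain ⟨D, hD, hDk⟩ := hT.back A hA k (h k) (hh k)
  obtain ⟨B, hB, hB1, -⟩ := hT.comp A hA D hD
  have hBk : ∀ x, Merge T x k → B x k := fun x hx =>
    hB1 _ _ _ (hh x) (by rw [hconst x k hx]; exact hDk)
  obtain ⟨σ, hσ⟩ := hT.exists_classMap hB
  have hpow : ∀ m : ℕ, ∃ C ∈ T, (∀ x y, C x y → (Quotient.mk _ y) = (σ ^ (m + 1)) (Quotient.mk _ x)) ∧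
      ∀ x, Merge T x k → C x k := by
    intro m
    induction m with
    | zero => exact ⟨B, hB, by simpa using hσ, hBk⟩
    | succ m ih =>
      obtain ⟨C, hC, hC1, hC2⟩ := ih
      obtain ⟨C', hC', h1, -⟩ := hT.comp C hC B hB
      refine ⟨C', hC', fun x y hxy => ?_, fun x hx => h1 _ _ _ (hC2 x hx) (hBk k (hT.merge_refl k))⟩
      obtain ⟨u, hu⟩ := hT.total C hC x
      obtain ⟨v, hv⟩ := hT.total B hB u
      -- `C'` may be larger than the composite, but all `C'`-successors of `x` lie in one class, so
      -- the path through `u` and `v` determines it.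
      have h2 := hT.merge_step hC' hxy (h1 _ _ _ hu hv) (hT.merge_refl x)
      rw [pow_succ', Equiv.Perm.mul_apply, ← hC1 x u hu, ← hσ u v hv]
      exact Quotient.sound h2
  -- The permutation of the finitely many classes has finite order, so an iterate of `B` preserves
  -- every class.
  obtain ⟨C, hC, hC1, hC2⟩ := hpow (orderOf σ - 1)
  refine ⟨C, hC, fun x y hxy => ?_, hC2⟩
  have h3 := hC1 x y hxy
  rw [Nat.sub_add_cancel (orderOf_pos σ), pow_orderOf_eq_one] at h3
  exact Merge.symm (Quotient.exact h3)

/-- Some relation of a recurrent family is reflexive. -/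
theorem exists_reflexive [Finite V] : ∃ A ∈ T, ∀ x, A x x := by
  classical
  have := Fintype.ofFinite V
  have key : ∀ W : Finset V, ∃ C ∈ T, (∀ x y, C x y → Merge T x y) ∧
      ∀ w ∈ W, ∀ x, Merge T x w → C x w := by
    intro W
    induction W using Finset.induction_on with
    | empty =>
      by_cases hV : Nonempty V
      · obtain ⟨k⟩ := hV
        obtain ⟨C, hC, h1, -⟩ := hT.exists_relation_to k
        exact ⟨C, hC, h1, by simp⟩
      · obtain ⟨C, hC⟩ := hT.nonempty
        exact ⟨C, hC, fun x => (hV ⟨x⟩).elim, by simp⟩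
    | insert k W _ ih =>
      obtain ⟨C, hC, h1, h2⟩ := ih
      obtain ⟨D, hD, h3, h4⟩ := hT.exists_relation_to k
      -- `C` then `D` sends the class of `k` to `k`; `D` then `C` still sends the class of each `w ∈
      -- W` to `w`. The single relation `F` contains both composites.
      obtain ⟨F, hF, h5, h6⟩ := hT.comp C hC D hD
      refine ⟨F, hF, fun x y hxy => ?_, fun w hw x hx => ?_⟩
      · obtain ⟨u, hu⟩ := hT.total C hC x
        obtain ⟨v, hv⟩ := hT.total D hD u
        exact hT.merge_trans (hT.merge_trans (h1 _ _ hu) (h3 _ _ hv))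
          (hT.merge_step hF (h5 _ _ _ hu hv) hxy (hT.merge_refl x))
      · rcases Finset.mem_insert.1 hw with rfl | hw
        · obtain ⟨u, hu⟩ := hT.total C hC x
          exact h5 _ _ _ hu (h4 u (hT.merge_trans (h1 _ _ hu).symm hx))
        · obtain ⟨u, hu⟩ := hT.total D hD x
          exact h6 _ _ _ hu (h2 w hw u (hT.merge_trans (h3 _ _ hu).symm hx))
  obtain ⟨C, hC, -, h⟩ := key Finset.univ
  exact ⟨C, hC, fun x => h x (Finset.mem_univ x) x (hT.merge_refl x)⟩

end IsRecurrentFamily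

end FiniteRelations

end QPForced

namespace QPForced

/-! ### Forward transitivity and near returns of the base. -/

section Transitivity

/-- Forward topological transitivity from a dense two-sided orbit in a space without isolated
points. -/
lemma exists_pos_iterate_mem {X : Type*} [TopologicalSpace X] [T1Space X] (Φ : X ≃ₜ X) {p : X}
    (hp : Dense (Set.range fun n : ℤ => (Φ ^ n) p))
    (hinf : ∀ W : Set X, IsOpen W → W.Nonempty → W.Infinite)
    {U V : Set X} (hU : IsOpen U) (hU' : U.Nonempty) (hV : IsOpen V) (hV' : V.Nonempty) :
    ∃ n : ℕ, 1 ≤ n ∧ ∃ u ∈ U, (Φ ^ n) u ∈ V := by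
  obtain ⟨_, haU, a, rfl⟩ := hp.inter_open_nonempty U hU hU'
  obtain ⟨_, hbV, b, rfl⟩ := hp.inter_open_nonempty V hV hV'
  -- A visit to `W` at time `n` is a visit to `V` at time `n` and to `U` at time `n + a - b`. Two
  -- visits more than `|a - b|` apart therefore give a positive transit time from `U` to `V`,
  -- whichever end of the orbit accumulates.
  set W : Set X := V ∩ (Φ ^ (a - b)) ⁻¹' U with hW
  have hWo : IsOpen W := hV.inter (hU.preimage (Φ ^ (a - b)).continuous)
  have hbW : (Φ ^ b) p ∈ W := by
    refine ⟨hbV, ?_⟩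
    rw [Set.mem_preimage, ← Homeomorph.mul_apply, ← zpow_add]
    simpa using haU
  have hI : {n : ℤ | (Φ ^ n) p ∈ W}.Infinite := by
    intro hfin
    have hfin' := hfin.image (fun n : ℤ => (Φ ^ n) p)
    have hne : (W \ (fun n : ℤ => (Φ ^ n) p) '' {n : ℤ | (Φ ^ n) p ∈ W}).Nonempty :=
      ((hinf W hWo ⟨_, hbW⟩).sdiff hfin').nonempty
    obtain ⟨_, ⟨h1, h2⟩, n, rfl⟩ := hp.inter_open_nonempty _ (hWo.sdiff hfin'.isClosed) hne
    exact h2 ⟨n, h1, rfl⟩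
  obtain ⟨n₁, h₁, n₂, h₂, hlt⟩ : ∃ n₁, (Φ ^ n₁) p ∈ W ∧ ∃ n₂, (Φ ^ n₂) p ∈ W ∧
      |a - b| < n₂ - n₁ := by
    by_contra! hcon
    refine hI ((Set.finite_Icc (b - |a - b|) (b + |a - b|)).subset fun n hn => ?_)
    have h1 := hcon b hbW n hn
    have h2 := hcon n hn b hbW
    constructor <;> linarith
  have h0 : (0 : ℤ) < n₂ - n₁ - (a - b) := by
    have := le_abs_self (a - b); linarith
  refine ⟨(n₂ - n₁ - (a - b)).toNat, by omega, (Φ ^ (a - b)) ((Φ ^ n₁) p), h₁.2, ?_⟩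
  rw [← zpow_natCast, Int.toNat_of_nonneg h0.le, ← Homeomorph.mul_apply, ← Homeomorph.mul_apply,
    ← zpow_add, ← zpow_add]
  have : n₂ - n₁ - (a - b) + (a - b) + n₁ = n₂ := by ring
  rw [this]
  exact h₂.1

variable {Ω : Type*} [MetricSpace Ω]

lemma IsEquicontinuous.exists_dist_lt {θ : Ω ≃ₜ Ω} (hθ : IsEquicontinuous θ) {ε : ℝ} (hε : 0 < ε) :
    ∃ δ > 0, ∀ w₁ w₂ : Ω, dist w₁ w₂ < δ → ∀ n : ℤ, dist ((θ ^ n) w₁) ((θ ^ n) w₂) < ε := by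
  obtain ⟨c, hc, δ, hδ, h⟩ := hθ
  have hc0 : 0 < c := by linarith
  refine ⟨min δ (ε / c), by positivity, fun w₁ w₂ hw n => ?_⟩
  refine ((h w₁ w₂ (hw.trans_le (min_le_left _ _)) n).2).trans_lt ?_
  have := hw.trans_le (min_le_right _ _)
  rwa [lt_div_iff₀' hc0] at this

/-- For an equicontinuous homeomorphism with a dense orbit, an iterate that almost fixes one point
is uniformly close to the identity. -/
lemma IsEquicontinuous.exists_dist_iterate_lt {θ : Ω ≃ₜ Ω} (hθ : IsEquicontinuous θ) {w₀ : Ω}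
    (hw₀ : Dense (Set.range fun n : ℤ => (θ ^ n) w₀)) {η : ℝ} (hη : 0 < η) :
    ∃ η' > 0, ∀ (n : ℕ) (w : Ω), dist ((θ ^ n) w) w < η' → ∀ w', dist ((θ ^ n) w') w' < η := by
  obtain ⟨δ₁, hδ₁, h₁⟩ := hθ.exists_dist_lt (show 0 < η / 4 by positivity)
  obtain ⟨δ₂, hδ₂, h₂⟩ := hθ.exists_dist_lt (show 0 < min δ₁ (η / 4) / 2 by positivity)
  refine ⟨δ₁, hδ₁, fun n w hw w' => ?_⟩
  -- Along the dense orbit, `w'` is close to `θ ^ (k - m) w`. This power commutes with `θ ^ n` and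
  -- hardly distorts small distances, so the near return of `w` is carried to `w'`.
  obtain ⟨_, ⟨m, rfl⟩, hm⟩ := hw₀.exists_dist_lt w hδ₂
  obtain ⟨_, ⟨k, rfl⟩, hk⟩ := hw₀.exists_dist_lt w' (show 0 < min δ₁ (η / 4) / 2 by positivity)
  have e1 := h₂ _ _ hm (k - m)
  rw [← Homeomorph.mul_apply, ← zpow_add, sub_add_cancel] at e1
  have e2 : dist w' ((θ ^ (k - m)) w) < min δ₁ (η / 4) := by
    have := dist_triangle_right w' ((θ ^ (k - m)) w) ((θ ^ k) w₀)
    linarith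
  have e3 := h₁ _ _ (e2.trans_le (min_le_left _ _)) n
  have e4 := h₁ _ _ hw (k - m)
  have e5 : (θ ^ (k - m)) ((θ ^ n) w) = (θ ^ (n : ℤ)) ((θ ^ (k - m)) w) := by
    rw [← zpow_natCast, ← Homeomorph.mul_apply, ← Homeomorph.mul_apply, ← zpow_add, ← zpow_add,
      add_comm]
  rw [e5] at e4
  have e6 := e2.trans_le (min_le_right _ _)
  rw [← zpow_natCast]
  have t1 := dist_triangle4 ((θ ^ (n : ℤ)) w') ((θ ^ (n : ℤ)) ((θ ^ (k - m)) w))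
    ((θ ^ (k - m)) w) w'
  rw [dist_comm] at e6
  linarith

end Transitivity

/-! ### Pseudo-orbits along the fibers and simultaneous recurrence. -/

section Chains

variable {M Ω : Type*} [MetricSpace M] [MetricSpace Ω]

/-- The sequence `c` is, up to time `n`, a pseudo-orbit in the fibers over the orbit of `w`: its
jumps, all of them along the fibers, are smaller than `s`. -/
def IsFiberChain (f : Ω → M → M) (θ : Ω ≃ₜ Ω) (s : ℝ) (w : Ω) (n : ℕ) (c : ℕ → M) : Prop :=
  ∀ k < n, dist (f ((θ ^ k) w) (c k)) (c (k + 1)) < s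

variable {f : Ω → M → M} {θ : Ω ≃ₜ Ω}

lemma IsFiberChain.mono {s s' : ℝ} {w : Ω} {n : ℕ} {c : ℕ → M} (h : IsFiberChain f θ s w n c)
    (hs : s ≤ s') : IsFiberChain f θ s' w n c := fun k hk => (h k hk).trans_le hs

lemma IsFiberChain.append {s : ℝ} {w : Ω} {n m : ℕ} {c d : ℕ → M}
    (hc : IsFiberChain f θ s w n c) (hd : IsFiberChain f θ s ((θ ^ n) w) m d) (hcd : c n = d 0) :
    IsFiberChain f θ s w (n + m) fun k => if k < n then c k else d (k - n) := by
  intro k hk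
  by_cases h : k < n
  · by_cases h' : k + 1 < n
    · simpa [h, h'] using hc k h
    · have : k + 1 = n := by omega
      have h2 := hc k h
      rw [this, hcd] at h2
      simpa [h, h', this] using h2
  · have h' : ¬ k + 1 < n := by omega
    have h2 := hd (k - n) (by omega)
    rw [← Homeomorph.mul_apply, ← pow_add, Nat.sub_add_cancel (by omega)] at h2
    simp only [h, h', if_false]
    rwa [show k + 1 - n = k - n + 1 by omega]

lemma iterate_skew_snd {Φ : M × Ω ≃ₜ M × Ω} (hΦ : ∀ p, Φ p = (f p.2 p.1, θ p.2)) (n : ℕ)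
    (p : M × Ω) : ((Φ ^ n) p).2 = (θ ^ n) p.2 := by
  induction n with
  | zero => simp
  | succ n ih => rw [pow_succ', pow_succ', Homeomorph.mul_apply, Homeomorph.mul_apply, hΦ, ih]

lemma iterate_succ_skew_fst {Φ : M × Ω ≃ₜ M × Ω} (hΦ : ∀ p, Φ p = (f p.2 p.1, θ p.2)) (n : ℕ)
    (p : M × Ω) : ((Φ ^ (n + 1)) p).1 = f ((θ ^ n) p.2) ((Φ ^ n) p).1 := by
  rw [pow_succ', Homeomorph.mul_apply, hΦ, iterate_skew_snd hΦ]

/-- Reachability, by chains of length `n` with jumps smaller than `s`, between finitely many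
points over finitely many base points. -/
def chainRel (f : Ω → M → M) (θ : Ω ≃ₜ Ω) (F : Finset M) (L : Finset Ω) (s : ℝ) (n : ℕ)
    (u v : F × L) : Prop :=
  u.2 = v.2 ∧ ∃ c : ℕ → M, c 0 = u.1 ∧ c n = v.1 ∧ IsFiberChain f θ s u.2 n c

/-- The total relations that are contained in `chainRel f θ F L s n` for times `n ≥ 1` at which the
base returns arbitrarily closely. -/
def returnRelations (f : Ω → M → M) (θ : Ω ≃ₜ Ω) (F : Finset M) (L : Finset Ω) (s : ℝ) :
    Set (F × L → F × L → Prop) :=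
  {A | (∀ u, ∃ v, A u v) ∧ ∀ η > 0, ∃ n : ℕ, 1 ≤ n ∧ (∀ w, dist ((θ ^ n) w) w < η) ∧
    ∀ u v, A u v → chainRel f θ F L s n u v}

/-- Follow the true orbit and jump only at the last step, into the net. -/
lemma chainRel_total (F : Finset M) (L : Finset Ω) {s : ℝ} (hF : ∀ x, ∃ y ∈ F, dist x y < s)
    {n : ℕ} (hn : 1 ≤ n) (u : F × L) : ∃ v, chainRel f θ F L s n u v := by
  have hs : 0 < s := by
    obtain ⟨y, -, hy⟩ := hF u.1
    exact dist_nonneg.trans_lt hy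
  let c : ℕ → M := fun k => Nat.rec (u.1 : M) (fun k x => f ((θ ^ k) u.2) x) k
  obtain ⟨y, hyF, hy⟩ := hF (c n)
  refine ⟨(⟨y, hyF⟩, u.2), rfl, fun k => if k < n then c k else y, ?_, by simp, ?_⟩
  · simp [show 0 < n by omega, c]
  · intro k hk
    by_cases h : k + 1 < n
    · simpa [hk, h, c] using hs
    · have : n = k + 1 := by omega
      subst this
      simpa [c] using hy

/-- If reachability from `u` to `v` holds at arbitrarily precise return times, it is witnessed by a
member of `returnRelations`. -/
lemma exists_mem_returnRelations (F : Finset M) (L : Finset Ω) {s : ℝ}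
    (hF : ∀ x, ∃ y ∈ F, dist x y < s) {u v : F × L}
    (h : ∀ η > 0, ∃ n : ℕ, 1 ≤ n ∧ (∀ w, dist ((θ ^ n) w) w < η) ∧ chainRel f θ F L s n u v) :
    ∃ A ∈ returnRelations f θ F L s, A u v := by
  choose! n hn hR hc using fun k : ℕ => h (1 / ((k : ℝ) + 1)) (by positivity)
  -- There are finitely many relations on `F × L`, so one of them occurs for infinitely many `k`,
  -- hence at arbitrarily precise returns.
  obtain ⟨A, hA⟩ := Finite.exists_infinite_fiber fun k => chainRel f θ F L s (n k)
  rw [Set.infinite_coe_iff] at hA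
  refine ⟨A, ⟨fun u => ?_, fun η hη => ?_⟩, ?_⟩
  · obtain ⟨k, rfl⟩ := hA.nonempty
    exact chainRel_total F L hF (hn k) u
  · obtain ⟨N, hN⟩ := exists_nat_one_div_lt hη
    obtain ⟨k, rfl, hk⟩ := hA.exists_gt N
    refine ⟨n k, hn k, fun w => (hR k w).trans (lt_of_le_of_lt ?_ hN), fun _ _ h => h⟩
    gcongr
  · obtain ⟨k, rfl⟩ := hA.nonempty
    exact hc k

variable [CompactSpace M] [CompactSpace Ω]

lemma exists_dist_apply_lt (hf : Continuous fun p : M × Ω => f p.2 p.1) {ε : ℝ} (hε : 0 < ε) :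
    ∃ δ > 0, ∀ x x' w w', dist x x' < δ → dist w w' < δ → dist (f w x) (f w' x') < ε := by
  obtain ⟨δ, hδ, h⟩ := Metric.uniformContinuous_iff.1
    (CompactSpace.uniformContinuous_of_continuous hf) ε hε
  exact ⟨δ, hδ, fun x x' w w' h1 h2 => @h (x, w) (x', w') (max_lt h1 h2)⟩

/-- A chain over an orbit is also a chain, with slightly larger jumps, over nearby orbits. -/
lemma exists_isFiberChain_of_dist_lt (hf : Continuous fun p : M × Ω => f p.2 p.1)
    (hθ : IsEquicontinuous θ) {s s' : ℝ} (hs : s < s') :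
    ∃ δ > 0, ∀ (w w' : Ω) (n : ℕ) (c : ℕ → M), dist w w' < δ → IsFiberChain f θ s w n c →
      IsFiberChain f θ s' w' n c := by
  obtain ⟨δ₁, hδ₁, h₁⟩ := exists_dist_apply_lt hf (sub_pos.2 hs)
  obtain ⟨δ, hδ, h⟩ := hθ.exists_dist_lt hδ₁
  refine ⟨δ, hδ, fun w w' n c hw hc k hk => ?_⟩
  have h2 := h w w' hw k
  rw [zpow_natCast] at h2
  have h3 := h₁ (c k) (c k) _ _ (by simpa using hδ₁) h2
  have := dist_triangle_left (f ((θ ^ k) w') (c k)) (c (k + 1)) (f ((θ ^ k) w) (c k))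
  linarith [hc k hk]

variable {Φ : M × Ω ≃ₜ M × Ω}

/-- Under a transitive skew product over an equicontinuous homeomorphism, any two points of the
same fiber are joined by a chain whose length is a near-return time of the whole base. -/
lemma exists_isFiberChain_joining (hΦ : ∀ p, Φ p = (f p.2 p.1, θ p.2)) (hθ : IsEquicontinuous θ)
    {p : M × Ω} (hp : Dense (Set.range fun n : ℤ => (Φ ^ n) p))
    (hw₀ : Dense (Set.range fun n : ℤ => (θ ^ n) p.2))
    (hinf : ∀ W : Set (M × Ω), IsOpen W → W.Nonempty → W.Infinite)
    {s η : ℝ} (hs : 0 < s) (hη : 0 < η) (x x' : M) (w : Ω) :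
    ∃ n : ℕ, 1 ≤ n ∧ (∀ w', dist ((θ ^ n) w') w' < η) ∧
      ∃ c : ℕ → M, c 0 = x ∧ c n = x' ∧ IsFiberChain f θ s w n c := by
  have hf : Continuous fun p : M × Ω => f p.2 p.1 := by
    have : (fun p : M × Ω => f p.2 p.1) = fun p => (Φ p).1 := by ext p; rw [hΦ]
    rw [this]; exact continuous_fst.comp Φ.continuous
  obtain ⟨η', hη', hη'w⟩ := hθ.exists_dist_iterate_lt hw₀ hη
  obtain ⟨δ, hδ, hδf⟩ := exists_dist_apply_lt hf (show 0 < s / 2 by positivity)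
  obtain ⟨r, hr, hrθ⟩ := hθ.exists_dist_lt (show 0 < min δ (η' / 2) by positivity)
  have hm : 0 < min δ (s / 2) := by positivity
  have hrm : 0 < min r (η' / 2) := by positivity
  -- A true orbit segment runs from near `(x, w)` to near `(x', w)`. The chain moves it to the
  -- fibers over the orbit of `w` and replaces its two ends; each jump costs `s / 2` before and `s /
  -- 2` after the arrival point is changed.
  obtain ⟨n, hn, ⟨y, w₁⟩, ⟨hy, hw₁⟩, hV⟩ := exists_pos_iterate_mem Φ hp hinf
    (U := Metric.ball x (min δ (s / 2)) ×ˢ Metric.ball w (min r (η' / 2)))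
    (V := Metric.ball x' (min δ (s / 2)) ×ˢ Metric.ball w (min r (η' / 2)))
    (Metric.isOpen_ball.prod Metric.isOpen_ball)
    ⟨(x, w), Metric.mem_ball_self hm, Metric.mem_ball_self hrm⟩
    (Metric.isOpen_ball.prod Metric.isOpen_ball)
    ⟨(x', w), Metric.mem_ball_self hm, Metric.mem_ball_self hrm⟩
  obtain ⟨hV1, hV2⟩ := hV
  rw [Metric.mem_ball] at hy hw₁ hV1 hV2
  rw [iterate_skew_snd hΦ] at hV2
  simp only at hy hw₁ hV2
  have hθk : ∀ k : ℕ, dist ((θ ^ k) w) ((θ ^ k) w₁) < min δ (η' / 2) := fun k => by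
    have := hrθ w w₁ (by rw [dist_comm]; exact hw₁.trans_le (min_le_left _ _)) k
    rwa [zpow_natCast] at this
  refine ⟨n, hn, hη'w n w ?_, fun k => if k = 0 then x else if k = n then x' else
    ((Φ ^ k) (y, w₁)).1, by simp, by simp [show n ≠ 0 by omega], ?_⟩
  · have h1 := dist_triangle ((θ ^ n) w) ((θ ^ n) w₁) w
    have h2 := (hθk n).trans_le (min_le_right _ _)
    have h3 := hV2.trans_le (min_le_right _ _)
    linarith
  · set c : ℕ → M := fun k => if k = 0 then x else if k = n then x' else ((Φ ^ k) (y, w₁)).1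
    have hc : ∀ k, dist (c k) ((Φ ^ k) (y, w₁)).1 < min δ (s / 2) := by
      intro k
      by_cases h0 : k = 0
      · subst h0; simpa [c, dist_comm] using hy
      by_cases h1 : k = n
      · subst h1; rw [dist_comm]; simpa [c, h0] using hV1
      · simpa [c, h0, h1] using hm
    intro k _
    have h1 := hδf (c k) ((Φ ^ k) (y, w₁)).1 ((θ ^ k) w) ((θ ^ k) w₁)
      ((hc k).trans_le (min_le_left _ _)) ((hθk k).trans_le (min_le_left _ _))
    have h2 := (hc (k + 1)).trans_le (min_le_right _ _)
    rw [iterate_succ_skew_fst hΦ] at h2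
    simp only at h2
    have := dist_triangle_right (f ((θ ^ k) w) (c k)) (c (k + 1))
      (f ((θ ^ k) w₁) ((Φ ^ k) (y, w₁)).1)
    linarith

/-- Composition of return relations, at the cost of slightly larger jumps. -/
lemma exists_comp_returnRelations (hf : Continuous fun p : M × Ω => f p.2 p.1)
    (hθ : IsEquicontinuous θ) (F : Finset M) (L : Finset Ω) {s s' : ℝ} (hs : s < s')
    {A B : F × L → F × L → Prop} (hA : A ∈ returnRelations f θ F L s)
    (hB : B ∈ returnRelations f θ F L s) :
    ∃ C ∈ returnRelations f θ F L s', (∀ x y z, A x y → B y z → C x z) ∧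
      ∀ x y z, B x y → A y z → C x z := by
  -- Lengths add commutatively, so both composites are realized at the same time `n + m`.
  refine ⟨fun x z => (∃ y, A x y ∧ B y z) ∨ ∃ y, B x y ∧ A y z, ⟨fun x => ?_, fun η hη => ?_⟩,
    fun x y z h1 h2 => Or.inl ⟨y, h1, h2⟩, fun x y z h1 h2 => Or.inr ⟨y, h1, h2⟩⟩
  · obtain ⟨y, hy⟩ := hA.1 x
    obtain ⟨z, hz⟩ := hB.1 y
    exact ⟨z, Or.inl ⟨y, hy, hz⟩⟩
  obtain ⟨δ, hδ, hchain⟩ := exists_isFiberChain_of_dist_lt hf hθ hs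
  obtain ⟨n, hn, hnR, hnA⟩ := hA.2 (min δ (η / 2)) (by positivity)
  obtain ⟨m, hm, hmR, hmB⟩ := hB.2 (min δ (η / 2)) (by positivity)
  have key : ∀ n m : ℕ, (∀ w, dist ((θ ^ n) w) w < min δ (η / 2)) → ∀ u v z,
      chainRel f θ F L s n u v → chainRel f θ F L s m v z → chainRel f θ F L s' (n + m) u z := by
    rintro n m hR u v z ⟨h1, c, hc0, hcn, hc⟩ ⟨h2, d, hd0, hdn, hd⟩
    rw [← h1] at hd
    -- The second chain is given over `u.2` but must start over `θ ^ n u.2`; this transport costs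
    -- the increase from `s` to `s'`.
    have hd' := hchain _ ((θ ^ n) u.2) _ _ (by
      rw [dist_comm]; exact (hR _).trans_le (min_le_left _ _)) hd
    refine ⟨h1.trans h2, _, ?_, ?_, (hc.mono hs.le).append hd' (hcn.trans hd0.symm)⟩
    · by_cases h0 : 0 < n
      · simp [h0, hc0]
      · have : n = 0 := by omega
        subst this
        simp [hd0, ← hcn, hc0]
    · simp [hdn]
  refine ⟨n + m, by omega, fun w => ?_, fun u z huz => ?_⟩
  · rw [pow_add, Homeomorph.mul_apply]
    have h1 := (hnR ((θ ^ m) w)).trans_le (min_le_right _ _)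
    have h2 := (hmR w).trans_le (min_le_right _ _)
    linarith [dist_triangle ((θ ^ n) ((θ ^ m) w)) ((θ ^ m) w) w]
  · rcases huz with ⟨y, h1, h2⟩ | ⟨y, h1, h2⟩
    · exact key n m hnR _ _ _ (hnA _ _ h1) (hmB _ _ h2)
    · rw [add_comm]
      exact key m n hmR _ _ _ (hmB _ _ h1) (hnA _ _ h2)

/-- Simultaneous recurrence: finitely many points over finitely many base points return to
themselves along chains of one common length, at which the whole base nearly returns. -/
theorem exists_simultaneous_closed_chains (hΦ : ∀ p, Φ p = (f p.2 p.1, θ p.2))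
    (hθ : IsEquicontinuous θ)
    {p : M × Ω} (hp : Dense (Set.range fun n : ℤ => (Φ ^ n) p))
    (hw₀ : Dense (Set.range fun n : ℤ => (θ ^ n) p.2))
    (hinf : ∀ W : Set (M × Ω), IsOpen W → W.Nonempty → W.Infinite)
    {δ η : ℝ} (hδ : 0 < δ) (hη : 0 < η) (F : Finset M) (L : Finset Ω) :
    ∃ n : ℕ, 1 ≤ n ∧ (∀ w, dist ((θ ^ n) w) w < η) ∧
      ∀ x ∈ F, ∀ w ∈ L, ∃ c : ℕ → M, c 0 = x ∧ c n = x ∧ IsFiberChain f θ δ w n c := by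
  classical
  have hf : Continuous fun p : M × Ω => f p.2 p.1 := by
    have : (fun p : M × Ω => f p.2 p.1) = fun p => (Φ p).1 := by ext p; rw [hΦ]
    rw [this]; exact continuous_fst.comp Φ.continuous
  obtain ⟨N, -, hNfin, hN⟩ := (isCompact_univ (X := M)).finite_cover_balls
    (show 0 < δ / 2 by positivity)
  set F' : Finset M := F ∪ hNfin.toFinset with hF'
  -- Composition enlarges the jumps. But a finite state set carries only finitely many families of
  -- relations, so two jump sizes `s < s'` give the same family, which is then closed under
  -- composition.
  obtain ⟨s, s', hs, hss', hs', heq⟩ : ∃ s s' : ℝ, δ / 2 < s ∧ s < s' ∧ s' < δ ∧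
      returnRelations f θ F' L s = returnRelations f θ F' L s' := by
    have : Infinite (Set.Ioo (δ / 2) δ) := (Set.Ioo_infinite (by linarith)).to_subtype
    obtain ⟨s, s', hne, heq⟩ := Finite.exists_ne_map_eq_of_infinite
      fun s : Set.Ioo (δ / 2) δ => returnRelations f θ F' L s
    rcases lt_or_gt_of_ne hne with h | h
    · exact ⟨s, s', s.2.1, h, s'.2.2, heq⟩
    · exact ⟨s', s, s'.2.1, h, s.2.2, heq.symm⟩
  have hnet : ∀ x, ∃ y ∈ F', dist x y < s := by
    intro x
    have hx := hN (Set.mem_univ x)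
    simp only [Set.mem_iUnion, Metric.mem_ball] at hx
    obtain ⟨y, hy, hxy⟩ := hx
    exact ⟨y, by simp [hF', hy], hxy.trans hs⟩
  have hjoin : ∀ u v : F' × L, u.2 = v.2 → ∃ A ∈ returnRelations f θ F' L s, A u v := by
    intro u v huv
    refine exists_mem_returnRelations F' L hnet fun η hη => ?_
    obtain ⟨n, hn, hR, c, h0, h1, hc⟩ := exists_isFiberChain_joining hΦ hθ hp hw₀ hinf
      (show 0 < s by linarith) hη u.1 v.1 u.2
    exact ⟨n, hn, hR, huv, c, h0, h1, hc⟩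
  by_cases hne : Nonempty (F' × L)
  · obtain ⟨u₀⟩ := hne
    have hT : IsRecurrentFamily (returnRelations f θ F' L s) :=
      { nonempty := (hjoin u₀ u₀ rfl).imp fun A h => h.1
        total := fun A hA => hA.1
        comp := fun A hA B hB => by
          rw [heq]
          exact exists_comp_returnRelations hf hθ F' L hss' hA hB
        back := fun A hA u v huv => by
          obtain ⟨n, -, -, h⟩ := hA.2 1 one_pos
          exact hjoin v u (h u v huv).1.symm }
    obtain ⟨A, hA, hrefl⟩ := hT.exists_reflexive
    obtain ⟨n, hn, hR, h⟩ := hA.2 η hη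
    refine ⟨n, hn, hR, fun x hx w hw => ?_⟩
    have hx' : x ∈ F' := by simp [hF', hx]
    obtain ⟨-, c, h0, h1, hc⟩ := h _ _ (hrefl (⟨x, hx'⟩, ⟨w, hw⟩))
    exact ⟨c, h0, h1, hc.mono (by linarith)⟩
  · obtain ⟨n, hn, hR, -⟩ := exists_isFiberChain_joining hΦ hθ hp hw₀ hinf hδ hη p.1 p.1 p.2
    refine ⟨n, hn, hR, fun x hx w hw => (hne ⟨(⟨x, ?_⟩, ⟨w, hw⟩)⟩).elim⟩
    simp [hF', hx]

end Chains

end QPForced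

namespace QPForced

/-! ### Perturbations of hyperbolic sequences of linear maps. -/

section HyperbolicSequences

variable {F : Type*} [NormedAddCommGroup F] [NormedSpace ℝ F]

/-- A sequence of linear maps that preserves a sequence of splittings, given by the projections
`p k`, and contracts by `μ` along the kernels, forward, and along the ranges, backward. -/
structure IsHyperbolicSequence (C μ : ℝ) (p L : ℤ → F →ₗ[ℝ] F) : Prop where
  idem : ∀ k v, p k (p k v) = p k v
  norm_proj : ∀ k v, ‖p k v‖ ≤ C * ‖v‖
  norm_compl : ∀ k v, ‖v - p k v‖ ≤ C * ‖v‖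
  comm : ∀ k v, p (k + 1) (L k v) = L k (p k v)
  contract : ∀ k v, ‖L k (v - p k v)‖ ≤ μ * ‖v - p k v‖
  expand : ∀ k v, ‖p k v‖ ≤ μ * ‖L k (p k v)‖
  surj : ∀ k v, ∃ u, p k u = u ∧ L k u = p (k + 1) v

namespace IsHyperbolicSequence

variable {C μ : ℝ} {p L : ℤ → F →ₗ[ℝ] F} (h : IsHyperbolicSequence C μ p L)
include h

lemma proj_sub_proj (k : ℤ) (v : F) : p k (v - p k v) = 0 := by
  rw [map_sub, h.idem, sub_self]

/-- One step of the comparison of two bounded sequences of which each coordinate determines the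
stable part of the next one and the unstable part of the previous one. -/
lemma norm_le_of_step (hμ0 : 0 ≤ μ) (hμ1 : μ ≤ 1) (hC : 0 ≤ C) {κ b : ℝ} {w w' d : ℤ → F}
    (hb : ∀ k, ‖p k (w k)‖ ≤ b ∧ ‖w k - p k (w k)‖ ≤ b)
    (hd : ∀ k, ‖d k‖ ≤ κ * ‖w k‖) (hκ : 0 ≤ κ)
    (hs : ∀ k, w' (k + 1) - p (k + 1) (w' (k + 1)) =
      (L k (w k) + d k) - p (k + 1) (L k (w k) + d k))
    (hu : ∀ k, L k (p k (w' k)) = p (k + 1) (w (k + 1) - d k)) (k : ℤ) :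
    ‖p k (w' k)‖ ≤ (μ + 2 * C * κ) * b ∧ ‖w' k - p k (w' k)‖ ≤ (μ + 2 * C * κ) * b := by
  have hw : ∀ k, ‖w k‖ ≤ 2 * b := fun k => by
    have := norm_add_le (p k (w k)) (w k - p k (w k))
    rw [add_sub_cancel] at this
    linarith [(hb k).1, (hb k).2]
  have hd' : ∀ k, C * ‖d k‖ ≤ 2 * C * κ * b := fun k => by
    have h1 : ‖d k‖ ≤ κ * (2 * b) := (hd k).trans (mul_le_mul_of_nonneg_left (hw k) hκ)
    nlinarith [mul_le_mul_of_nonneg_left h1 hC]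
  have hb0 : 0 ≤ b := (norm_nonneg _).trans (hb 0).1
  have hC2 : 0 ≤ 2 * C * κ * b := by positivity
  constructor
  · have h1 := h.expand k (w' k)
    rw [hu, map_sub] at h1
    have h2 := norm_sub_le (p (k + 1) (w (k + 1))) (p (k + 1) (d k))
    have h3 := (h.norm_proj (k + 1) (d k)).trans (hd' k)
    have h4 : ‖p (k + 1) (w (k + 1)) - p (k + 1) (d k)‖ ≤ b + 2 * C * κ * b := by
      linarith [(hb (k + 1)).1]
    have h5 := mul_le_mul_of_nonneg_left h4 hμ0
    nlinarith [mul_le_mul_of_nonneg_right hμ1 hC2]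
  · obtain ⟨j, rfl⟩ : ∃ j, k = j + 1 := ⟨k - 1, by ring⟩
    rw [hs]
    have h1 : L j (w j) + d j - p (j + 1) (L j (w j) + d j) =
        L j (w j - p j (w j)) + (d j - p (j + 1) (d j)) := by
      rw [map_add, h.comm, map_sub]; abel
    rw [h1]
    have h2 := norm_add_le (L j (w j - p j (w j))) (d j - p (j + 1) (d j))
    have h3 := (h.norm_compl (j + 1) (d j)).trans (hd' j)
    have h4 := (h.contract j (w j)).trans (mul_le_mul_of_nonneg_left (hb j).2 hμ0)
    nlinarith

/-- Nonlinear perturbations of a hyperbolic sequence have at most one small bounded orbit. -/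
lemma eq_of_bounded_orbits (hμ0 : 0 ≤ μ) (hC : 0 ≤ C) {κ ρ : ℝ} (hκ : 0 ≤ κ)
    (hθ : μ + 2 * C * κ < 1) {G : ℤ → F → F}
    (hG : ∀ k v v', ‖v‖ ≤ ρ → ‖v'‖ ≤ ρ → ‖G k v - G k v' - L k (v - v')‖ ≤ κ * ‖v - v'‖)
    {z z' : ℤ → F} (hz : ∀ k, ‖z k‖ ≤ ρ) (hz' : ∀ k, ‖z' k‖ ≤ ρ)
    (hzG : ∀ k, z (k + 1) = G k (z k)) (hzG' : ∀ k, z' (k + 1) = G k (z' k)) : z = z' := by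
  have hCκ : 0 ≤ 2 * C * κ := by positivity
  set t := μ + 2 * C * κ with ht
  have ht0 : 0 ≤ t := by positivity
  set w : ℤ → F := fun k => z k - z' k with hw
  set d : ℤ → F := fun k => G k (z k) - G k (z' k) - L k (w k) with hd
  have hwd : ∀ k, w (k + 1) = L k (w k) + d k := fun k => by
    simp only [hd, hw, hzG, hzG']; abel
  -- The difference `w` of the orbits satisfies both recursions of `norm_le_of_step` with `w' = w`,
  -- so every bound for it improves by the factor `t`.
  have hbound : ∀ n : ℕ, ∀ k, ‖p k (w k)‖ ≤ t ^ n * (C * (2 * ρ)) ∧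
      ‖w k - p k (w k)‖ ≤ t ^ n * (C * (2 * ρ)) := by
    intro n
    induction n with
    | zero =>
      intro k
      have h1 : ‖w k‖ ≤ 2 * ρ := by
        have := norm_sub_le (z k) (z' k)
        linarith [hz k, hz' k]
      have h2 := mul_le_mul_of_nonneg_left h1 hC
      simp only [pow_zero, one_mul]
      exact ⟨(h.norm_proj k _).trans h2, (h.norm_compl k _).trans h2⟩
    | succ n ih =>
      have := h.norm_le_of_step hμ0 (by linarith) hC (w := w) (w' := w) (d := d) ih
        (fun k => hG k _ _ (hz k) (hz' k)) hκ (fun k => by rw [hwd])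
        (fun k => by rw [hwd, add_sub_cancel_right, h.comm])
      intro k
      rw [pow_succ', mul_assoc]
      exact this k
  have hlim : Filter.Tendsto (fun n : ℕ => t ^ n * (C * (2 * ρ))) Filter.atTop (𝓝 0) := by
    simpa using (tendsto_pow_atTop_nhds_zero_of_lt_one ht0 hθ).mul_const (C * (2 * ρ))
  ext k
  have h1 : ‖p k (w k)‖ ≤ 0 := ge_of_tendsto' hlim fun n => (hbound n k).1
  have h2 : ‖w k - p k (w k)‖ ≤ 0 := ge_of_tendsto' hlim fun n => (hbound n k).2
  rw [norm_le_zero_iff] at h1 h2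
  rw [h1, sub_zero] at h2
  exact sub_eq_zero.1 h2

/-- Nonlinear perturbations of a hyperbolic sequence that almost fix `0` have a small bounded
orbit. -/
lemma exists_bounded_orbit [CompleteSpace F] (hμ0 : 0 ≤ μ) (hC : 0 ≤ C) {κ r : ℝ} (hκ : 0 ≤ κ)
    (hθ : μ + 2 * C * κ < 1) {G : ℤ → F → F}
    (hG : ∀ k v v', ‖v‖ ≤ 2 * r → ‖v'‖ ≤ 2 * r →
      ‖G k v - G k v' - L k (v - v')‖ ≤ κ * ‖v - v'‖)
    (hG0 : ∀ k, C * ‖G k 0‖ ≤ (1 - (μ + 2 * C * κ)) * r) :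
    ∃ z : ℤ → F, (∀ k, ‖z k‖ ≤ 2 * r) ∧ ∀ k, z (k + 1) = G k (z k) := by
  have hCκ : 0 ≤ 2 * C * κ := by positivity
  set t := μ + 2 * C * κ with ht
  have ht0 : 0 ≤ t := by positivity
  have hr : 0 ≤ r := by
    have h1 : 0 ≤ (1 - t) * r := (mul_nonneg hC (norm_nonneg (G 0 0))).trans (hG0 0)
    exact nonneg_of_mul_nonneg_right h1 (by linarith)
  -- `J` need be neither linear nor continuous: `expand` bounds differences in the range of `p k`
  -- through their images under `L k`.
  choose J hJ hLJ using h.surj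
  let R : ℤ → F → F := fun k v => G k v - L k v
  have hR : ∀ k v v', ‖v‖ ≤ 2 * r → ‖v'‖ ≤ 2 * r → ‖R k v - R k v'‖ ≤ κ * ‖v - v'‖ := by
    intro k v v' hv hv'
    have := hG k v v' hv hv'
    rw [map_sub] at this
    convert this using 2
    simp only [R]; abel
  -- The stable part at `k` is pushed forward from `k - 1`, the unstable part pulled back from `k +
  -- 1`. Fixed points are orbits of `G`, and `Ψ` contracts the supremum of the two component norms
  -- by `t`.
  let Ψ : (ℤ → F) → ℤ → F := fun z k =>
    (G (k - 1) (z (k - 1)) - p k (G (k - 1) (z (k - 1)))) + J k (z (k + 1) - R k (z k))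
  have hΨp : ∀ z k, p k (Ψ z k) = J k (z (k + 1) - R k (z k)) := fun z k => by
    simp only [Ψ, map_add, h.proj_sub_proj, zero_add, hJ]
  have hΨq : ∀ z k, Ψ z (k + 1) - p (k + 1) (Ψ z (k + 1)) = G k (z k) - p (k + 1) (G k (z k)) :=
    fun z k => by
      rw [hΨp]
      simp only [Ψ, add_sub_cancel_right]
  have hΨu : ∀ z k, L k (p k (Ψ z k)) = p (k + 1) (z (k + 1) - R k (z k)) := fun z k => by
    rw [hΨp, hLJ]
  have hsmall : ∀ {z : ℤ → F}, (∀ k, ‖p k (z k)‖ ≤ r ∧ ‖z k - p k (z k)‖ ≤ r) →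
      ∀ k, ‖z k‖ ≤ 2 * r := by
    intro z hz k
    have := norm_add_le (p k (z k)) (z k - p k (z k))
    rw [add_sub_cancel] at this
    linarith [(hz k).1, (hz k).2]
  have hstep : ∀ {z z' : ℤ → F} {b : ℝ}, (∀ k, ‖p k (z k)‖ ≤ r ∧ ‖z k - p k (z k)‖ ≤ r) →
      (∀ k, ‖p k (z' k)‖ ≤ r ∧ ‖z' k - p k (z' k)‖ ≤ r) →
      (∀ k, ‖p k (z k - z' k)‖ ≤ b ∧ ‖(z k - z' k) - p k (z k - z' k)‖ ≤ b) →
      ∀ k, ‖p k (Ψ z k - Ψ z' k)‖ ≤ t * b ∧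
        ‖(Ψ z k - Ψ z' k) - p k (Ψ z k - Ψ z' k)‖ ≤ t * b := by
    intro z z' b hz hz' hzz'
    refine h.norm_le_of_step hμ0 (by linarith) hC (w := fun k => z k - z' k)
      (w' := fun k => Ψ z k - Ψ z' k) (d := fun k => R k (z k) - R k (z' k)) hzz'
      (fun k => hR k _ _ (hsmall hz k) (hsmall hz' k)) hκ (fun k => ?_) (fun k => ?_)
    · have e1 : L k (z k - z' k) + (R k (z k) - R k (z' k)) = G k (z k) - G k (z' k) := by
        simp only [R, map_sub]; abel
      rw [e1, map_sub, map_sub]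
      have e2 := hΨq z k
      have e3 := hΨq z' k
      calc _ = (Ψ z (k + 1) - p (k + 1) (Ψ z (k + 1))) -
            (Ψ z' (k + 1) - p (k + 1) (Ψ z' (k + 1))) := by abel
        _ = _ := by rw [e2, e3]; abel
    · rw [map_sub, map_sub, hΨu, hΨu, ← map_sub]
      congr 1; abel
  have hΨ0 : ∀ k, ‖p k (Ψ 0 k)‖ ≤ (1 - t) * r ∧ ‖Ψ 0 k - p k (Ψ 0 k)‖ ≤ (1 - t) * r := by
    intro k
    constructor
    · have h1 := h.expand k (Ψ 0 k)
      rw [hΨu] at h1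
      have h2 := h.norm_proj (k + 1) (-(G k 0))
      rw [norm_neg] at h2
      replace h2 := h2.trans (hG0 k)
      simp only [Pi.zero_apply, R, map_zero, sub_zero, zero_sub] at h1
      nlinarith [norm_nonneg (p (k + 1) (-(G k 0)))]
    · obtain ⟨j, rfl⟩ : ∃ j, k = j + 1 := ⟨k - 1, by ring⟩
      rw [hΨq]
      exact (h.norm_compl _ _).trans (hG0 j)
  let z : ℕ → ℤ → F := fun n => Ψ^[n] 0
  have hzs : ∀ n, z (n + 1) = Ψ (z n) := fun n => Function.iterate_succ_apply' Ψ n 0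
  -- The first iterate moves each component by at most `(1 - t) * r`. Summing the geometric series
  -- keeps components within `r` and norms within `2 * r`, where `hG` applies.
  have hmain : ∀ n, (∀ k, ‖p k (z n k)‖ ≤ (1 - t ^ n) * r ∧
        ‖z n k - p k (z n k)‖ ≤ (1 - t ^ n) * r) ∧
      ∀ k, ‖p k (z (n + 1) k - z n k)‖ ≤ t ^ n * ((1 - t) * r) ∧
        ‖(z (n + 1) k - z n k) - p k (z (n + 1) k - z n k)‖ ≤ t ^ n * ((1 - t) * r) := by
    have hle : ∀ n : ℕ, (1 - t ^ n) * r ≤ r := fun n => by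
      nlinarith [pow_nonneg ht0 n, mul_nonneg (pow_nonneg ht0 n) hr]
    intro n
    induction n with
    | zero =>
      refine ⟨fun k => by simp [z], fun k => ?_⟩
      simpa [z] using hΨ0 k
    | succ n ih =>
      obtain ⟨ih1, ih2⟩ := ih
      have hnext : ∀ k, ‖p k (z (n + 1) k)‖ ≤ (1 - t ^ (n + 1)) * r ∧
          ‖z (n + 1) k - p k (z (n + 1) k)‖ ≤ (1 - t ^ (n + 1)) * r := by
        intro k
        have e : (1 - t ^ (n + 1)) * r = (1 - t ^ n) * r + t ^ n * ((1 - t) * r) := by ring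
        rw [e]
        constructor
        · have := norm_add_le (p k (z n k)) (p k (z (n + 1) k - z n k))
          rw [← map_add, add_sub_cancel] at this
          linarith [(ih1 k).1, (ih2 k).1]
        · have := norm_add_le (z n k - p k (z n k))
            ((z (n + 1) k - z n k) - p k (z (n + 1) k - z n k))
          have e2 : z n k - p k (z n k) + (z (n + 1) k - z n k - p k (z (n + 1) k - z n k)) =
              z (n + 1) k - p k (z (n + 1) k) := by rw [map_sub]; abel
          rw [e2] at this
          linarith [(ih1 k).2, (ih2 k).2]
      refine ⟨hnext, fun k => ?_⟩
      rw [hzs (n + 1), pow_succ', mul_assoc]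
      nth_rw 2 4 6 [hzs n]
      exact hstep (fun k => ⟨(hnext k).1.trans (hle _), (hnext k).2.trans (hle _)⟩)
        (fun k => ⟨(ih1 k).1.trans (hle _), (ih1 k).2.trans (hle _)⟩) ih2 k
  have hnr : ∀ n k, ‖p k (z n k)‖ ≤ r ∧ ‖z n k - p k (z n k)‖ ≤ r := fun n k => by
    have hle : (1 - t ^ n) * r ≤ r := by
      nlinarith [pow_nonneg ht0 n, mul_nonneg (pow_nonneg ht0 n) hr]
    exact ⟨((hmain n).1 k).1.trans hle, ((hmain n).1 k).2.trans hle⟩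
  have hdist : ∀ k n, dist (z n k) (z (n + 1) k) ≤ 2 * ((1 - t) * r) * t ^ n := by
    intro k n
    rw [dist_comm, dist_eq_norm]
    have h1 := (hmain n).2 k
    have h2 := norm_add_le (p k (z (n + 1) k - z n k))
      ((z (n + 1) k - z n k) - p k (z (n + 1) k - z n k))
    rw [add_sub_cancel] at h2
    linarith [h1.1, h1.2]
  choose Z hZ using fun k => cauchySeq_tendsto_of_complete
    (cauchySeq_of_le_geometric t _ hθ (hdist k))
  have hpc : ∀ k, Continuous (p k) := fun k =>
    ((p k).mkContinuous C (h.norm_proj k)).continuous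
  have hZr : ∀ k, ‖p k (Z k)‖ ≤ r ∧ ‖Z k - p k (Z k)‖ ≤ r := fun k => by
    have h1 := ((hpc k).tendsto (Z k)).comp (hZ k)
    exact ⟨le_of_tendsto' h1.norm fun n => (hnr n k).1,
      le_of_tendsto' ((hZ k).sub h1).norm fun n => (hnr n k).2⟩
  have hb : ∀ n k, ‖Z k - z n k‖ ≤ 2 * r * t ^ n := fun n k => by
    have := dist_le_of_le_geometric_of_tendsto t _ hθ (hdist k) (hZ k) n
    rw [dist_comm, dist_eq_norm] at this
    convert this using 1
    field_simp [show (1 - t) ≠ 0 by linarith]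
  have hΨZ : ∀ n k, ‖Ψ Z k - z (n + 1) k‖ ≤ 2 * (t * (C * (2 * r * t ^ n))) := fun n k => by
    rw [hzs]
    have h1 := hstep hZr (hnr n) (b := C * (2 * r * t ^ n)) (fun k =>
      ⟨(h.norm_proj k _).trans (mul_le_mul_of_nonneg_left (hb n k) hC),
        (h.norm_compl k _).trans (mul_le_mul_of_nonneg_left (hb n k) hC)⟩) k
    have h2 := norm_add_le (p k (Ψ Z k - Ψ (z n) k))
      ((Ψ Z k - Ψ (z n) k) - p k (Ψ Z k - Ψ (z n) k))
    rw [add_sub_cancel] at h2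
    linarith [h1.1, h1.2]
  have hfix : ∀ k, Ψ Z k = Z k := fun k => by
    have h1 : Filter.Tendsto (fun n => 2 * (t * (C * (2 * r * t ^ n)))) Filter.atTop (𝓝 0) := by
      have := tendsto_pow_atTop_nhds_zero_of_lt_one ht0 hθ
      simpa using ((((this.const_mul (2 * r)).const_mul C).const_mul t).const_mul 2)
    have h2 : Filter.Tendsto (fun n => Ψ Z k - z (n + 1) k) Filter.atTop (𝓝 0) :=
      squeeze_zero_norm (fun n => hΨZ n k) h1
    have h3 := ((hZ k).comp (Filter.tendsto_add_atTop_nat 1)).const_sub (Ψ Z k)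
    exact sub_eq_zero.1 (tendsto_nhds_unique h3 h2)
  refine ⟨Z, hsmall hZr, fun k => ?_⟩
  -- At the fixed point, `e1` equates the stable parts of `Z (k + 1)` and `G k (Z k)`, and `e2` the
  -- unstable parts.
  have e1 := hΨq Z k
  have e2 := hΨu Z k
  rw [hfix] at e1 e2
  rw [← h.comm, map_sub] at e2
  have e3 : p (k + 1) (Z (k + 1)) = p (k + 1) (G k (Z k)) := by
    have : p (k + 1) (R k (Z k)) = p (k + 1) (G k (Z k)) - p (k + 1) (L k (Z k)) := by
      simp only [R, map_sub]
    rw [this] at e2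
    have e4 := sub_eq_zero.2 e2
    rw [← sub_eq_zero, ← neg_eq_zero, ← e4]
    abel
  rw [e3] at e1
  exact sub_left_injective e1

end IsHyperbolicSequence

/-- If `P` and `P'` are idempotents that are close to each other, `P` maps the range of `P'` onto
the range of `P`. -/
lemma exists_proj_proj_eq [FiniteDimensional ℝ F] {P P' : F →ₗ[ℝ] F} {C τ : ℝ}
    (hP : ∀ v, P (P v) = P v) (hC : ∀ v, ‖P v‖ ≤ C * ‖v‖) (hτ : ∀ v, ‖P' v - P v‖ ≤ τ * ‖v‖)
    (hC0 : 0 ≤ C) (hτ0 : 0 ≤ τ) (hCτ : C * (τ * C) < 1) (v : F) : ∃ u, P (P' u) = P v := by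
  -- On the range of `P`, `P ∘ P'` is the identity minus `B`, and `B` has norm below `1`. In finite
  -- dimension, injectivity of `id - B` is enough.
  let B : F →ₗ[ℝ] F := P ∘ₗ (P - P') ∘ₗ P
  have hB : ∀ v, ‖B v‖ ≤ C * (τ * C) * ‖v‖ := by
    intro v
    calc ‖P (P (P v) - P' (P v))‖ ≤ C * ‖P (P v) - P' (P v)‖ := hC _
      _ ≤ C * (τ * ‖P v‖) := by
        gcongr; rw [norm_sub_rev]; exact hτ _
      _ ≤ C * (τ * (C * ‖v‖)) := by gcongr; exact hC v
      _ = _ := by ring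
  have hinj : Function.Injective (LinearMap.id - B : F →ₗ[ℝ] F) := by
    rw [← LinearMap.ker_eq_bot, LinearMap.ker_eq_bot']
    intro m hm
    have h1 : m = B m := sub_eq_zero.1 hm
    have h2 := hB m
    rw [← h1] at h2
    by_contra hne
    nlinarith [norm_pos_iff.2 hne]
  obtain ⟨w, hw⟩ := (LinearMap.injective_iff_surjective.1 hinj) (P v)
  refine ⟨P w, ?_⟩
  have h1 : w - B w = P v := hw
  have h2 := congrArg P h1
  have h3 : P (P (P w) - P' (P w)) = B w := rfl
  rw [map_sub, hP, hP] at h3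
  rw [map_sub, hP, show P (B w) = B w from hP _, ← h3] at h2
  rw [← h2]; abel

/-- A sequence of linear maps that respects two slightly different sequences of splittings is close
to a sequence that preserves one of them. -/
lemma exists_isHyperbolicSequence [FiniteDimensional ℝ F] {C D τ ν : ℝ} {p p' A : ℤ → F →ₗ[ℝ] F}
    (hν : 0 < ν) (hC0 : 0 ≤ C) (hD0 : 0 ≤ D) (hτ0 : 0 ≤ τ) (hτ1 : τ < 1)
    (hCτ : C * (τ * C) < 1)
    (hp : ∀ k v, p k (p k v) = p k v)
    (hpC : ∀ k v, ‖p k v‖ ≤ C * ‖v‖) (hqC : ∀ k v, ‖v - p k v‖ ≤ C * ‖v‖)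
    (hτ : ∀ k v, ‖p' k v - p (k + 1) v‖ ≤ τ * ‖v‖)
    (hA : ∀ k v, p' k (A k v) = A k (p k v)) (hAD : ∀ k v, ‖A k v‖ ≤ D * ‖v‖)
    (hAu : ∀ k v, ν * ‖p k v‖ ≤ ‖A k (p k v)‖)
    (hAs : ∀ k v, ν * ‖A k (v - p k v)‖ ≤ ‖v - p k v‖)
    (hsurj : ∀ k v, ∃ u, A k (p k u) = p' k v) :
    ∃ L : ℤ → F →ₗ[ℝ] F, IsHyperbolicSequence C (max ((1 + τ) / ν) (1 / ((1 - τ) * ν))) p L ∧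
      ∀ k v, ‖L k v - A k v‖ ≤ 2 * τ * C * D * ‖v‖ := by
  -- The block-diagonal part of `A` for the projections `p`. As `A` intertwines `p k` with `p' k`,
  -- which is `τ`-close to `p (k + 1)`, the two discarded blocks have norm at most `τ * C * D` each.
  let L : ℤ → F →ₗ[ℝ] F := fun k =>
    p (k + 1) ∘ₗ A k ∘ₗ p k + (LinearMap.id - p (k + 1)) ∘ₗ A k ∘ₗ (LinearMap.id - p k)
  have hL : ∀ k v, L k v = p (k + 1) (A k (p k v)) +
      (A k (v - p k v) - p (k + 1) (A k (v - p k v))) := fun k v => rfl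
  have hLp : ∀ k v, L k (p k v) = p (k + 1) (A k (p k v)) := fun k v => by
    rw [hL, hp, sub_self, map_zero, map_zero, sub_zero, add_zero]
  have hLq : ∀ k v, L k (v - p k v) = A k (v - p k v) - p (k + 1) (A k (v - p k v)) :=
    fun k v => by
      rw [hL, map_sub, hp, sub_self, map_zero, map_zero, zero_add, sub_zero]
  have hτp : ∀ k v, ‖A k (p k v) - p (k + 1) (A k (p k v))‖ ≤ τ * ‖A k (p k v)‖ := fun k v => by
    have := hτ k (A k (p k v))
    rwa [hA, hp] at this
  have hτq : ∀ k v, ‖p (k + 1) (A k (v - p k v))‖ ≤ τ * ‖A k (v - p k v)‖ := fun k v => by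
    have := hτ k (A k (v - p k v))
    rwa [hA, map_sub, hp, sub_self, map_zero, zero_sub, norm_neg] at this
  refine ⟨L, ⟨hp, hpC, hqC, fun k v => ?_, fun k v => ?_, fun k v => ?_, fun k v => ?_⟩,
    fun k v => ?_⟩
  · rw [hLp, hL, map_add, map_sub, hp, hp, sub_self, add_zero]
  · rw [hLq]
    have h1 := norm_sub_le (A k (v - p k v)) (p (k + 1) (A k (v - p k v)))
    have h2 := hτq k v
    have h3 : ‖A k (v - p k v)‖ ≤ ‖v - p k v‖ / ν := by
      rw [le_div_iff₀' hν]; exact hAs k v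
    calc _ ≤ (1 + τ) * ‖A k (v - p k v)‖ := by linarith
      _ ≤ (1 + τ) * (‖v - p k v‖ / ν) := by gcongr
      _ = (1 + τ) / ν * ‖v - p k v‖ := by ring
      _ ≤ _ := by gcongr; exact le_max_left _ _
  · rw [hLp]
    have h1 := norm_sub_norm_le (A k (p k v)) (p (k + 1) (A k (p k v)))
    have h2 := hτp k v
    have h3 := hAu k v
    have h4 : (1 - τ) * ν * ‖p k v‖ ≤ ‖p (k + 1) (A k (p k v))‖ := by
      nlinarith [mul_le_mul_of_nonneg_left h3 (sub_nonneg.2 hτ1.le)]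
    have h5 : 0 < (1 - τ) * ν := mul_pos (by linarith) hν
    calc ‖p k v‖ ≤ ‖p (k + 1) (A k (p k v))‖ / ((1 - τ) * ν) := by rwa [le_div_iff₀' h5]
      _ = 1 / ((1 - τ) * ν) * ‖p (k + 1) (A k (p k v))‖ := by ring
      _ ≤ _ := by gcongr; exact le_max_right _ _
  · obtain ⟨u, hu⟩ := exists_proj_proj_eq (hp (k + 1)) (hpC (k + 1)) (hτ k) hC0 hτ0 hCτ v
    obtain ⟨w, hw⟩ := hsurj k u
    exact ⟨p k w, hp k w, by rw [hLp, hw, hu]⟩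
  · have e : L k v - A k v = -p (k + 1) (A k (v - p k v)) -
        (A k (p k v) - p (k + 1) (A k (p k v))) := by
      have : A k v = A k (p k v) + A k (v - p k v) := by rw [← map_add, add_sub_cancel]
      rw [hL, this]; abel
    rw [e]
    calc _ ≤ τ * ‖A k (v - p k v)‖ + τ * ‖A k (p k v)‖ :=
          (norm_sub_le _ _).trans (add_le_add (by rw [norm_neg]; exact hτq k v) (hτp k v))
      _ ≤ τ * (D * (C * ‖v‖)) + τ * (D * (C * ‖v‖)) := by
        gcongr
        · exact (hAD _ _).trans (by gcongr; exact hqC k v)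
        · exact (hAD _ _).trans (by gcongr; exact hpC k v)
      _ = _ := by ring

end HyperbolicSequences

end QPForced

namespace QPForced

/-! ### Hyperbolic atlases: expansivity and shadowing in the fibers. -/

section HyperbolicCharts

variable {M Ω : Type*} [MetricSpace M] [MetricSpace Ω]

/-- The sequence `y` is an orbit in the fibers over the orbit of `w`. -/
def IsFiberOrbit (f : Ω → M → M) (θ : Ω ≃ₜ Ω) (w : Ω) (y : ℤ → M) : Prop :=
  ∀ k : ℤ, y (k + 1) = f ((θ ^ k) w) (y k)

/-- Charts `χ x` centered at the points `x` of `M`, uniformly comparable to the metric, and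
projections `p x w`, such that the maps `f w` are in these charts uniformly close to linear maps
that almost preserve the splittings given by `p`, expanding the ranges of `p` and contracting the
kernels. -/
structure IsHyperbolicAtlas {F : Type*} [NormedAddCommGroup F] [NormedSpace ℝ F]
    (f : Ω → M → M) (θ : Ω ≃ₜ Ω) (χ : M → OpenPartialHomeomorph M F)
    (p : M → Ω → F →ₗ[ℝ] F) (C D ν : ℝ) : Prop where
  center : ∀ x, x ∈ (χ x).source ∧ χ x x = 0
  chart_small : ∀ ρ > 0, ∃ ε > 0, ∀ x y, dist x y ≤ ε → y ∈ (χ x).source ∧ ‖χ x y‖ ≤ ρ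
  symm_small : ∀ ε > 0, ∃ ρ > 0, ∀ x v, ‖v‖ ≤ ρ → v ∈ (χ x).target ∧ dist ((χ x).symm v) x ≤ ε
  C_nonneg : 0 ≤ C
  D_nonneg : 0 ≤ D
  one_lt : 1 < ν
  idem : ∀ x w v, p x w (p x w v) = p x w v
  norm_proj : ∀ x w v, ‖p x w v‖ ≤ C * ‖v‖
  norm_compl : ∀ x w v, ‖v - p x w v‖ ≤ C * ‖v‖
  step : ∀ τ > 0, ∃ δ > 0, ∃ ρ > 0, ∀ x x' w, dist (f w x) x' < δ →
    ∃ A P' : F →ₗ[ℝ] F, (∀ v, ‖P' v - p x' (θ w) v‖ ≤ τ * ‖v‖) ∧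
      (∀ v, P' (A v) = A (p x w v)) ∧ (∀ v, ‖A v‖ ≤ D * ‖v‖) ∧
      (∀ v, ν * ‖p x w v‖ ≤ ‖A (p x w v)‖) ∧
      (∀ v, ν * ‖A (v - p x w v)‖ ≤ ‖v - p x w v‖) ∧
      (∀ v, ∃ u, A (p x w u) = P' v) ∧
      (∀ v, ‖v‖ ≤ ρ → f w ((χ x).symm v) ∈ (χ x').source) ∧
      ∀ v v', ‖v‖ ≤ ρ → ‖v'‖ ≤ ρ →
        ‖χ x' (f w ((χ x).symm v)) - χ x' (f w ((χ x).symm v')) - A (v - v')‖ ≤ τ * ‖v - v'‖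

namespace IsHyperbolicAtlas

variable {F : Type*} [NormedAddCommGroup F] [NormedSpace ℝ F] [FiniteDimensional ℝ F]
  {f : Ω → M → M} {θ : Ω ≃ₜ Ω} {χ : M → OpenPartialHomeomorph M F}
  {p : M → Ω → F →ₗ[ℝ] F} {C D ν : ℝ} (h : IsHyperbolicAtlas f θ χ p C D ν)
include h

/-- Along pseudo-orbits, the maps read in the charts are small Lipschitz perturbations of a
hyperbolic sequence. -/
lemma exists_linearization : ∃ μ κ δ ρ : ℝ, 0 ≤ μ ∧ 0 ≤ κ ∧ μ + 2 * C * κ < 1 ∧ 0 < δ ∧ 0 < ρ ∧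
    ∀ (w : Ω) (x : ℤ → M), (∀ k : ℤ, dist (f ((θ ^ k) w) (x k)) (x (k + 1)) < δ) →
      ∃ L : ℤ → F →ₗ[ℝ] F, IsHyperbolicSequence C μ (fun k => p (x k) ((θ ^ k) w)) L ∧
        ∀ k, (∀ v, ‖v‖ ≤ ρ → f ((θ ^ k) w) ((χ (x k)).symm v) ∈ (χ (x (k + 1))).source) ∧
          ∀ v v', ‖v‖ ≤ ρ → ‖v'‖ ≤ ρ →
            ‖χ (x (k + 1)) (f ((θ ^ k) w) ((χ (x k)).symm v)) -
              χ (x (k + 1)) (f ((θ ^ k) w) ((χ (x k)).symm v')) - L k (v - v')‖ ≤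
                κ * ‖v - v'‖ := by
  have hν := h.one_lt
  have hC := h.C_nonneg
  have hD := h.D_nonneg
  -- At `τ = 0` the last expression equals `1 / ν < 1`, so continuity allows a small positive `τ`.
  obtain ⟨τ, hτ0, hτ1, hCτ, hlt⟩ : ∃ τ : ℝ, 0 < τ ∧ τ < 1 ∧ C * (τ * C) < 1 ∧
      max ((1 + τ) / ν) (1 / ((1 - τ) * ν)) + 2 * C * (τ + 2 * τ * C * D) < 1 := by
    have e0 : ∀ᶠ τ in 𝓝[>] (0 : ℝ), 0 < τ := self_mem_nhdsWithin
    have e1 : ∀ᶠ τ in 𝓝[>] (0 : ℝ), τ < 1 :=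
      nhdsWithin_le_nhds (eventually_lt_nhds one_pos)
    have c2 : ContinuousAt (fun τ : ℝ => C * (τ * C)) 0 := by fun_prop
    have e2 : ∀ᶠ τ in 𝓝[>] (0 : ℝ), C * (τ * C) < 1 :=
      nhdsWithin_le_nhds (c2.eventually_lt_const (by simp))
    have c3 : ContinuousAt (fun τ : ℝ => max ((1 + τ) / ν) (1 / ((1 - τ) * ν)) +
        2 * C * (τ + 2 * τ * C * D)) 0 := by
      have : (1 - (0 : ℝ)) * ν ≠ 0 := by simp; linarith
      fun_prop (disch := assumption)
    have e3 := nhdsWithin_le_nhds (s := Set.Ioi 0) (c3.eventually_lt_const (u := 1) (by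
      simpa using inv_lt_one_of_one_lt₀ hν))
    obtain ⟨τ, h0, h1, h2, h3⟩ := (e0.and (e1.and (e2.and e3))).exists
    exact ⟨τ, h0, h1, h2, h3⟩
  obtain ⟨δ, hδ, ρ, hρ, hstep⟩ := h.step τ hτ0
  refine ⟨max ((1 + τ) / ν) (1 / ((1 - τ) * ν)), τ + 2 * τ * C * D, δ, ρ,
    le_max_of_le_left (by positivity), by positivity, hlt, hδ, hρ, fun w x hx => ?_⟩
  choose A P' h1 h2 h3 h4 h5 h6 h7 h8 using fun k => hstep (x k) (x (k + 1)) ((θ ^ k) w) (hx k)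
  have hθk : ∀ k : ℤ, θ ((θ ^ k) w) = (θ ^ (k + 1)) w := fun k => by
    rw [add_comm, zpow_add, zpow_one, Homeomorph.mul_apply]
  obtain ⟨L, hL, hLA⟩ := exists_isHyperbolicSequence (p := fun k => p (x k) ((θ ^ k) w)) (p' := P')
    (A := A) (ν := ν) (by linarith) hC hD hτ0.le hτ1 hCτ (fun k => h.idem _ _)
    (fun k => h.norm_proj _ _) (fun k => h.norm_compl _ _) (fun k v => by rw [← hθk]; exact h1 k v)
    h2 h3 h4 h5 h6
  refine ⟨L, hL, fun k => ⟨h7 k, fun v v' hv hv' => ?_⟩⟩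
  have e1 := h8 k v v' hv hv'
  have e2 := hLA k (v - v')
  rw [norm_sub_rev] at e2
  calc _ ≤ _ := norm_sub_le_norm_sub_add_norm_sub _ (A k (v - v')) _
    _ ≤ τ * ‖v - v'‖ + 2 * τ * C * D * ‖v - v'‖ := add_le_add e1 e2
    _ = _ := by ring

/-- Expansivity in the fibers. -/
theorem exists_expansive : ∃ ε > 0, ∀ (w : Ω) (y y' : ℤ → M), IsFiberOrbit f θ w y →
    IsFiberOrbit f θ w y' → (∀ k, dist (y k) (y' k) ≤ ε) → y = y' := by
  obtain ⟨μ, κ, δ, ρ, hμ, hκ, hlt, hδ, hρ, hlin⟩ := h.exists_linearization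
  obtain ⟨ε, hε, hsmall⟩ := h.chart_small ρ hρ
  refine ⟨ε, hε, fun w y y' hy hy' hd => ?_⟩
  obtain ⟨L, hL, hG⟩ := hlin w y fun k => by rw [← hy, dist_self]; exact hδ
  have hs := fun k => hsmall _ _ (hd k)
  -- In the charts centered along `y`, the orbit `y` itself becomes the zero sequence.
  have key := hL.eq_of_bounded_orbits hμ h.C_nonneg hκ hlt
    (G := fun k v => χ (y (k + 1)) (f ((θ ^ k) w) ((χ (y k)).symm v))) (ρ := ρ)
    (fun k => (hG k).2) (z := fun k => χ (y k) (y' k)) (z' := 0) (fun k => (hs k).2)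
    (fun k => by simpa using hρ.le) (fun k => by
      rw [(χ (y k)).left_inv (hs k).1, hy'])
    (fun k => by
      have h0 : (χ (y k)).symm 0 = y k := by
        rw [← (h.center (y k)).2, (χ (y k)).left_inv (h.center (y k)).1]
      simp only [Pi.zero_apply]
      rw [h0, ← hy, (h.center _).2])
  ext k
  refine (χ (y k)).injOn (h.center _).1 (hs k).1 ?_
  rw [(h.center _).2]
  exact (congrFun key k).symm

/-- Shadowing in the fibers. -/
theorem exists_shadowing {ε : ℝ} (hε : 0 < ε) : ∃ δ > 0, ∀ (w : Ω) (x : ℤ → M),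
    (∀ k : ℤ, dist (f ((θ ^ k) w) (x k)) (x (k + 1)) < δ) →
      ∃ y, IsFiberOrbit f θ w y ∧ ∀ k, dist (y k) (x k) ≤ ε := by
  obtain ⟨μ, κ, δ, ρ, hμ, hκ, hlt, hδ, hρ, hlin⟩ := h.exists_linearization
  obtain ⟨ρ', hρ', hsymm⟩ := h.symm_small ε hε
  have hC := h.C_nonneg
  set t := μ + 2 * C * κ with ht
  set r := min ρ ρ' / 2 with hr
  have hr0 : 0 < r := by positivity
  have ht1 : 0 < 1 - t := by linarith
  -- In the charts centered at the `x k`, `G k 0` is the jump at time `k`. This is the smallness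
  -- that `exists_bounded_orbit` asks of it, with `C + 1` in place of `C` to allow `C = 0`.
  obtain ⟨ε', hε', hsmall⟩ := h.chart_small ((1 - t) * r / (C + 1)) (by positivity)
  refine ⟨min δ ε', by positivity, fun w x hx => ?_⟩
  obtain ⟨L, hL, hG⟩ := hlin w x fun k => (hx k).trans_le (min_le_left _ _)
  have h2r : ∀ {v : F}, ‖v‖ ≤ 2 * r → ‖v‖ ≤ ρ := fun hv => hv.trans (by
    have := min_le_left ρ ρ'; linarith)
  have h2r' : ∀ {v : F}, ‖v‖ ≤ 2 * r → ‖v‖ ≤ ρ' := fun hv => hv.trans (by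
    have := min_le_right ρ ρ'; linarith)
  have : CompleteSpace F := FiniteDimensional.complete ℝ F
  obtain ⟨z, hz, hzG⟩ := hL.exists_bounded_orbit hμ hC hκ hlt (r := r)
    (G := fun k v => χ (x (k + 1)) (f ((θ ^ k) w) ((χ (x k)).symm v)))
    (fun k v v' hv hv' => (hG k).2 v v' (h2r hv) (h2r hv'))
    (fun k => by
      have h0 : (χ (x k)).symm 0 = x k := by
        rw [← (h.center (x k)).2, (χ (x k)).left_inv (h.center (x k)).1]
      simp only [h0]
      have h1 := (hsmall (x (k + 1)) (f ((θ ^ k) w) (x k)) (by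
        rw [dist_comm]; exact ((hx k).trans_le (min_le_right _ _)).le)).2
      rw [le_div_iff₀ (by positivity)] at h1
      nlinarith [norm_nonneg (χ (x (k + 1)) (f ((θ ^ k) w) (x k)))])
  refine ⟨fun k => (χ (x k)).symm (z k), fun k => ?_, fun k => (hsymm _ _ (h2r' (hz k))).2⟩
  simp only
  rw [hzG, (χ (x (k + 1))).left_inv ((hG k).1 _ (h2r (hz k)))]

end IsHyperbolicAtlas

end HyperbolicCharts

end QPForced

namespace QPForced

/-! ### Joint continuity of the fiber maps and of their derivatives in charts. -/

section ChartContinuity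

variable {E : Type*} [NormedAddCommGroup E] {M : Type*} [TopologicalSpace M] [ChartedSpace E M]

/-- The expression of `h : M → M` in the preferred charts at `p` and `q`. -/
noncomputable def inCharts (p q : M) (h : M → M) : E → E :=
  fun y => chartAt E q (h ((chartAt E p).symm y))

lemma isOpen_inCharts_domain {p q : M} {h : M → M} (hh : Continuous h) :
    IsOpen {y : E | y ∈ (chartAt E p).target ∧ h ((chartAt E p).symm y) ∈ (chartAt E q).source} :=
  ((chartAt E p).continuousOn_symm.isOpen_inter_preimage (chartAt E p).open_target
    ((chartAt E q).open_source.preimage hh))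

variable [NormedSpace ℝ E] [IsManifold 𝓘(ℝ, E) ∞ M] {Ω : Type*} [TopologicalSpace Ω]

lemma contDiffOn_inCharts {p q : M} {h : M → M} (hh : ContMDiff 𝓘(ℝ, E) 𝓘(ℝ, E) 2 h) :
    ContDiffOn ℝ 2 (inCharts p q h)
      {y : E | y ∈ (chartAt E p).target ∧ h ((chartAt E p).symm y) ∈ (chartAt E q).source} := by
  rw [← contMDiffOn_iff_contDiffOn]
  have h1 : ContMDiffOn 𝓘(ℝ, E) 𝓘(ℝ, E) 2 (chartAt E p).symm (chartAt E p).target :=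
    contMDiffOn_chart_symm
  have h2 : ContMDiffOn 𝓘(ℝ, E) 𝓘(ℝ, E) 2 (chartAt E q) (chartAt E q).source :=
    contMDiffOn_chart
  exact h2.comp ((hh.comp_contMDiffOn h1).mono fun y hy => hy.1) fun y hy => hy.2

variable {f : Ω → M ≃ₘ^2⟮𝓘(ℝ, E), 𝓘(ℝ, E)⟯ M}

/-- A basic neighbourhood of the `C^2` topology controls the map and its derivative on a compact
set; both are recovered from `iteratedFDeriv` of orders `0` and `1` by evaluation on constant
tuples. -/
lemma eventually_inCharts_close [T2Space M] [LocallyCompactSpace M] (hf : Continuous f) {p q x₀ : M}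
    {w₀ : Ω} (hx : x₀ ∈ (chartAt E p).source) (hfx : f w₀ x₀ ∈ (chartAt E q).source) {ε : ℝ}
    (hε : 0 < ε) :
    ∃ K ∈ 𝓝 x₀, K ⊆ (chartAt E p).source ∧ ∀ᶠ w in 𝓝 w₀, ∀ x ∈ K,
      f w x ∈ (chartAt E q).source ∧
      ‖inCharts p q (f w) (chartAt E p x) - inCharts p q (f w₀) (chartAt E p x)‖ < ε ∧
      ‖fderiv ℝ (inCharts p q (f w)) (chartAt E p x) -
        fderiv ℝ (inCharts p q (f w₀)) (chartAt E p x)‖ ≤ ε := by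
  have hopen : IsOpen ((chartAt E p).source ∩ f w₀ ⁻¹' (chartAt E q).source) :=
    (chartAt E p).open_source.inter ((chartAt E q).open_source.preimage (f w₀).continuous)
  obtain ⟨K, hK, hKs, hKc⟩ := local_compact_nhds (hopen.mem_nhds ⟨hx, hfx⟩)
  refine ⟨K, hK, fun x hx => (hKs hx).1, ?_⟩
  have hN : IsOpen (cTwoNhd (f w₀) (chartAt E p) (chartAt E q) K ε) :=
    TopologicalSpace.isOpen_generateFrom_of_mem ⟨f w₀, chartAt E p, chartAt E q, K, ε,
      IsManifold.chart_mem_maximalAtlas p, IsManifold.chart_mem_maximalAtlas q, hKc,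
      fun x hx => (hKs hx).1, fun x hx => (hKs hx).2, hε, rfl⟩
  have hmem : f w₀ ∈ cTwoNhd (f w₀) (chartAt E p) (chartAt E q) K ε :=
    ⟨fun x hx => (hKs hx).2, fun x _ k _ => by simpa using hε⟩
  filter_upwards [hf.continuousAt.preimage_mem_nhds (hN.mem_nhds hmem)] with w hw x hxK
  refine ⟨hw.1 x hxK, ?_, ?_⟩
  · have h0 : ‖iteratedFDeriv ℝ 0 (inCharts p q (f w)) (chartAt E p x) -
        iteratedFDeriv ℝ 0 (inCharts p q (f w₀)) (chartAt E p x)‖ < ε :=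
      hw.2 x hxK 0 (by norm_num)
    refine lt_of_le_of_lt ?_ h0
    have := ContinuousMultilinearMap.le_opNorm
      (iteratedFDeriv ℝ 0 (inCharts p q (f w)) (chartAt E p x) -
        iteratedFDeriv ℝ 0 (inCharts p q (f w₀)) (chartAt E p x)) (fun _ => 0)
    simpa using this
  · have h1 : ‖iteratedFDeriv ℝ 1 (inCharts p q (f w)) (chartAt E p x) -
        iteratedFDeriv ℝ 1 (inCharts p q (f w₀)) (chartAt E p x)‖ < ε :=
      hw.2 x hxK 1 (by norm_num)
    refine le_trans (ContinuousLinearMap.opNorm_le_bound _ (norm_nonneg _) fun v => ?_) h1.le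
    have := ContinuousMultilinearMap.le_opNorm
      (iteratedFDeriv ℝ 1 (inCharts p q (f w)) (chartAt E p x) -
        iteratedFDeriv ℝ 1 (inCharts p q (f w₀)) (chartAt E p x)) (fun _ => v)
    simpa [iteratedFDeriv_one_apply] using this

/-- Closeness to `f w₀` uniformly on a neighbourhood of `x₀`, combined with continuity of `f w₀`.
The same scheme gives `continuousOn_fderiv_inCharts`. -/
lemma continuous_apply [T2Space M] [LocallyCompactSpace M] (hf : Continuous f) :
    Continuous fun z : M × Ω => f z.2 z.1 := by
  rw [continuous_iff_continuousAt]
  rintro ⟨x₀, w₀⟩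
  set a := chartAt E x₀
  set b := chartAt E (f w₀ x₀)
  have hx : x₀ ∈ a.source := mem_chart_source E x₀
  have hfx : f w₀ x₀ ∈ b.source := mem_chart_source E _
  have hb : Filter.Tendsto (fun z : M × Ω => b (f z.2 z.1)) (𝓝 (x₀, w₀)) (𝓝 (b (f w₀ x₀))) := by
    rw [Metric.tendsto_nhds]
    intro ε hε
    obtain ⟨K, hK, hKs, hw⟩ := eventually_inCharts_close hf hx hfx (half_pos hε)
    have hc : ContinuousAt (fun x => b (f w₀ x)) x₀ :=
      (b.continuousAt hfx).comp (f w₀).continuous.continuousAt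
    have h1 := Metric.tendsto_nhds.1 hc (ε / 2) (half_pos hε)
    rw [nhds_prod_eq]
    filter_upwards [((h1.and hK).prod_mk hw)] with z hz
    obtain ⟨⟨h2, h3⟩, h4⟩ := hz
    have h5 := (h4 z.1 h3).2.1
    simp only [inCharts] at h5
    rw [a.left_inv (hKs h3), ← dist_eq_norm] at h5
    linarith [dist_triangle (b (f z.2 z.1)) (b (f w₀ z.1)) (b (f w₀ x₀))]
  have hev : ∀ᶠ z : M × Ω in 𝓝 (x₀, w₀), b.symm (b (f z.2 z.1)) = f z.2 z.1 := by
    obtain ⟨K, hK, hKs, hw⟩ := eventually_inCharts_close hf hx hfx one_pos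
    rw [nhds_prod_eq]
    filter_upwards [(Filter.Eventually.prod_mk hK hw)] with z hz
    exact b.left_inv (hz.2 z.1 hz.1).1
  have h1 := (b.continuousAt_symm (b.map_source hfx)).tendsto.comp hb
  rw [b.left_inv hfx] at h1
  exact h1.congr' hev

/-- The domain of the expressions of the maps `f w` in the charts at `p` and `q`. -/
def chartDomain (f : Ω → M ≃ₘ^2⟮𝓘(ℝ, E), 𝓘(ℝ, E)⟯ M) (p q : M) : Set (E × Ω) :=
  {z | z.1 ∈ (chartAt E p).target ∧ f z.2 ((chartAt E p).symm z.1) ∈ (chartAt E q).source}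

lemma isOpen_chartDomain [T2Space M] [LocallyCompactSpace M] (hf : Continuous f) (p q : M) :
    IsOpen (chartDomain f p q) := by
  have h1 : ContinuousOn (fun z : E × Ω => f z.2 ((chartAt E p).symm z.1))
      ((chartAt E p).target ×ˢ Set.univ) :=
    (continuous_apply hf).comp_continuousOn (f := fun z : E × Ω => ((chartAt E p).symm z.1, z.2))
      (((chartAt E p).continuousOn_symm.comp continuousOn_fst fun z hz => hz.1).prodMk
        continuousOn_snd)
  convert h1.isOpen_inter_preimage ((chartAt E p).open_target.prod isOpen_univ)
    (chartAt E q).open_source using 1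
  ext z
  simp [chartDomain]

lemma continuousOn_fderiv_inCharts [T2Space M] [LocallyCompactSpace M] (hf : Continuous f)
    (p q : M) :
    ContinuousOn (fun z : E × Ω => fderiv ℝ (inCharts p q (f z.2)) z.1) (chartDomain f p q) := by
  rintro ⟨y₀, w₀⟩ ⟨hy, hfy⟩
  simp only at hy hfy
  refine ContinuousAt.continuousWithinAt ?_
  rw [ContinuousAt, Metric.tendsto_nhds]
  intro ε hε
  obtain ⟨K, hK, hKs, hw⟩ := eventually_inCharts_close hf ((chartAt E p).map_target hy) hfy
    (show 0 < ε / 2 by positivity)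
  have hc : ContinuousAt (fderiv ℝ (inCharts p q (f w₀))) y₀ :=
    ((contDiffOn_inCharts (f w₀).contMDiff).continuousOn_fderiv_of_isOpen
      (isOpen_inCharts_domain (f w₀).continuous) (by norm_num)).continuousAt
      ((isOpen_inCharts_domain (f w₀).continuous).mem_nhds ⟨hy, hfy⟩)
  have h1 := Metric.tendsto_nhds.1 hc (ε / 2) (half_pos hε)
  have h2 := ((chartAt E p).continuousAt_symm hy).preimage_mem_nhds hK
  have h3 := (chartAt E p).open_target.mem_nhds hy
  rw [nhds_prod_eq]
  filter_upwards [((h1.and (Filter.Eventually.and h2 h3)).prod_mk hw)] with z hz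
  obtain ⟨⟨h4, h5, h6⟩, h7⟩ := hz
  have h8 := (h7 _ h5).2.2
  rw [(chartAt E p).right_inv h6, ← dist_eq_norm] at h8
  exact lt_of_le_of_lt (dist_triangle _ (fderiv ℝ (inCharts p q (f w₀)) z.1) _) (by linarith)

lemma hasFDerivAt_inCharts {p q : M} {h : M ≃ₘ^2⟮𝓘(ℝ, E), 𝓘(ℝ, E)⟯ M} {y : E}
    (hy : y ∈ (chartAt E p).target) (hhy : h ((chartAt E p).symm y) ∈ (chartAt E q).source) :
    HasFDerivAt (inCharts p q h) (fderiv ℝ (inCharts p q h) y) y :=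
  (((contDiffOn_inCharts h.contMDiff).differentiableOn (by norm_num)).differentiableAt
    ((isOpen_inCharts_domain h.continuous).mem_nhds ⟨hy, hhy⟩)).hasFDerivAt

/-- The chain rule relating the derivative in charts to the derivative on the manifold. -/
lemma fderiv_inCharts_comp {p q : M} {h : M ≃ₘ^2⟮𝓘(ℝ, E), 𝓘(ℝ, E)⟯ M} {x : M}
    (hx : x ∈ (chartAt E p).source) (hhx : h x ∈ (chartAt E q).source)
    (v : TangentSpace 𝓘(ℝ, E) x) :
    fderiv ℝ (inCharts p q h) (chartAt E p x)
      ((trivializationAt E (TangentSpace 𝓘(ℝ, E)) p).continuousLinearMapAt ℝ x v) =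
    (trivializationAt E (TangentSpace 𝓘(ℝ, E)) q).continuousLinearMapAt ℝ (h x)
      (mfderiv 𝓘(ℝ, E) 𝓘(ℝ, E) h x v) := by
  rw [TangentBundle.continuousLinearMapAt_trivializationAt hx,
    TangentBundle.continuousLinearMapAt_trivializationAt hhx]
  have hy := (chartAt E p).map_source hx
  have h1 : MDifferentiableAt 𝓘(ℝ, E) 𝓘(ℝ, E) (extChartAt 𝓘(ℝ, E) p) x :=
    mdifferentiableAt_extChartAt hx
  have h2 : MDifferentiableAt 𝓘(ℝ, E) 𝓘(ℝ, E) (extChartAt 𝓘(ℝ, E) q) (h x) :=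
    mdifferentiableAt_extChartAt hhx
  have h3 : MDifferentiableAt 𝓘(ℝ, E) 𝓘(ℝ, E) h x :=
    (h.contMDiff.mdifferentiable (by norm_num)) x
  have h4 :=
    (hasFDerivAt_inCharts hy (by rwa [(chartAt E p).left_inv hx])).hasMFDerivAt
  have h5 := h4.comp x (f := extChartAt 𝓘(ℝ, E) p) h1.hasMFDerivAt
  have h6 := h2.hasMFDerivAt.comp x h3.hasMFDerivAt
  have heq : (inCharts p q h ∘ extChartAt 𝓘(ℝ, E) p) =ᶠ[𝓝 x] extChartAt 𝓘(ℝ, E) q ∘ h := by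
    filter_upwards [(chartAt E p).open_source.mem_nhds hx] with z hz
    simp [inCharts, (chartAt E p).left_inv hz]
  have h7 := hasMFDerivAt_unique h5 (h6.congr_of_eventuallyEq heq)
  exact congrArg (fun A => A v) h7

end ChartContinuity

end QPForced

namespace QPForced

/-! ### Continuity of the invariant splitting in tangent coordinates. -/

section Splittings

variable {E : Type*} [NormedAddCommGroup E] [NormedSpace ℝ E]

/-- The linear combinations of two finite families of vectors. -/
noncomputable def frameMap {k l : ℕ} (V : Fin k → E) (W : Fin l → E) :
    ((Fin k → ℝ) × (Fin l → ℝ)) →L[ℝ] E :=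
  ∑ i, ((ContinuousLinearMap.proj i).comp
      (ContinuousLinearMap.fst ℝ (Fin k → ℝ) (Fin l → ℝ))).smulRight (V i) +
    ∑ j, ((ContinuousLinearMap.proj j).comp
      (ContinuousLinearMap.snd ℝ (Fin k → ℝ) (Fin l → ℝ))).smulRight (W j)

lemma frameMap_apply {k l : ℕ} (V : Fin k → E) (W : Fin l → E) (c : (Fin k → ℝ) × (Fin l → ℝ)) :
    frameMap V W c = ∑ i, c.1 i • V i + ∑ j, c.2 j • W j := by
  simp [frameMap]

/-- A family of projections depends continuously on the parameter if its ranges and its kernels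
have continuous frames. -/
lemma continuousAt_of_frames [FiniteDimensional ℝ E] {X : Type*} [TopologicalSpace X] {x₀ : X}
    {k l : ℕ} {V : Fin k → X → E} {W : Fin l → X → E} {P : X → E →L[ℝ] E}
    (hV : ∀ i, ContinuousAt (V i) x₀) (hW : ∀ j, ContinuousAt (W j) x₀)
    (hPV : ∀ᶠ x in 𝓝 x₀, ∀ i, P x (V i x) = V i x) (hPW : ∀ᶠ x in 𝓝 x₀, ∀ j, P x (W j x) = 0)
    (hVl : LinearIndependent ℝ fun i => V i x₀) (hWl : LinearIndependent ℝ fun j => W j x₀)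
    (hVs : ∀ v, P x₀ v ∈ Submodule.span ℝ (Set.range fun i => V i x₀))
    (hWs : ∀ v, v - P x₀ v ∈ Submodule.span ℝ (Set.range fun j => W j x₀)) :
    ContinuousAt P x₀ := by
  set Ψ : X → ((Fin k → ℝ) × (Fin l → ℝ)) →L[ℝ] E :=
    fun x => frameMap (fun i => V i x) (fun j => W j x) with hΨ
  have hΨc : ContinuousAt Ψ x₀ := by
    have h1 : ∀ c : ((Fin k → ℝ) × (Fin l → ℝ)) →L[ℝ] ℝ, ∀ {U : X → E}, ContinuousAt U x₀ →
        ContinuousAt (fun x => c.smulRight (U x)) x₀ := fun c U hU =>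
      ((ContinuousLinearMap.smulRightL ℝ _ E c).continuous.continuousAt).comp hU
    have h2 : ContinuousAt (fun x => ∑ i, ((ContinuousLinearMap.proj i).comp
        (ContinuousLinearMap.fst ℝ (Fin k → ℝ) (Fin l → ℝ))).smulRight (V i x)) x₀ :=
      tendsto_finsetSum _ fun i _ => h1 _ (hV i)
    have h3 : ContinuousAt (fun x => ∑ j, ((ContinuousLinearMap.proj j).comp
        (ContinuousLinearMap.snd ℝ (Fin k → ℝ) (Fin l → ℝ))).smulRight (W j x)) x₀ :=
      tendsto_finsetSum _ fun j _ => h1 _ (hW j)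
    exact h2.add h3
  have hPΨ : ∀ᶠ x in 𝓝 x₀, ∀ c, P x (Ψ x c) = Ψ x (c.1, 0) := by
    filter_upwards [hPV, hPW] with x hx1 hx2 c
    simp [hΨ, frameMap_apply, hx1, hx2]
  have hinj : Function.Injective (Ψ x₀) := by
    rw [injective_iff_map_eq_zero]
    intro c hc
    have h1 := hPΨ.self_of_nhds c
    rw [hc, map_zero] at h1
    have h2 : ∑ i, c.1 i • V i x₀ = 0 := by simpa [hΨ, frameMap_apply] using h1.symm
    have h3 : ∑ j, c.2 j • W j x₀ = 0 := by
      have := hc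
      rw [hΨ] at this
      simp only [frameMap_apply, h2, zero_add] at this
      exact this
    ext i
    · exact Fintype.linearIndependent_iff.1 hVl _ h2 i
    · exact Fintype.linearIndependent_iff.1 hWl _ h3 i
  have hsurj : Function.Surjective (Ψ x₀) := by
    intro v
    obtain ⟨c, hc⟩ := (Submodule.mem_span_range_iff_exists_fun ℝ).1 (hVs v)
    obtain ⟨d, hd⟩ := (Submodule.mem_span_range_iff_exists_fun ℝ).1 (hWs v)
    exact ⟨(c, d), by rw [hΨ]; simp only [frameMap_apply, hc, hd, add_sub_cancel]⟩
  let e : ((Fin k → ℝ) × (Fin l → ℝ)) ≃L[ℝ] E :=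
    (LinearEquiv.ofBijective (Ψ x₀ : ((Fin k → ℝ) × (Fin l → ℝ)) →ₗ[ℝ] E)
      ⟨hinj, hsurj⟩).toContinuousLinearEquiv
  have he : (e : ((Fin k → ℝ) × (Fin l → ℝ)) →L[ℝ] E) = Ψ x₀ :=
    ContinuousLinearMap.ext fun _ => rfl
  have hinv : ContinuousAt (fun x => (Ψ x).inverse) x₀ := by
    have := (contDiffAt_map_inverse (n := 0) e).continuousAt
    rw [he] at this
    exact ContinuousAt.comp (f := Ψ) this hΨc
  have hequiv : ∀ᶠ x in 𝓝 x₀, Ψ x ∈ Set.range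
      ((↑) : (((Fin k → ℝ) × (Fin l → ℝ)) ≃L[ℝ] E) → ((Fin k → ℝ) × (Fin l → ℝ)) →L[ℝ] E) := by
    apply hΨc.preimage_mem_nhds
    rw [← he]
    exact ContinuousLinearEquiv.nhds e
  -- In frame coordinates the projection is the constant projection to the first factor. `P x` is
  -- its conjugate by `Ψ x`, and inversion is continuous at an isomorphism.
  have hP : (fun x => (Ψ x).comp ((ContinuousLinearMap.inl ℝ (Fin k → ℝ) (Fin l → ℝ)).comp
      ((ContinuousLinearMap.fst ℝ (Fin k → ℝ) (Fin l → ℝ)).comp (Ψ x).inverse))) =ᶠ[𝓝 x₀] P := by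
    filter_upwards [hPΨ, hequiv] with x hx ⟨e', he'⟩
    ext v
    have h1 : Ψ x ((Ψ x).inverse v) = v := by
      rw [← he', ContinuousLinearMap.inverse_equiv]; simp
    have h2 := hx ((Ψ x).inverse v)
    rw [h1] at h2
    rw [h2]; rfl
  refine ContinuousAt.congr ?_ hP
  exact hΨc.clm_comp (continuousAt_const.clm_comp (continuousAt_const.clm_comp hinv))

variable {M : Type*} [TopologicalSpace M] [ChartedSpace E M] [IsManifold 𝓘(ℝ, E) ∞ M]

/-- The linear coordinates on the tangent space at `x` given by the preferred chart at `p`. -/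
noncomputable abbrev tangentCoord (p x : M) : TangentSpace 𝓘(ℝ, E) x →L[ℝ] E :=
  (trivializationAt E (TangentSpace 𝓘(ℝ, E)) p).continuousLinearMapAt ℝ x

/-- The inverse of `tangentCoord`. -/
noncomputable abbrev tangentCoordSymm (p x : M) : E →L[ℝ] TangentSpace 𝓘(ℝ, E) x :=
  (trivializationAt E (TangentSpace 𝓘(ℝ, E)) p).symmL ℝ x

lemma tangentCoordSymm_tangentCoord {p x : M} (hx : x ∈ (chartAt E p).source)
    (v : TangentSpace 𝓘(ℝ, E) x) : tangentCoordSymm p x (tangentCoord p x v) = v :=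
  Bundle.Trivialization.symmL_continuousLinearMapAt _ hx v

lemma tangentCoord_tangentCoordSymm {p x : M} (hx : x ∈ (chartAt E p).source)
    (v : E) : tangentCoord p x (tangentCoordSymm p x v) = v :=
  Bundle.Trivialization.continuousLinearMapAt_symmL _ hx v

variable {Ω : Type*}

lemma continuousAt_tangentCoord [TopologicalSpace Ω] {v : ∀ x : M, Ω → TangentSpace 𝓘(ℝ, E) x} {z₀ : M × Ω}
    (hv : ContinuousAt (fun z : M × Ω => (⟨z.1, v z.1 z.2⟩ : TangentBundle 𝓘(ℝ, E) M)) z₀)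
    {p : M} (hp : z₀.1 ∈ (chartAt E p).source) :
    ContinuousAt (fun z : M × Ω => tangentCoord p z.1 (v z.1 z.2)) z₀ := by
  set e := trivializationAt E (TangentSpace 𝓘(ℝ, E) : M → Type _) p
  have hp' : (⟨z₀.1, v z₀.1 z₀.2⟩ : TangentBundle 𝓘(ℝ, E) M).proj ∈ e.baseSet := hp
  have h1 : ContinuousAt (fun z : M × Ω =>
      (e (⟨z.1, v z.1 z.2⟩ : TangentBundle 𝓘(ℝ, E) M)).2) z₀ :=
    continuousAt_snd.comp (ContinuousAt.comp
      (f := fun z : M × Ω => (⟨z.1, v z.1 z.2⟩ : TangentBundle 𝓘(ℝ, E) M))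
      (e.continuousAt (e.mem_source.2 hp')) hv)
  refine h1.congr ?_
  have hp' : ∀ᶠ z : M × Ω in 𝓝 z₀, z.1 ∈ (chartAt E p).source :=
    continuousAt_fst.preimage_mem_nhds ((chartAt E p).open_source.mem_nhds hp)
  filter_upwards [hp'] with z hz
  exact (e.continuousLinearMapAt_apply_of_mem ℝ hz _).symm

/-- The projection onto `Eu` along `Es`, read in the tangent coordinates given by the chart at
`p`. -/
noncomputable def chartProj [FiniteDimensional ℝ E]
    {Eu Es : ∀ x : M, Ω → Submodule ℝ (TangentSpace 𝓘(ℝ, E) x)}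
    (hc : ∀ x w, IsCompl (Eu x w) (Es x w)) (p : M) (z : M × Ω) : E →L[ℝ] E :=
  LinearMap.toContinuousLinearMap ((tangentCoord p z.1).toLinearMap ∘ₗ
    (Eu z.1 z.2).projection (Es z.1 z.2) (hc z.1 z.2) ∘ₗ (tangentCoordSymm p z.1).toLinearMap)

lemma chartProj_apply [FiniteDimensional ℝ E]
    {Eu Es : ∀ x : M, Ω → Submodule ℝ (TangentSpace 𝓘(ℝ, E) x)}
    (hc : ∀ x w, IsCompl (Eu x w) (Es x w)) (p : M) (z : M × Ω) (v : E) :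
    chartProj hc p z v = tangentCoord p z.1 ((Eu z.1 z.2).projection (Es z.1 z.2) (hc z.1 z.2)
      (tangentCoordSymm p z.1 v)) := rfl

section

variable [FiniteDimensional ℝ E] {Eu Es : ∀ x : M, Ω → Submodule ℝ (TangentSpace 𝓘(ℝ, E) x)}
  (hc : ∀ x w, IsCompl (Eu x w) (Es x w)) {p : M} {z : M × Ω}

lemma chartProj_tangentCoord (hp : z.1 ∈ (chartAt E p).source) (v : TangentSpace 𝓘(ℝ, E) z.1) :
    chartProj hc p z (tangentCoord p z.1 v) =
      tangentCoord p z.1 ((Eu z.1 z.2).projection (Es z.1 z.2) (hc z.1 z.2) v) := by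
  rw [chartProj_apply, tangentCoordSymm_tangentCoord hp]

lemma chartProj_of_mem_left (hp : z.1 ∈ (chartAt E p).source) {v : TangentSpace 𝓘(ℝ, E) z.1}
    (hv : v ∈ Eu z.1 z.2) : chartProj hc p z (tangentCoord p z.1 v) = tangentCoord p z.1 v := by
  rw [chartProj_tangentCoord hc hp, (Submodule.projection_eq_self_iff _ _).2 hv]

lemma chartProj_of_mem_right (hp : z.1 ∈ (chartAt E p).source) {v : TangentSpace 𝓘(ℝ, E) z.1}
    (hv : v ∈ Es z.1 z.2) : chartProj hc p z (tangentCoord p z.1 v) = 0 := by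
  rw [chartProj_tangentCoord hc hp, (Submodule.projection_apply_eq_zero_iff _).2 hv, map_zero]

end

lemma tangentCoord_mem_span {p x : M} {k : ℕ} (v : Fin k → TangentSpace 𝓘(ℝ, E) x)
    {y : TangentSpace 𝓘(ℝ, E) x} (hy : y ∈ Submodule.span ℝ (Set.range v)) :
    tangentCoord p x y ∈ Submodule.span ℝ (Set.range fun i => tangentCoord p x (v i)) := by
  have := Submodule.mem_map_of_mem (f := (tangentCoord p x).toLinearMap) hy
  rw [Submodule.map_span, ← Set.range_comp] at this
  exact this

lemma linearIndependent_tangentCoord {p x : M} (hx : x ∈ (chartAt E p).source) {k : ℕ}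
    {v : Fin k → TangentSpace 𝓘(ℝ, E) x} (hv : LinearIndependent ℝ v) :
    LinearIndependent ℝ fun i => tangentCoord p x (v i) :=
  hv.map' (tangentCoord p x).toLinearMap
    (LinearMap.ker_eq_bot.2 (Function.LeftInverse.injective (tangentCoordSymm_tangentCoord hx)))

lemma continuousAt_chartProj [TopologicalSpace Ω] [FiniteDimensional ℝ E]
    {Eu Es : ∀ x : M, Ω → Submodule ℝ (TangentSpace 𝓘(ℝ, E) x)}
    (hc : ∀ x w, IsCompl (Eu x w) (Es x w)) (hu : IsContinuousSubbundle Eu)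
    (hs : IsContinuousSubbundle Es) {p : M} {z₀ : M × Ω} (hp : z₀.1 ∈ (chartAt E p).source) :
    ContinuousAt (chartProj hc p) z₀ := by
  obtain ⟨U, hU, k, v, hvc, hv⟩ := hu z₀
  obtain ⟨U', hU', l, v', hvc', hv'⟩ := hs z₀
  have hp' : ∀ᶠ z : M × Ω in 𝓝 z₀, z.1 ∈ (chartAt E p).source :=
    continuousAt_fst.preimage_mem_nhds ((chartAt E p).open_source.mem_nhds hp)
  have h1 : ∀ᶠ z in 𝓝 z₀, ∀ i, chartProj hc p z (tangentCoord p z.1 (v i z.1 z.2)) =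
      tangentCoord p z.1 (v i z.1 z.2) := by
    filter_upwards [hp', hU] with z hz hzU i
    refine chartProj_of_mem_left hc hz ?_
    rw [← (hv z hzU).2]
    exact Submodule.subset_span ⟨i, rfl⟩
  have h2 : ∀ᶠ z in 𝓝 z₀, ∀ i, chartProj hc p z (tangentCoord p z.1 (v' i z.1 z.2)) = 0 := by
    filter_upwards [hp', hU'] with z hz hzU i
    refine chartProj_of_mem_right hc hz ?_
    rw [← (hv' z hzU).2]
    exact Submodule.subset_span ⟨i, rfl⟩
  have h3 : ∀ y, chartProj hc p z₀ y ∈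
      Submodule.span ℝ (Set.range fun i => tangentCoord p z₀.1 (v i z₀.1 z₀.2)) := by
    intro y
    rw [chartProj_apply]
    apply tangentCoord_mem_span
    rw [(hv z₀ (mem_of_mem_nhds hU)).2]
    exact Submodule.projection_apply_mem _ _
  have h4 : ∀ y, y - chartProj hc p z₀ y ∈
      Submodule.span ℝ (Set.range fun i => tangentCoord p z₀.1 (v' i z₀.1 z₀.2)) := by
    intro y
    have : y - chartProj hc p z₀ y = tangentCoord p z₀.1 (tangentCoordSymm p z₀.1 y -
        (Eu z₀.1 z₀.2).projection (Es z₀.1 z₀.2) (hc z₀.1 z₀.2) (tangentCoordSymm p z₀.1 y)) := by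
      rw [map_sub, tangentCoord_tangentCoordSymm hp, chartProj_apply]
    rw [this]
    apply tangentCoord_mem_span
    rw [(hv' z₀ (mem_of_mem_nhds hU')).2]
    exact Submodule.sub_projection_mem _ _
  exact continuousAt_of_frames
    (fun i => continuousAt_tangentCoord ((hvc i).continuousAt hU) hp)
    (fun i => continuousAt_tangentCoord ((hvc' i).continuousAt hU') hp) h1 h2
    (linearIndependent_tangentCoord hp (hv z₀ (mem_of_mem_nhds hU)).1)
    (linearIndependent_tangentCoord hp (hv' z₀ (mem_of_mem_nhds hU')).1) h3 h4

end Splittings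

/-! ### Comparison of Riemannian norms in a chart. -/

section Norms

variable {E : Type*} [NormedAddCommGroup E] [NormedSpace ℝ E]
  {M : Type*} [TopologicalSpace M] [ChartedSpace E M] [IsManifold 𝓘(ℝ, E) ∞ M]
  [Bundle.RiemannianBundle (fun x : M => TangentSpace 𝓘(ℝ, E) x)]
  [IsContMDiffRiemannianBundle 𝓘(ℝ, E) ∞ E (fun x : M => TangentSpace 𝓘(ℝ, E) x)]

/-- In the chart at `p`, the norms of the tangent spaces at points close to `p` are uniformly
equivalent to the norm of the model space, and almost equal to each other. -/
lemma exists_nhds_norm_bounds (p : M) {r : ℝ} (hr : 1 < r) :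
    ∃ C > 0, ∃ U ∈ 𝓝 p, U ⊆ (chartAt E p).source ∧
      (∀ x ∈ U, ∀ v : TangentSpace 𝓘(ℝ, E) x, ‖tangentCoord p x v‖ ≤ C * ‖v‖) ∧
      (∀ x ∈ U, ∀ v : E, ‖tangentCoordSymm p x v‖ ≤ C * ‖v‖) ∧
      ∀ x ∈ U, ∀ y ∈ U, ∀ v : E, ‖tangentCoordSymm p x v‖ ≤ r * ‖tangentCoordSymm p y v‖ := by
  have : IsContinuousRiemannianBundle E (fun x : M => TangentSpace 𝓘(ℝ, E) x) := by
    obtain ⟨g, hg, hg'⟩ := IsContMDiffRiemannianBundle.exists_contMDiff (IB := 𝓘(ℝ, E)) (n := ∞)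
      (F := E) (E := fun x : M => TangentSpace 𝓘(ℝ, E) x)
    exact ⟨g, hg.continuous, hg'⟩
  have hr0 : 0 < r := by linarith
  -- The comparison passes through the center, from `x` to `p` and from `p` to `y`, with a factor `s
  -- = √r` each time.
  obtain ⟨s, hs1, hsr⟩ : ∃ s : ℝ, 1 < s ∧ s * s = r :=
    ⟨√r, by rwa [Real.lt_sqrt zero_le_one, one_pow], Real.mul_self_sqrt hr0.le⟩
  have hs0 : 0 ≤ s := by linarith
  obtain ⟨C₁, hC₁, h1⟩ :=
    eventually_norm_trivializationAt_lt E (fun x : M => TangentSpace 𝓘(ℝ, E) x) p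
  obtain ⟨C₂, hC₂, h2⟩ :=
    eventually_norm_symmL_trivializationAt_lt E (fun x : M => TangentSpace 𝓘(ℝ, E) x) p
  have h3 := eventually_norm_symmL_trivializationAt_self_comp_lt E
    (fun x : M => TangentSpace 𝓘(ℝ, E) x) p hs1
  have h4 := eventually_norm_symmL_trivializationAt_comp_self_lt E
    (fun x : M => TangentSpace 𝓘(ℝ, E) x) p hs1
  have h5 := (chartAt E p).open_source.mem_nhds (mem_chart_source E p)
  refine ⟨max C₁ C₂, lt_max_of_lt_left hC₁, _, h1.and (h2.and (h3.and (h4.and h5))),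
    fun x hx => hx.2.2.2.2, fun x hx v => ?_, fun x hx v => ?_, fun x hx y hy v => ?_⟩
  · exact ContinuousLinearMap.le_of_opNorm_le _ (hx.1.le.trans (le_max_left _ _)) v
  · exact ContinuousLinearMap.le_of_opNorm_le _ (hx.2.1.le.trans (le_max_right _ _)) v
  · have e1 := ContinuousLinearMap.le_of_opNorm_le _ hx.2.2.2.1.le (tangentCoordSymm p p v)
    have e2 := ContinuousLinearMap.le_of_opNorm_le _ hy.2.2.1.le (tangentCoordSymm p y v)
    rw [ContinuousLinearMap.comp_apply, tangentCoord_tangentCoordSymm (mem_chart_source E p)] at e1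
    rw [ContinuousLinearMap.comp_apply, tangentCoord_tangentCoordSymm hy.2.2.2.2] at e2
    refine e1.trans ((mul_le_mul_of_nonneg_left e2 hs0).trans ?_)
    rw [← mul_assoc, hsr]

end Norms

end QPForced

namespace QPForced

/-! ### Uniform estimates by compactness, and the derivative relative to the splitting. -/

section Uniformity

lemma exists_uniform_pos {ι : Type*} (S : Finset ι) {P : ι → ℝ → Prop}
    (hP : ∀ i δ δ', 0 < δ' → δ' ≤ δ → P i δ → P i δ') (h : ∀ i ∈ S, ∃ δ > 0, P i δ) :
    ∃ δ > 0, ∀ i ∈ S, P i δ := by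
  classical
  induction S using Finset.induction_on with
  | empty => exact ⟨1, one_pos, by simp⟩
  | insert a S _ ih =>
    obtain ⟨δ, hδ, h1⟩ := ih fun i hi => h i (Finset.mem_insert_of_mem hi)
    obtain ⟨δ', hδ', h2⟩ := h a (Finset.mem_insert_self a S)
    refine ⟨min δ δ', lt_min hδ hδ', fun i hi => ?_⟩
    rcases Finset.mem_insert.1 hi with rfl | hi
    · exact hP _ _ _ (lt_min hδ hδ') (min_le_right _ _) h2
    · exact hP _ _ _ (lt_min hδ hδ') (min_le_left _ _) (h1 i hi)

lemma exists_uniform_bound {ι : Type*} (S : Finset ι) {P : ι → ℝ → Prop}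
    (hP : ∀ i C C', C ≤ C' → P i C → P i C') (h : ∀ i ∈ S, ∃ C, P i C) :
    ∃ C, 1 ≤ C ∧ ∀ i ∈ S, P i C := by
  classical
  induction S using Finset.induction_on with
  | empty => exact ⟨1, le_rfl, by simp⟩
  | insert a S _ ih =>
    obtain ⟨C, hC, h1⟩ := ih fun i hi => h i (Finset.mem_insert_of_mem hi)
    obtain ⟨C', h2⟩ := h a (Finset.mem_insert_self a S)
    refine ⟨max C C', le_max_of_le_left hC, fun i hi => ?_⟩
    rcases Finset.mem_insert.1 hi with rfl | hi
    · exact hP _ _ _ (le_max_right _ _) h2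
    · exact hP _ _ _ (le_max_left _ _) (h1 i hi)

/-- Stronger than uniform continuity on `K`: `y` may lie outside `K`, as is needed for estimates on
whole balls around points of a compact set. -/
lemma exists_uniform_near_compact {X Y : Type*} [PseudoMetricSpace X] [PseudoMetricSpace Y]
    {O K : Set X} {G : X → Y} (hO : IsOpen O) (hG : ContinuousOn G O) (hK : IsCompact K)
    (hKO : K ⊆ O) {κ : ℝ} (hκ : 0 < κ) :
    ∃ ρ > 0, ∀ z ∈ K, ∀ y, dist y z ≤ ρ → y ∈ O ∧ dist (G y) (G z) ≤ κ := by
  obtain ⟨δ, hδ, h1⟩ := hK.exists_thickening_subset_open hO hKO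
  have h2 := hK.uniformContinuousAt_of_continuousAt G
    (fun a ha => hG.continuousAt (hO.mem_nhds (hKO ha))) (Metric.dist_mem_uniformity hκ)
  obtain ⟨δ', hδ', h3⟩ := Metric.mem_uniformity_dist.1 h2
  have hm : 0 < min δ δ' := lt_min hδ hδ'
  refine ⟨min δ δ' / 2, half_pos hm, fun z hz y hy => ?_⟩
  have hlt : dist y z < min δ δ' := by linarith
  refine ⟨h1 (Metric.mem_thickening_iff.2 ⟨z, hz, hlt.trans_le (min_le_left _ _)⟩), ?_⟩
  rw [dist_comm] at hlt ⊢
  exact le_of_lt (h3 (hlt.trans_le (min_le_right _ _)) hz)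

end Uniformity

section Steps

variable {E : Type*} [NormedAddCommGroup E] [NormedSpace ℝ E]
  {M : Type*} [MetricSpace M] [ChartedSpace E M] [IsManifold 𝓘(ℝ, E) ∞ M]

/-- Mean value inequality on a convex ball, for the map minus its derivative at the center. -/
lemma norm_inCharts_sub_le {p q : M} {h : M ≃ₘ^2⟮𝓘(ℝ, E), 𝓘(ℝ, E)⟯ M} {y₀ : E} {ρ κ : ℝ}
    (hκ : ∀ y, ‖y - y₀‖ ≤ ρ → y ∈ (chartAt E p).target ∧
      h ((chartAt E p).symm y) ∈ (chartAt E q).source ∧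
      ‖fderiv ℝ (inCharts p q h) y - fderiv ℝ (inCharts p q h) y₀‖ ≤ κ)
    {y y' : E} (hy : ‖y - y₀‖ ≤ ρ) (hy' : ‖y' - y₀‖ ≤ ρ) :
    ‖inCharts p q h y - inCharts p q h y' - fderiv ℝ (inCharts p q h) y₀ (y - y')‖ ≤
      κ * ‖y - y'‖ := by
  refine (convex_closedBall y₀ ρ).norm_image_sub_le_of_norm_hasFDerivWithin_le'
    (f' := fderiv ℝ (inCharts p q h)) (fun z hz => ?_) (fun z hz => ?_)
    (mem_closedBall_iff_norm.2 hy') (mem_closedBall_iff_norm.2 hy)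
  · obtain ⟨h1, h2, -⟩ := hκ z (mem_closedBall_iff_norm.1 hz)
    exact (hasFDerivAt_inCharts h1 h2).hasFDerivWithinAt
  · exact (hκ z (mem_closedBall_iff_norm.1 hz)).2.2

variable [CompactSpace M] {Ω : Type*} [MetricSpace Ω] [CompactSpace Ω]
  {f : Ω → M ≃ₘ^2⟮𝓘(ℝ, E), 𝓘(ℝ, E)⟯ M}

/-- Uniform bounds for the derivatives in charts, and for their variation. -/
lemma exists_fderiv_bounds (hf : Continuous f) {p q : M} {K K' : Set M} (hK : IsClosed K)
    (hK' : IsClosed K') (hKp : K ⊆ (chartAt E p).source) (hKq : K' ⊆ (chartAt E q).source) :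
    (∃ D, ∀ x ∈ K, ∀ w, f w x ∈ K' → ‖fderiv ℝ (inCharts p q (f w)) (chartAt E p x)‖ ≤ D) ∧
    ∀ κ > 0, ∃ ρ > 0, ∀ x ∈ K, ∀ w, f w x ∈ K' → ∀ y, ‖y - chartAt E p x‖ ≤ ρ →
      y ∈ (chartAt E p).target ∧ f w ((chartAt E p).symm y) ∈ (chartAt E q).source ∧
      ‖fderiv ℝ (inCharts p q (f w)) y - fderiv ℝ (inCharts p q (f w)) (chartAt E p x)‖ ≤ κ := by
  -- A compact set of pairs at which the expression in the two charts is defined, so the derivative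
  -- is bounded on it and uniformly continuous near it.
  set Z : Set (M × Ω) := {z | z.1 ∈ K ∧ f z.2 z.1 ∈ K'}
  have hZ : IsCompact Z :=
    ((hK.preimage continuous_fst).inter (hK'.preimage (continuous_apply hf))).isCompact
  have hcont : ContinuousOn (fun z : M × Ω => (chartAt E p z.1, z.2)) Z :=
    ((chartAt E p).continuousOn.comp continuousOn_fst fun z hz => hKp hz.1).prodMk continuousOn_snd
  have hmaps : Set.MapsTo (fun z : M × Ω => (chartAt E p z.1, z.2)) Z (chartDomain f p q) := by
    intro z hz
    refine ⟨(chartAt E p).map_source (hKp hz.1), ?_⟩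
    rw [(chartAt E p).left_inv (hKp hz.1)]
    exact hKq hz.2
  have hdf := continuousOn_fderiv_inCharts hf p q
  constructor
  · obtain ⟨D, hD⟩ := hZ.exists_bound_of_continuousOn (hdf.comp hcont hmaps)
    exact ⟨D, fun x hx w hw => hD (x, w) ⟨hx, hw⟩⟩
  · intro κ hκ
    obtain ⟨ρ, hρ, h⟩ := exists_uniform_near_compact (isOpen_chartDomain hf p q) hdf
      (hZ.image_of_continuousOn hcont) hmaps.image_subset hκ
    refine ⟨ρ, hρ, fun x hx w hw y hy => ?_⟩
    have hd : dist (y, w) (chartAt E p x, w) ≤ ρ := by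
      rw [Prod.dist_eq, dist_self, dist_eq_norm]
      exact max_le hy hρ.le
    have h1 := h (chartAt E p x, w) (Set.mem_image_of_mem _ (show (x, w) ∈ Z from ⟨hx, hw⟩))
      (y, w) hd
    refine ⟨h1.1.1, h1.1.2, ?_⟩
    rw [← dist_eq_norm]
    exact h1.2

end Steps

section Linear

variable {E : Type*} [NormedAddCommGroup E] [NormedSpace ℝ E]
  {M : Type*} [TopologicalSpace M] [ChartedSpace E M] [IsManifold 𝓘(ℝ, E) ∞ M]
  {Ω : Type*} {f : Ω → M ≃ₘ^2⟮𝓘(ℝ, E), 𝓘(ℝ, E)⟯ M}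

lemma fderiv_inCharts_eq {p q x : M} {w : Ω} (hx : x ∈ (chartAt E p).source)
    (hfx : f w x ∈ (chartAt E q).source) (v : E) :
    fderiv ℝ (inCharts p q (f w)) (chartAt E p x) v =
      tangentCoord q (f w x) (mfderiv 𝓘(ℝ, E) 𝓘(ℝ, E) (f w) x (tangentCoordSymm p x v)) := by
  rw [← fderiv_inCharts_comp hx hfx, tangentCoord_tangentCoordSymm hx]

variable [FiniteDimensional ℝ E] {θ : Ω → Ω}
  {Eu Es : ∀ x : M, Ω → Submodule ℝ (TangentSpace 𝓘(ℝ, E) x)}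
  (hc : ∀ x w, IsCompl (Eu x w) (Es x w))

lemma chartProj_idem {p : M} {z : M × Ω} (hp : z.1 ∈ (chartAt E p).source) (v : E) :
    chartProj hc p z (chartProj hc p z v) = chartProj hc p z v := by
  rw [chartProj_apply hc p z v]
  exact chartProj_of_mem_left hc hp (Submodule.projection_apply_mem _ _)

lemma tangentCoordSymm_chartProj_mem {p : M} {z : M × Ω} (hp : z.1 ∈ (chartAt E p).source)
    (v : E) : tangentCoordSymm p z.1 (chartProj hc p z v) ∈ Eu z.1 z.2 := by
  rw [chartProj_apply, tangentCoordSymm_tangentCoord hp]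
  exact Submodule.projection_apply_mem _ _

lemma tangentCoordSymm_sub_chartProj_mem {p : M} {z : M × Ω} (hp : z.1 ∈ (chartAt E p).source)
    (v : E) : tangentCoordSymm p z.1 (v - chartProj hc p z v) ∈ Es z.1 z.2 := by
  rw [map_sub, chartProj_apply, tangentCoordSymm_tangentCoord hp]
  exact Submodule.sub_projection_mem _ _

/-- The derivative respects both summands, hence intertwines the projections; this is verified on
the two components of `v`. -/
lemma chartProj_fderiv {p q x : M} {w : Ω} (hx : x ∈ (chartAt E p).source)
    (hfx : f w x ∈ (chartAt E q).source)
    (hu : (Eu x w).map (mfderiv 𝓘(ℝ, E) 𝓘(ℝ, E) (f w) x).toLinearMap = Eu (f w x) (θ w))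
    (hs : (Es x w).map (mfderiv 𝓘(ℝ, E) 𝓘(ℝ, E) (f w) x).toLinearMap = Es (f w x) (θ w))
    (v : E) :
    chartProj hc q (f w x, θ w) (fderiv ℝ (inCharts p q (f w)) (chartAt E p x) v) =
      fderiv ℝ (inCharts p q (f w)) (chartAt E p x) (chartProj hc p (x, w) v) := by
  have h1 : chartProj hc q (f w x, θ w) (fderiv ℝ (inCharts p q (f w)) (chartAt E p x)
      (chartProj hc p (x, w) v)) = fderiv ℝ (inCharts p q (f w)) (chartAt E p x)
      (chartProj hc p (x, w) v) := by
    rw [fderiv_inCharts_eq hx hfx]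
    refine chartProj_of_mem_left (z := (f w x, θ w)) hc hfx ?_
    simp only
    rw [← hu]
    exact Submodule.mem_map_of_mem (tangentCoordSymm_chartProj_mem (z := (x, w)) hc hx v)
  have h2 : chartProj hc q (f w x, θ w) (fderiv ℝ (inCharts p q (f w)) (chartAt E p x)
      (v - chartProj hc p (x, w) v)) = 0 := by
    rw [fderiv_inCharts_eq hx hfx]
    refine chartProj_of_mem_right (z := (f w x, θ w)) hc hfx ?_
    simp only
    rw [← hs]
    exact Submodule.mem_map_of_mem (tangentCoordSymm_sub_chartProj_mem (z := (x, w)) hc hx v)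
  rw [map_sub, map_sub, h1, sub_eq_zero] at h2
  exact h2

lemma exists_fderiv_chartProj_eq {p q x : M} {w : Ω} (hx : x ∈ (chartAt E p).source)
    (hfx : f w x ∈ (chartAt E q).source)
    (hu : (Eu x w).map (mfderiv 𝓘(ℝ, E) 𝓘(ℝ, E) (f w) x).toLinearMap = Eu (f w x) (θ w))
    (v : E) : ∃ u, fderiv ℝ (inCharts p q (f w)) (chartAt E p x) (chartProj hc p (x, w) u) =
      chartProj hc q (f w x, θ w) v := by
  have h1 := tangentCoordSymm_chartProj_mem (z := (f w x, θ w)) hc hfx v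
  simp only at h1
  rw [← hu] at h1
  obtain ⟨ξ, hξ, hξv⟩ := h1
  refine ⟨tangentCoord p x ξ, ?_⟩
  rw [chartProj_of_mem_left (z := (x, w)) hc hx hξ]
  simp only
  rw [fderiv_inCharts_comp hx hfx]
  have h2 := congrArg (tangentCoord q (f w x)) hξv
  rw [tangentCoord_tangentCoordSymm hfx] at h2
  exact h2

variable [Bundle.RiemannianBundle (fun x : M => TangentSpace 𝓘(ℝ, E) x)]

lemma norm_fderiv_chartProj_ge {p q x : M} {w : Ω} {ν : ℝ} (hx : x ∈ (chartAt E p).source)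
    (hfx : f w x ∈ (chartAt E q).source)
    (h : ∀ ξ ∈ Eu x w, ν * ‖ξ‖ ≤ ‖mfderiv 𝓘(ℝ, E) 𝓘(ℝ, E) (f w) x ξ‖) (v : E) :
    ν * ‖tangentCoordSymm p x (chartProj hc p (x, w) v)‖ ≤
      ‖tangentCoordSymm q (f w x) (fderiv ℝ (inCharts p q (f w)) (chartAt E p x)
        (chartProj hc p (x, w) v))‖ := by
  rw [fderiv_inCharts_eq hx hfx, tangentCoordSymm_tangentCoord hfx]
  exact h _ (tangentCoordSymm_chartProj_mem (z := (x, w)) hc hx v)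

lemma norm_fderiv_sub_chartProj_le {p q x : M} {w : Ω} {ν : ℝ} (hx : x ∈ (chartAt E p).source)
    (hfx : f w x ∈ (chartAt E q).source)
    (h : ∀ ξ ∈ Es x w, ‖mfderiv 𝓘(ℝ, E) 𝓘(ℝ, E) (f w) x ξ‖ ≤ ν * ‖ξ‖) (v : E) :
    ‖tangentCoordSymm q (f w x) (fderiv ℝ (inCharts p q (f w)) (chartAt E p x)
        (v - chartProj hc p (x, w) v))‖ ≤
      ν * ‖tangentCoordSymm p x (v - chartProj hc p (x, w) v)‖ := by
  rw [fderiv_inCharts_eq hx hfx, tangentCoordSymm_tangentCoord hfx]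
  exact h _ (tangentCoordSymm_sub_chartProj_mem (z := (x, w)) hc hx v)

/-- Linear coordinates on the model space that are isometric for the Riemannian norm at `x`. -/
lemma exists_isometric_coord {p x : M} (hx : x ∈ (chartAt E p).source) :
    ∃ β : EuclideanSpace ℝ (Fin (Module.finrank ℝ E)) ≃L[ℝ] E,
      ∀ v, ‖β.symm v‖ = ‖tangentCoordSymm p x v‖ := by
  have hfin : FiniteDimensional ℝ (TangentSpace 𝓘(ℝ, E) x) :=
    inferInstanceAs (FiniteDimensional ℝ E)
  let B := (stdOrthonormalBasis ℝ (TangentSpace 𝓘(ℝ, E) x)).repr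
  let T : E ≃ₗ[ℝ] TangentSpace 𝓘(ℝ, E) x :=
    { (tangentCoordSymm p x).toLinearMap with
      invFun := tangentCoord p x
      left_inv := tangentCoord_tangentCoordSymm hx
      right_inv := tangentCoordSymm_tangentCoord hx }
  let e : E ≃ₗ[ℝ] EuclideanSpace ℝ (Fin (Module.finrank ℝ E)) := T.trans B.toLinearEquiv
  exact ⟨e.toContinuousLinearEquiv.symm, fun v => B.norm_map (T v)⟩

end Linear

end QPForced

namespace QPForced

/-! ### Construction of a hyperbolic atlas for an Anosov system. -/

section CenteredCharts

variable {E F M : Type*} [NormedAddCommGroup E] [NormedSpace ℝ E] [NormedAddCommGroup F]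
  [NormedSpace ℝ F] [TopologicalSpace M]

/-- The chart `a`, translated so as to be centered at `x` and followed by linear coordinates. -/
noncomputable def centeredChart (a : OpenPartialHomeomorph M E) (β : F ≃L[ℝ] E) (x : M) :
    OpenPartialHomeomorph M F :=
  a.transHomeomorph ((Homeomorph.addRight (-(a x))).trans β.symm.toHomeomorph)

variable (a : OpenPartialHomeomorph M E) (β : F ≃L[ℝ] E) (x : M)

lemma centeredChart_apply (y : M) : centeredChart a β x y = β.symm (a y - a x) := by
  rw [sub_eq_add_neg]; rfl

lemma centeredChart_symm_apply (v : F) :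
    (centeredChart a β x).symm v = a.symm (a x + β v) := by
  have : a x + β v = β v + - -(a x) := by abel
  rw [this]; rfl

lemma mem_centeredChart_target {v : F} (hv : a x + β v ∈ a.target) :
    v ∈ (centeredChart a β x).target := by
  have h : a x + β v = β v + - -(a x) := by abel
  rw [h] at hv
  exact hv

end CenteredCharts

section Atlas

variable {E : Type*} [NormedAddCommGroup E] [NormedSpace ℝ E]
  {M : Type*} [MetricSpace M] [CompactSpace M] [ChartedSpace E M] [IsManifold 𝓘(ℝ, E) ∞ M]
  [Bundle.RiemannianBundle (fun x : M => TangentSpace 𝓘(ℝ, E) x)]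
  [IsContMDiffRiemannianBundle 𝓘(ℝ, E) ∞ E (fun x : M => TangentSpace 𝓘(ℝ, E) x)]
  {Ω : Type*} [MetricSpace Ω] [CompactSpace Ω]

/-- A finite family of centers of charts, one near each point, with uniform comparison of the
Riemannian norms to the norm of the model space. -/
lemma exists_chart_centers {r : ℝ} (hr : 1 < r) :
    ∃ (S : Finset M) (R : M → ℝ) (c : M → M) (C : ℝ), 1 ≤ C ∧ (∀ p, 0 < R p) ∧ (∀ x, c x ∈ S) ∧
      (∀ x, dist x (c x) ≤ R (c x) / 2) ∧
      (∀ p x, dist x p ≤ R p → x ∈ (chartAt E p).source) ∧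
      (∀ p ∈ S, ∀ x, dist x p ≤ R p → ∀ v : TangentSpace 𝓘(ℝ, E) x,
        ‖tangentCoord p x v‖ ≤ C * ‖v‖) ∧
      (∀ p ∈ S, ∀ x, dist x p ≤ R p → ∀ v : E, ‖tangentCoordSymm p x v‖ ≤ C * ‖v‖) ∧
      ∀ p x y, dist x p ≤ R p → dist y p ≤ R p → ∀ v : E,
        ‖tangentCoordSymm p x v‖ ≤ r * ‖tangentCoordSymm p y v‖ := by
  choose Cn hCn U hU hUs hT hTs hN using fun p : M => exists_nhds_norm_bounds (E := E) p hr
  choose R hR hRU using fun p : M => Metric.nhds_basis_closedBall.mem_iff.1 (hU p)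
  obtain ⟨S, -, hS⟩ := (isCompact_univ (X := M)).elim_nhds_subcover
    (fun p => Metric.ball p (R p / 2)) fun p _ => Metric.ball_mem_nhds p (half_pos (hR p))
  have hcov : ∀ x : M, ∃ p ∈ S, dist x p ≤ R p / 2 := fun x => by
    have := hS (Set.mem_univ x)
    simp only [Set.mem_iUnion, Metric.mem_ball] at this
    obtain ⟨p, hp, hxp⟩ := this
    exact ⟨p, hp, hxp.le⟩
  choose c hcS hc using hcov
  obtain ⟨C, hC1, hC⟩ := exists_uniform_bound S (P := fun p C => Cn p ≤ C)
    (fun i C C' h h' => h'.trans h) fun p _ => ⟨Cn p, le_rfl⟩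
  refine ⟨S, R, c, C, hC1, hR, hcS, hc, fun p x hx => hUs p (hRU p hx),
    fun p hp x hx v => (hT p x (hRU p hx) v).trans ?_,
    fun p hp x hx v => (hTs p x (hRU p hx) v).trans ?_,
    fun p x y hx hy v => hN p x (hRU p hx) y (hRU p hy) v⟩
  · exact mul_le_mul_of_nonneg_right (hC p hp) (norm_nonneg v)
  · exact mul_le_mul_of_nonneg_right (hC p hp) (norm_nonneg v)

variable [FiniteDimensional ℝ E] {θ : Ω ≃ₜ Ω} {f : Ω → M ≃ₘ^2⟮𝓘(ℝ, E), 𝓘(ℝ, E)⟯ M}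

/-- A system that is Anosov on fibers has a hyperbolic atlas. -/
theorem IsAnosovOnFibers.exists_isHyperbolicAtlas (hf : Continuous f)
    (hA : IsAnosovOnFibers f θ) :
    ∃ (χ : M → OpenPartialHomeomorph M (EuclideanSpace ℝ (Fin (Module.finrank ℝ E))))
      (P : M → Ω → EuclideanSpace ℝ (Fin (Module.finrank ℝ E)) →ₗ[ℝ]
        EuclideanSpace ℝ (Fin (Module.finrank ℝ E))) (C D ν : ℝ),
      IsHyperbolicAtlas (fun w x => f w x) θ χ P C D ν := by
  obtain ⟨Eu, Es, lam, hlam, hu, hs, h⟩ := hA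
  have hc : ∀ x w, IsCompl (Eu x w) (Es x w) := fun x w => (h x w).1
  -- The rate `exp lam` is split as `r * r`: one factor is lost in comparing the norms at `f w x`
  -- and at `x'`, the other survives as `ν`.
  set r := Real.exp (lam / 2) with hr
  have hr1 : 1 < r := Real.one_lt_exp_iff.2 (half_pos hlam)
  have hrr : Real.exp lam = r * r := by rw [hr, ← Real.exp_add, add_halves]
  have hrr' : Real.exp (-lam) = r⁻¹ * r⁻¹ := by rw [Real.exp_neg, hrr, mul_inv]
  have hr0 : 0 < r := by linarith
  obtain ⟨S, R, c, C₁, hC₁, hR, hcS, hcR, hsrc, hT, hTs, hN⟩ :=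
    exists_chart_centers (E := E) (M := M) hr1
  have hC₁0 : 0 < C₁ := by linarith
  have hcR' : ∀ x, dist x (c x) ≤ R (c x) := fun x => by linarith [hcR x, hR (c x)]
  have hcsrc : ∀ x, x ∈ (chartAt E (c x)).source := fun x => hsrc _ _ (hcR' x)
  obtain ⟨C₂, hC₂, hproj⟩ := exists_uniform_bound S
    (P := fun p C => ∀ x, dist x p ≤ R p → ∀ w, ‖chartProj hc p (x, w)‖ ≤ C)
    (fun i C C' h h' x hx w => (h' x hx w).trans h) fun p hp => by
      obtain ⟨C, hC⟩ := ((isCompact_closedBall p (R p)).prod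
        (isCompact_univ (X := Ω))).exists_bound_of_continuousOn (f := chartProj hc p)
        fun z hz => (continuousAt_chartProj hc hu hs (hsrc p z.1 hz.1)).continuousWithinAt
      exact ⟨C, fun x hx w => hC (x, w) ⟨hx, trivial⟩⟩
  have hder := fun p q : M => exists_fderiv_bounds hf (p := p) (q := q)
    (Metric.isClosed_closedBall (x := p) (ε := R p))
    (Metric.isClosed_closedBall (x := q) (ε := R q)) (fun x hx => hsrc p x hx)
    (fun x hx => hsrc q x hx)
  obtain ⟨D₀, hD₀, hD⟩ := exists_uniform_bound (S ×ˢ S)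
    (P := fun z D => ∀ x ∈ Metric.closedBall z.1 (R z.1), ∀ w,
      f w x ∈ Metric.closedBall z.2 (R z.2) →
        ‖fderiv ℝ (inCharts z.1 z.2 (f w)) (chartAt E z.1 x)‖ ≤ D)
    (fun i C C' h h' x hx w hw => (h' x hx w hw).trans h) fun z _ => (hder z.1 z.2).1
  -- Coordinates isometric at `x` let expansion and contraction show in a single step; `C₁` alone
  -- could spoil the rates.
  choose β hβ using fun x : M => exists_isometric_coord (E := E) (hcsrc x)
  have hβs : ∀ x v, ‖(β x).symm v‖ ≤ C₁ * ‖v‖ := fun x v => by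
    rw [hβ]; exact hTs _ (hcS x) x (hcR' x) v
  have hβn : ∀ x v, ‖β x v‖ ≤ C₁ * ‖v‖ := fun x v => by
    have := hT _ (hcS x) x (hcR' x) (tangentCoordSymm (c x) x (β x v))
    rwa [tangentCoord_tangentCoordSymm (hcsrc x), ← hβ, (β x).symm_apply_apply] at this
  let P : M → Ω → EuclideanSpace ℝ (Fin (Module.finrank ℝ E)) →ₗ[ℝ]
      EuclideanSpace ℝ (Fin (Module.finrank ℝ E)) := fun x w =>
    ((β x).symm.toLinearEquiv.toLinearMap ∘ₗ (chartProj hc (c x) (x, w)).toLinearMap) ∘ₗ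
      (β x).toLinearEquiv.toLinearMap
  have hP : ∀ x w v, P x w v = (β x).symm (chartProj hc (c x) (x, w) (β x v)) :=
    fun x w v => rfl
  have hβP : ∀ x w v, β x (P x w v) = chartProj hc (c x) (x, w) (β x v) := fun x w v => by
    rw [hP, (β x).apply_symm_apply]
  have hPn : ∀ x w v, ‖P x w v‖ ≤ C₁ * C₂ * C₁ * ‖v‖ := fun x w v => by
    rw [hP]
    calc _ ≤ C₁ * ‖chartProj hc (c x) (x, w) (β x v)‖ := hβs _ _
      _ ≤ C₁ * (C₂ * ‖β x v‖) := by
        gcongr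
        exact ContinuousLinearMap.le_of_opNorm_le _ (hproj _ (hcS x) x (hcR' x) w) _
      _ ≤ C₁ * (C₂ * (C₁ * ‖v‖)) := by gcongr; exact hβn x v
      _ = _ := by ring
  refine ⟨fun x => centeredChart (chartAt E (c x)) (β x) x, P, 1 + C₁ * C₂ * C₁, C₁ * D₀ * C₁, r,
    { center := fun x => ⟨hcsrc x, by rw [centeredChart_apply, sub_self, map_zero]⟩
      chart_small := ?_
      symm_small := ?_
      C_nonneg := by positivity
      D_nonneg := by positivity
      one_lt := hr1
      idem := fun x w v => by
        rw [hP x w (P x w v), hβP, chartProj_idem hc (z := (x, w)) (hcsrc x), ← hP]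
      norm_proj := fun x w v => (hPn x w v).trans (by
        gcongr; linarith)
      norm_compl := fun x w v => (norm_sub_le _ _).trans (by
        rw [add_mul, one_mul]; gcongr; exact hPn x w v)
      step := ?_ }⟩
  · intro ρ hρ
    obtain ⟨ε, hε, hS⟩ := exists_uniform_pos S
      (P := fun p ε => ∀ z ∈ Metric.closedBall p (R p), ∀ y, dist y z ≤ ε →
        y ∈ (chartAt E p).source ∧ dist (chartAt E p y) (chartAt E p z) ≤ ρ / C₁)
      (fun i δ δ' _ h h' z hz y hy => h' z hz y (hy.trans h)) fun p _ =>
        exists_uniform_near_compact (chartAt E p).open_source (chartAt E p).continuousOn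
          (isCompact_closedBall p (R p)) (fun x hx => hsrc p x hx) (by positivity)
    refine ⟨ε, hε, fun x y hxy => ?_⟩
    obtain ⟨h1, h2⟩ := hS _ (hcS x) x (hcR' x) y (by rwa [dist_comm])
    refine ⟨h1, ?_⟩
    rw [centeredChart_apply]
    refine (hβs _ _).trans ?_
    rwa [dist_eq_norm, le_div_iff₀' hC₁0] at h2
  · intro ε hε
    obtain ⟨ρ, hρ, hS⟩ := exists_uniform_pos S
      (P := fun p ρ => ∀ z ∈ chartAt E p '' Metric.closedBall p (R p), ∀ y, dist y z ≤ ρ →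
        y ∈ (chartAt E p).target ∧ dist ((chartAt E p).symm y) ((chartAt E p).symm z) ≤ ε)
      (fun i δ δ' _ h h' z hz y hy => h' z hz y (hy.trans h)) fun p _ =>
        exists_uniform_near_compact (chartAt E p).open_target (chartAt E p).continuousOn_symm
          ((isCompact_closedBall p (R p)).image_of_continuousOn
            ((chartAt E p).continuousOn.mono fun x hx => hsrc p x hx))
          (by rintro _ ⟨x, hx, rfl⟩; exact (chartAt E p).map_source (hsrc p x hx)) hε
    refine ⟨ρ / C₁, by positivity, fun x v hv => ?_⟩
    obtain ⟨h1, h2⟩ := hS _ (hcS x) (chartAt E (c x) x) (Set.mem_image_of_mem _ (hcR' x)) (chartAt E (c x) x + β x v) (by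
      rw [dist_eq_norm, add_sub_cancel_left]
      refine (hβn _ _).trans ?_
      rwa [le_div_iff₀' hC₁0] at hv)
    refine ⟨mem_centeredChart_target _ _ _ h1, ?_⟩
    rw [centeredChart_symm_apply]
    rwa [(chartAt E (c x)).left_inv (hcsrc x)] at h2
  · intro τ hτ
    -- Entering and leaving the coordinates `β` costs a factor `C₁` each.
    have hτ' : 0 < τ / (C₁ * C₁) := by positivity
    -- Since `x'` is within half the radius of its center, a jump of at most the other half keeps `f
    -- w x` in the same ball, so that one chart serves both points.
    obtain ⟨δ₁, hδ₁, hS₁⟩ := exists_uniform_pos S (P := fun p δ => δ ≤ R p / 2)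
      (fun i δ δ' _ h h' => h.trans h') fun p _ => ⟨R p / 2, half_pos (hR p), le_rfl⟩
    obtain ⟨δ₂, hδ₂, hS₂⟩ := exists_uniform_pos S
      (P := fun p δ => ∀ z ∈ Metric.closedBall p (R p) ×ˢ (Set.univ : Set Ω), ∀ y, dist y z ≤ δ →
        y ∈ (chartAt E p).source ×ˢ (Set.univ : Set Ω) ∧
          dist (chartProj hc p y) (chartProj hc p z) ≤ τ / (C₁ * C₁))
      (fun i δ δ' _ h h' z hz y hy => h' z hz y (hy.trans h)) fun p _ =>
        exists_uniform_near_compact ((chartAt E p).open_source.prod isOpen_univ)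
          (fun z hz => (continuousAt_chartProj hc hu hs hz.1).continuousWithinAt)
          ((isCompact_closedBall p (R p)).prod isCompact_univ)
          (Set.prod_mono (fun x hx => hsrc p x hx) subset_rfl) hτ'
    obtain ⟨ρ, hρ, hS₃⟩ := exists_uniform_pos (S ×ˢ S)
      (P := fun z ρ => ∀ x ∈ Metric.closedBall z.1 (R z.1), ∀ w,
        f w x ∈ Metric.closedBall z.2 (R z.2) → ∀ y, ‖y - chartAt E z.1 x‖ ≤ ρ →
        y ∈ (chartAt E z.1).target ∧ f w ((chartAt E z.1).symm y) ∈ (chartAt E z.2).source ∧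
        ‖fderiv ℝ (inCharts z.1 z.2 (f w)) y -
          fderiv ℝ (inCharts z.1 z.2 (f w)) (chartAt E z.1 x)‖ ≤ τ / (C₁ * C₁))
      (fun i δ δ' _ h h' x hx w hw y hy => h' x hx w hw y (hy.trans h)) fun z _ =>
        (hder z.1 z.2).2 _ hτ'
    refine ⟨min δ₁ δ₂, lt_min hδ₁ hδ₂, ρ / C₁, by positivity, fun x x' w hd => ?_⟩
    have hq : dist (f w x) (c x') ≤ R (c x') := by
      have h1 := hS₁ _ (hcS x')
      have h2 := hd.le.trans (min_le_left _ _)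
      linarith [dist_triangle (f w x) x' (c x'), hcR x']
    have hfx : f w x ∈ (chartAt E (c x')).source := hsrc _ _ hq
    have hpair : (c x, c x') ∈ S ×ˢ S := Finset.mem_product.2 ⟨hcS x, hcS x'⟩
    obtain ⟨-, -, hmu, hms, hexp, hcon⟩ := h x w
    set Df := fderiv ℝ (inCharts (c x) (c x') (f w)) (chartAt E (c x) x) with hDf
    have hDn : ‖Df‖ ≤ D₀ := hD _ hpair x (hcR' x) w hq
    have hN₁ : ∀ e, ‖tangentCoordSymm (c x') (f w x) e‖ ≤ r * ‖(β x').symm e‖ := fun e => by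
      rw [hβ]; exact hN _ _ _ hq (hcR' x') e
    have hN₂ : ∀ e, ‖(β x').symm e‖ ≤ r * ‖tangentCoordSymm (c x') (f w x) e‖ := fun e => by
      rw [hβ]; exact hN _ _ _ (hcR' x') hq e
    -- `A` is the derivative at `x` read between the charts at `x` and `x'`. `P'` is the projection
    -- at the true image `f w x` in the chart at `x'`: it is intertwined exactly by `A` and is only
    -- close to the projection at `x'`.
    let A : EuclideanSpace ℝ (Fin (Module.finrank ℝ E)) →ₗ[ℝ]
        EuclideanSpace ℝ (Fin (Module.finrank ℝ E)) :=
      ((β x').symm.toLinearEquiv.toLinearMap ∘ₗ Df.toLinearMap) ∘ₗ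
        (β x).toLinearEquiv.toLinearMap
    let P' : EuclideanSpace ℝ (Fin (Module.finrank ℝ E)) →ₗ[ℝ]
        EuclideanSpace ℝ (Fin (Module.finrank ℝ E)) :=
      ((β x').symm.toLinearEquiv.toLinearMap ∘ₗ
        (chartProj hc (c x') (f w x, θ w)).toLinearMap) ∘ₗ (β x').toLinearEquiv.toLinearMap
    have hAapp : ∀ v, A v = (β x').symm (Df (β x v)) := fun v => rfl
    have hP'app : ∀ v, P' v = (β x').symm (chartProj hc (c x') (f w x, θ w) (β x' v)) :=
      fun v => rfl
    refine ⟨A, P', fun v => ?_, fun v => ?_, fun v => ?_, fun v => ?_, fun v => ?_, fun v => ?_,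
      fun v hv => ?_, fun v v' hv hv' => ?_⟩
    · rw [hP'app, hP, ← map_sub, ← sub_apply]
      have h1 := (hS₂ _ (hcS x') (x', θ w) ⟨hcR' x', trivial⟩ (f w x, θ w) (by
        rw [Prod.dist_eq, dist_self]
        exact max_le (hd.le.trans (min_le_right _ _)) hδ₂.le)).2
      rw [dist_eq_norm] at h1
      calc _ ≤ C₁ * ‖(chartProj hc (c x') (f w x, θ w) - chartProj hc (c x') (x', θ w))
            (β x' v)‖ := hβs _ _
        _ ≤ C₁ * (τ / (C₁ * C₁) * ‖β x' v‖) := by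
          gcongr
          exact ContinuousLinearMap.le_of_opNorm_le _ h1 _
        _ ≤ C₁ * (τ / (C₁ * C₁) * (C₁ * ‖v‖)) := by gcongr; exact hβn _ _
        _ = τ * ‖v‖ := by field_simp
    · rw [hP'app, hAapp, (β x').apply_symm_apply, hDf,
        chartProj_fderiv hc (hcsrc x) hfx hmu hms, hAapp, hβP]
    · rw [hAapp]
      calc _ ≤ C₁ * ‖Df (β x v)‖ := hβs _ _
        _ ≤ C₁ * (D₀ * ‖β x v‖) := by
          gcongr
          exact ContinuousLinearMap.le_of_opNorm_le _ hDn _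
        _ ≤ C₁ * (D₀ * (C₁ * ‖v‖)) := by gcongr; exact hβn _ _
        _ = _ := by ring
    · have h1 := norm_fderiv_chartProj_ge hc (hcsrc x) hfx hexp (β x v)
      rw [← hβP, ← hβ, (β x).symm_apply_apply, ← hDf, hrr] at h1
      have h2 := h1.trans (hN₁ _)
      rw [← hAapp, mul_assoc] at h2
      exact le_of_mul_le_mul_left h2 hr0
    · have h1 := norm_fderiv_sub_chartProj_le hc (hcsrc x) hfx hcon (β x v)
      rw [← hβP, ← map_sub, ← hβ, (β x).symm_apply_apply, ← hDf, hrr'] at h1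
      have h2 := (hN₂ _).trans (mul_le_mul_of_nonneg_left h1 hr0.le)
      rw [← hAapp] at h2
      calc _ ≤ r * (r * (r⁻¹ * r⁻¹ * ‖v - P x w v‖)) := by gcongr
        _ = _ := by field_simp
    · obtain ⟨u, hu'⟩ := exists_fderiv_chartProj_eq hc (hcsrc x) hfx hmu (β x' v)
      refine ⟨(β x).symm u, ?_⟩
      rw [hAapp, hβP, (β x).apply_symm_apply, hP'app, ← hu']
    · have h1 := hS₃ _ hpair x (hcR' x) w hq (chartAt E (c x) x + β x v) (by
        rw [add_sub_cancel_left]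
        refine (hβn _ _).trans ?_
        rwa [le_div_iff₀' hC₁0] at hv)
      rw [centeredChart_symm_apply]
      exact h1.2.1
    · have hle : ∀ {v}, ‖v‖ ≤ ρ / C₁ →
          ‖chartAt E (c x) x + β x v - chartAt E (c x) x‖ ≤ ρ := fun {v} hv => by
        rw [add_sub_cancel_left]
        refine (hβn _ _).trans ?_
        rwa [le_div_iff₀' hC₁0] at hv
      have h1 := norm_inCharts_sub_le (hS₃ _ hpair x (hcR' x) w hq) (hle hv) (hle hv')
      rw [add_sub_add_left_eq_sub, ← map_sub] at h1
      rw [centeredChart_symm_apply, centeredChart_symm_apply, centeredChart_apply,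
        centeredChart_apply, ← map_sub, sub_sub_sub_cancel_right, hAapp, ← map_sub]
      calc _ ≤ C₁ * (τ / (C₁ * C₁) * ‖β x (v - v')‖) := (hβs _ _).trans (by
            gcongr; exact h1)
        _ ≤ C₁ * (τ / (C₁ * C₁) * (C₁ * ‖v - v'‖)) := by gcongr; exact hβn _ _
        _ = τ * ‖v - v'‖ := by field_simp

end Atlas

end QPForced

namespace QPForced

/-! ### Orbits in the fibers and measurable families of sections. -/

section FiberOrbits

variable {M Ω : Type*} [MetricSpace M] [MetricSpace Ω] {f : Ω → M → M} {θ : Ω ≃ₜ Ω}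
  {Φ : M × Ω ≃ₜ M × Ω}

lemma zpow_skew_snd (hΦ : ∀ p, Φ p = (f p.2 p.1, θ p.2)) (k : ℤ) (p : M × Ω) :
    ((Φ ^ k) p).2 = (θ ^ k) p.2 := by
  have hstep : ∀ j : ℤ, ((Φ ^ (j + 1)) p).2 = θ ((Φ ^ j) p).2 := fun j => by
    rw [add_comm, zpow_one_add, Homeomorph.mul_apply, hΦ]
  have hstep' : ∀ j : ℤ, (θ ^ (j + 1)) p.2 = θ ((θ ^ j) p.2) := fun j => by
    rw [add_comm, zpow_one_add, Homeomorph.mul_apply]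
  induction k using Int.induction_on with
  | zero => simp
  | succ i ih => rw [hstep, hstep', ih]
  | pred i ih =>
    have h1 := hstep (-(i : ℤ) - 1)
    have h2 := hstep' (-(i : ℤ) - 1)
    rw [sub_add_cancel] at h1 h2
    exact θ.injective (by rw [← h1, ← h2, ih])

lemma isFiberOrbit_zpow (hΦ : ∀ p, Φ p = (f p.2 p.1, θ p.2)) (p : M × Ω) :
    IsFiberOrbit f θ p.2 fun k => ((Φ ^ k) p).1 := fun k => by
  beta_reduce
  rw [add_comm, zpow_one_add, Homeomorph.mul_apply, hΦ, zpow_skew_snd hΦ]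

lemma IsFiberOrbit.zpow_apply (hΦ : ∀ p, Φ p = (f p.2 p.1, θ p.2)) {w : Ω} {y : ℤ → M}
    (hy : IsFiberOrbit f θ w y) (k : ℤ) : (Φ ^ k) (y 0, w) = (y k, (θ ^ k) w) := by
  have hstep : ∀ j : ℤ, Φ (y j, (θ ^ j) w) = (y (j + 1), (θ ^ (j + 1)) w) := fun j => by
    rw [hΦ, hy j, add_comm, zpow_one_add, Homeomorph.mul_apply]
  induction k using Int.induction_on with
  | zero => simp
  | succ i ih => rw [add_comm, zpow_one_add, Homeomorph.mul_apply, ih, hstep, add_comm]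
  | pred i ih =>
    apply Φ.injective
    rw [hstep, ← Homeomorph.mul_apply, ← zpow_one_add, add_sub_cancel, ih, sub_add_cancel]

end FiberOrbits

section PseudoOrbits

open MeasureTheory

/-- A finite net with a measurable choice of a nearby point; it reduces all fibers to finitely many
chains. -/
lemma exists_simpleFunc_dist_lt (X : Type*) [MetricSpace X] [CompactSpace X] [Nonempty X]
    [MeasurableSpace X] [BorelSpace X] {δ : ℝ} (hδ : 0 < δ) :
    ∃ s : SimpleFunc X X, ∀ x, dist (s x) x < δ := by
  obtain ⟨t, ht⟩ := (isCompact_univ (X := X)).elim_finite_subcover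
    (fun k => Metric.ball (TopologicalSpace.denseSeq X k) δ) (fun _ => Metric.isOpen_ball)
    fun x _ => by
      obtain ⟨k, hk⟩ := (TopologicalSpace.denseRange_denseSeq X).exists_dist_lt x hδ
      exact Set.mem_iUnion.2 ⟨k, hk⟩
  refine ⟨SimpleFunc.nearestPt (TopologicalSpace.denseSeq X) (t.sup id), fun x => ?_⟩
  obtain ⟨k, hk, hx⟩ := Set.mem_iUnion₂.1 (ht (Set.mem_univ x))
  have h := SimpleFunc.edist_nearestPt_le (TopologicalSpace.denseSeq X) x
    (Finset.le_sup (f := id) hk : k ≤ t.sup id)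
  rw [edist_dist, edist_dist, ENNReal.ofReal_le_ofReal_iff dist_nonneg] at h
  exact h.trans_lt (by rwa [dist_comm])

variable {M Ω : Type*} [MetricSpace M] [CompactSpace M] [MeasurableSpace M] [BorelSpace M]
  [MetricSpace Ω] [CompactSpace Ω] [MeasurableSpace Ω] [BorelSpace Ω]
  {f : Ω → M → M} {θ : Ω ≃ₜ Ω}

/-- If simultaneous closed chains exist then every continuous section belongs to a measurable
periodic family of sections that is almost invariant. -/
lemma exists_periodic_pseudo_orbit (hf : Continuous fun p : M × Ω => f p.2 p.1)
    (hθ : IsEquicontinuous θ) [Nonempty M] [Nonempty Ω]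
    (hchain : ∀ {δ η : ℝ}, 0 < δ → 0 < η → ∀ (F : Finset M) (L : Finset Ω), ∃ n : ℕ, 1 ≤ n ∧
      (∀ w, dist ((θ ^ n) w) w < η) ∧ ∀ x ∈ F, ∀ w ∈ L, ∃ c : ℕ → M, c 0 = x ∧ c n = x ∧
        IsFiberChain f θ δ w n c)
    (g : C(Ω, M)) {δ : ℝ} (hδ : 0 < δ) :
    ∃ (n : ℕ) (x : ℤ → Ω → M), 1 ≤ n ∧ (∀ i, Measurable (x i)) ∧ x 0 = g ∧
      Function.Periodic x (n : ℤ) ∧ ∀ i w, dist (f w (x i w)) (x (i + 1) (θ w)) < δ := by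
  obtain ⟨τ, hτ, hfτ⟩ := exists_dist_apply_lt hf (show 0 < δ / 4 by positivity)
  obtain ⟨ρ, hρ, hfρ⟩ := exists_isFiberChain_of_dist_lt hf hθ (show δ / 4 < δ / 2 by linarith)
  obtain ⟨η, hη, hg⟩ := Metric.uniformContinuous_iff.1
    (CompactSpace.uniformContinuous_of_continuous g.continuous) (δ / 8) (by positivity)
  obtain ⟨s, hs⟩ := exists_simpleFunc_dist_lt M (show 0 < min τ (δ / 8) by positivity)
  obtain ⟨s', hs'⟩ := exists_simpleFunc_dist_lt Ω hρ
  obtain ⟨n, hn, hret, hc⟩ := hchain (show 0 < δ / 4 by positivity) hη s.range s'.range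
  choose! c hc0 hcn hcc using hc
  -- `v` discretizes the pair `(g w, w)`. `X m w` is the `m`-th point of the closed chain chosen for
  -- the base point `m` steps before `w`.
  let v : SimpleFunc Ω (M × Ω) := (s.comp g g.continuous.measurable).pair s'
  let X : ℕ → Ω → M := fun m w => c (v ((θ ^ (-(m : ℤ))) w)).1 (v ((θ ^ (-(m : ℤ))) w)).2 m
  have hv1 : ∀ w, (v w).1 ∈ s.range := fun w => SimpleFunc.mem_range_self s (g w)
  have hv2 : ∀ w, (v w).2 ∈ s'.range := fun w => SimpleFunc.mem_range_self s' w
  have hX : ∀ m < n, ∀ w, dist (f w (X m w)) (X (m + 1) (θ w)) < δ / 2 := by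
    intro m hm w
    have h := hfρ _ _ n _ (hs' ((θ ^ (-(m : ℤ))) w))
      (hcc _ (hv1 ((θ ^ (-(m : ℤ))) w)) _ (hv2 ((θ ^ (-(m : ℤ))) w))) m hm
    rw [← zpow_natCast, ← Homeomorph.mul_apply, ← zpow_add, add_neg_cancel, zpow_zero] at h
    have h1 : (θ ^ (-((m + 1 : ℕ) : ℤ))) (θ w) = (θ ^ (-(m : ℤ))) w := by
      rw [← Homeomorph.mul_apply, ← zpow_add_one]
      congr 2
      push_cast
      ring
    simp only [X, h1]
    exact h
  have hX0 : ∀ w, dist (g w) (X 0 w) < min τ (δ / 8) := fun w => by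
    simp only [X, hc0 _ (hv1 _) _ (hv2 _), Nat.cast_zero, neg_zero, zpow_zero]
    rw [dist_comm]
    exact hs (g w)
  -- The chain closes at a point near `g (θ ^ (-n) w)`, which is near `g w` because `θ ^ n` is close
  -- to the identity.
  have hXn : ∀ w, dist (X n w) (g w) < δ / 4 := fun w => by
    simp only [X, hcn _ (hv1 _) _ (hv2 _)]
    set u := (θ ^ (-(n : ℤ))) w with hu
    have hw : w = (θ ^ n) u := by
      rw [hu, ← zpow_natCast, ← Homeomorph.mul_apply, ← zpow_add, add_neg_cancel, zpow_zero]
      rfl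
    have h1 : dist (g w) (g u) < δ / 8 := hg (by rw [hw]; exact hret u)
    have h2 : dist (v u).1 (g u) < δ / 8 := (hs (g u)).trans_le (min_le_right _ _)
    have := dist_triangle_right (v u).1 (g w) (g u)
    linarith
  have hXm : ∀ m, Measurable (X m) := fun m =>
    ((v.map fun p => c p.1 p.2 m).measurable).comp (θ ^ (-(m : ℤ))).continuous.measurable
  -- At multiples of `n` the section `g` itself is inserted, so that `x 0 = g`. Its insertion costs
  -- `δ / 4` at each end of a jump, in addition to the `δ / 2` of the chain.
  refine ⟨n, fun i w => if i % n = 0 then g w else X (i % n).toNat w, hn, fun i => ?_, ?_, ?_,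
    fun i w => ?_⟩
  · by_cases h : i % n = 0
    · simpa only [h, if_true] using g.continuous.measurable
    · simpa only [h, if_false] using hXm _
  · simp
  · intro i
    simp
  · have hn0 : (0 : ℤ) < n := by omega
    obtain ⟨m, hm⟩ := Int.eq_ofNat_of_zero_le (Int.emod_nonneg i hn0.ne')
    have hmn : m < n := by have := Int.emod_lt_of_pos i hn0; omega
    have h1 : dist (f w (if i % n = 0 then g w else X (i % n).toNat w)) (f w (X m w)) < δ / 4 := by
      split_ifs with h
      · obtain rfl : m = 0 := by omega
        exact hfτ _ _ _ _ ((hX0 w).trans_le (min_le_left _ _)) (by simpa using hτ)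
      · simp only [hm, Int.toNat_natCast, dist_self]
        positivity
    have h2 : dist (X (m + 1) (θ w))
        (if (i + 1) % n = 0 then g (θ w) else X ((i + 1) % n).toNat (θ w)) < δ / 4 := by
      have h3 : (i + 1) % n = ((m + 1 : ℕ) : ℤ) % n := by
        rw [← Int.emod_add_emod i n 1, hm]
        rfl
      rcases (show m + 1 ≤ n from hmn).lt_or_eq with h4 | h4
      · rw [Int.emod_eq_of_lt (a := ((m + 1 : ℕ) : ℤ)) (by omega) (by omega)] at h3
        rw [h3, if_neg (by omega), Int.toNat_natCast, dist_self]
        positivity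
      · rw [h4, Int.emod_self] at h3
        rw [if_pos h3, h4]
        exact hXn _
    have h3 := hX m hmn w
    have := dist_triangle4 (f w (if i % n = 0 then g w else X (i % n).toNat w)) (f w (X m w))
      (X (m + 1) (θ w)) (if (i + 1) % n = 0 then g (θ w) else X ((i + 1) % n).toNat (θ w))
    linarith

/-- The sections formed by the unique shadowing orbits of a measurable family of pseudo-orbits are
measurable. -/
lemma measurable_of_shadowing {Φ : M × Ω ≃ₜ M × Ω} (hΦ : ∀ p, Φ p = (f p.2 p.1, θ p.2)) {ε : ℝ}
    (hexp : ∀ (w : Ω) (y y' : ℤ → M), IsFiberOrbit f θ w y → IsFiberOrbit f θ w y' →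
      (∀ k, dist (y k) (y' k) ≤ 2 * ε) → y = y')
    {x : ℤ → Ω → M} (hx : ∀ k, Measurable (x k)) {y : Ω → ℤ → M}
    (hy : ∀ w, IsFiberOrbit f θ w (y w)) (hxy : ∀ w k, dist (y w k) (x k w) ≤ ε) :
    Measurable fun w => y w 0 := by
  have := UniformSpace.secondCountable_of_separable M
  have := UniformSpace.secondCountable_of_separable Ω
  refine measurable_of_isClosed fun C hC => ?_
  -- The triples `(a, w, ξ)` with `a ∈ C` for which the orbit of `(a, w)` follows `ξ` within `ε`.
  -- Its projection along the compact `M` is closed. By expansivity, over `w` and the given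
  -- pseudo-orbit the only candidate for `a` is `y w 0`, so the set in question is a measurable
  -- preimage of this projection.
  let A : Set (M × Ω × (ℤ → M)) :=
    Prod.fst ⁻¹' C ∩ ⋂ k, {z | dist ((Φ ^ k) (z.1, z.2.1)).1 (z.2.2 k) ≤ ε}
  have hA : IsClosed A := by
    refine (hC.preimage continuous_fst).inter
      (isClosed_iInter fun k => isClosed_le ?_ continuous_const)
    have := (Φ ^ k).continuous
    fun_prop
  have hmeas : Measurable fun w : Ω => (w, fun k => x k w) :=
    measurable_id.prodMk (measurable_pi_lambda _ hx)
  convert hmeas (isClosedMap_snd_of_compactSpace A hA).measurableSet using 1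
  ext w
  constructor
  · intro hw
    refine ⟨(y w 0, w, fun k => x k w), ⟨hw, Set.mem_iInter.2 fun k => ?_⟩, rfl⟩
    simp only [Set.mem_ofPred_eq, (hy w).zpow_apply hΦ]
    exact hxy w k
  · rintro ⟨⟨a, w', ξ⟩, ⟨haC, ha⟩, h⟩
    obtain ⟨rfl, rfl⟩ := Prod.mk.inj h
    have h1 : (fun k => ((Φ ^ k) (a, w')).1) = y w' :=
      hexp w' _ _ (isFiberOrbit_zpow hΦ (a, w')) (hy w') fun k => by
        have h2 : dist ((Φ ^ k) (a, w')).1 (x k w') ≤ ε := Set.mem_iInter.1 ha k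
        have h3 := hxy w' k
        have h4 := dist_triangle_right ((Φ ^ k) (a, w')).1 (y w' k) (x k w')
        linarith
    have h2 := congrFun h1 0
    simp only [zpow_zero] at h2
    show y w' 0 ∈ C
    rw [← h2]
    exact haC

/-- Shadowing and expansivity along the fibers turn a measurable periodic family of almost
invariant sections into a nearby measurable periodic family of invariant sections. -/
lemma exists_periodic_orbit_of_pseudo_orbit {Φ : M × Ω ≃ₜ M × Ω}
    (hΦ : ∀ p, Φ p = (f p.2 p.1, θ p.2)) {ε δ : ℝ}
    (hexp : ∀ (w : Ω) (y y' : ℤ → M), IsFiberOrbit f θ w y → IsFiberOrbit f θ w y' →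
      (∀ k, dist (y k) (y' k) ≤ 2 * ε) → y = y')
    (hshadow : ∀ (w : Ω) (x : ℤ → M),
      (∀ k : ℤ, dist (f ((θ ^ k) w) (x k)) (x (k + 1)) < δ) →
      ∃ y, IsFiberOrbit f θ w y ∧ ∀ k, dist (y k) (x k) ≤ ε)
    {n : ℕ} {x : ℤ → Ω → M} (hx : ∀ i, Measurable (x i)) (hper : Function.Periodic x (n : ℤ))
    (hjump : ∀ i w, dist (f w (x i w)) (x (i + 1) (θ w)) < δ) :
    ∃ y : ℤ → Ω → M, (∀ i, Measurable (y i)) ∧ Function.Periodic y (n : ℤ) ∧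
      (∀ i w, y (i + 1) (θ w) = f w (y i w)) ∧ ∀ i w, dist (y i w) (x i w) ≤ ε := by
  have hsucc : ∀ (k : ℤ) w, (θ ^ (k + 1)) w = θ ((θ ^ k) w) := fun k w => by
    rw [add_comm, zpow_one_add, Homeomorph.mul_apply]
  have hsucc' : ∀ (k : ℤ) w, (θ ^ (k + 1)) w = (θ ^ k) (θ w) := fun k w => by
    rw [zpow_add_one, Homeomorph.mul_apply]
  choose y hy hyx using fun (i : ℤ) (w : Ω) =>
    hshadow w (fun k => x (i + k) ((θ ^ k) w)) fun k => by
      have := hjump (i + k) ((θ ^ k) w)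
      rwa [← hsucc, add_assoc] at this
  -- Orbits following the same pseudo-orbit coincide. Comparing the indices `i + n` and `i` gives
  -- periodicity; comparing `(i + 1, θ w)` with the time shift of `(i, w)` gives invariance.
  have huniq : ∀ (w : Ω) (y y' x : ℤ → M), IsFiberOrbit f θ w y → IsFiberOrbit f θ w y' →
      (∀ k, dist (y k) (x k) ≤ ε) → (∀ k, dist (y' k) (x k) ≤ ε) → y = y' :=
    fun w y y' x h h' hd hd' => hexp w y y' h h' fun k => by
      have := dist_triangle_right (y k) (y' k) (x k)
      linarith [hd k, hd' k]
  refine ⟨fun i w => y i w 0, fun i => ?_, fun i => ?_, fun i w => ?_, fun i w => ?_⟩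
  · exact measurable_of_shadowing hΦ hexp
      (fun k => (hx (i + k)).comp (θ ^ k).continuous.measurable) (hy i) (hyx i)
  · funext w
    refine congrFun (huniq w _ _ _ (hy (i + n) w) (hy i w) (fun k => ?_) (hyx i w)) 0
    have h := hyx (i + n) w k
    rwa [show i + n + k = i + k + n by ring, hper] at h
  · have h : y (i + 1) (θ w) = fun k => y i w (k + 1) := by
      refine huniq (θ w) _ _ _ (hy _ _) (fun k => ?_) (hyx _ _) fun k => ?_
      · rw [← hsucc']
        exact hy i w (k + 1)
      · have := hyx i w (k + 1)
        rwa [hsucc', show i + (k + 1) = i + 1 + k by ring] at this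
    simpa [h] using hy i w 0
  · simpa using hyx i w 0

end PseudoOrbits

/-! ### Random periodic points and the conclusion. -/

section PeriodicPoints

variable {E : Type*} [NormedAddCommGroup E] [NormedSpace ℝ E]
  {M : Type*} [TopologicalSpace M] [ChartedSpace E M]

/-- The slice of `W` in a fiber contains a chart copy of a nonempty open subset of `E`, which has no
isolated points. -/
lemma infinite_of_isOpen_prod [Nontrivial E] {Ω : Type*} [TopologicalSpace Ω] {W : Set (M × Ω)}
    (hW : IsOpen W) (hW' : W.Nonempty) : W.Infinite := by
  obtain ⟨⟨x, w⟩, hx⟩ := hW'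
  set a := chartAt E x
  have hV : IsOpen ((fun y => (y, w)) ⁻¹' W) := hW.preimage (by fun_prop)
  have hxa : x ∈ a.source := mem_chart_source E x
  have h1 : a '' (a.source ∩ (fun y => (y, w)) ⁻¹' W) ∈ 𝓝 (a x) :=
    (a.isOpen_image_source_inter hV).mem_nhds ⟨x, ⟨hxa, hx⟩, rfl⟩
  have h2 : (a.source ∩ (fun y => (y, w)) ⁻¹' W).Infinite :=
    have := Module.punctured_nhds_neBot ℝ E (a x)
    (infinite_of_mem_nhds _ h1).of_image a
  refine ((h2.image fun y _ y' _ h => (Prod.mk.inj h).1 : Set.Infinite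
    ((fun y => (y, w)) '' _))).mono ?_
  rintro _ ⟨y, hy, rfl⟩
  exact hy.2

lemma isFullRandomPeriodicPoint_of_periodic [MeasurableSpace M] {Ω : Type*} [TopologicalSpace Ω]
    [MeasurableSpace Ω] {θ : Ω ≃ₜ Ω} {f : Ω → M ≃ₘ^2⟮𝓘(ℝ, E), 𝓘(ℝ, E)⟯ M} {n : ℕ} (hn : 1 ≤ n)
    {y : ℤ → Ω → M} (hy : ∀ i, Measurable (y i)) (hper : Function.Periodic y (n : ℤ))
    (hinv : ∀ i w, y (i + 1) (θ w) = f w (y i w)) :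
    IsFullRandomPeriodicPoint (skewProduct f θ) (graph (y 0)) := by
  have hcast : ∀ i j : ℤ, (i : ZMod n) = j → y i = y j := fun i j h => by
    obtain ⟨q, hq⟩ := (ZMod.intCast_eq_intCast_iff_dvd_sub i j n).1 h
    rw [show j = i + q * n by linarith]
    exact (hper.int_mul q i).symm
  refine ⟨n, fun i => y i.cast, ⟨hn, fun i => hy _, fun i => ?_⟩, 0, ?_⟩
  · have h : y ((i + 1 : ZMod n).cast : ℤ) = y ((i.cast : ℤ) + 1) :=
      hcast _ _ (by push_cast [ZMod.intCast_zmod_cast]; rfl)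
    simp only [h]
    ext ⟨x, w⟩
    constructor
    · rintro ⟨⟨x', w'⟩, hx, h'⟩
      obtain ⟨rfl, rfl⟩ := Prod.mk.inj h'
      have hx : x' = y i.cast w' := hx
      show f w' x' = y _ (θ w')
      rw [hinv, hx]
    · intro hx
      have hx : x = y (i.cast + 1) w := hx
      refine ⟨(y i.cast (θ.symm w), θ.symm w), rfl, ?_⟩
      show (f (θ.symm w) (y i.cast (θ.symm w)), θ (θ.symm w)) = (x, w)
      rw [← hinv, θ.apply_symm_apply, hx]
  · show _ = graph (y ((0 : ZMod n).cast : ℤ))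
    rw [ZMod.cast_zero]

variable [IsManifold 𝓘(ℝ, E) ∞ M] [CompactSpace M] [T2Space M] {Ω : Type*} [TopologicalSpace Ω] [CompactSpace Ω] [T2Space Ω]

/-- The skew product over a continuous family of diffeomorphisms of a compact manifold is a
homeomorphism. -/
noncomputable def skewHomeomorph (θ : Ω ≃ₜ Ω) (f : Ω → M ≃ₘ^2⟮𝓘(ℝ, E), 𝓘(ℝ, E)⟯ M)
    (hf : Continuous f) : M × Ω ≃ₜ M × Ω :=
  Continuous.homeoOfEquivCompactToT2 (f := skewProduct f θ)
    ((continuous_apply hf).prodMk (θ.continuous.comp continuous_snd))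

lemma skewHomeomorph_zpow_apply (θ : Ω ≃ₜ Ω) (f : Ω → M ≃ₘ^2⟮𝓘(ℝ, E), 𝓘(ℝ, E)⟯ M)
    (hf : Continuous f) (n : ℤ) (p : M × Ω) :
    (skewHomeomorph θ f hf ^ n) p = (skewProduct f θ ^ n) p := by
  let T : (M × Ω ≃ₜ M × Ω) →* Equiv.Perm (M × Ω) :=
    { toFun := Homeomorph.toEquiv, map_one' := rfl, map_mul' := fun _ _ => rfl }
  exact congrArg (fun e : Equiv.Perm (M × Ω) => e p) (map_zpow T (skewHomeomorph θ f hf) n)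

end PeriodicPoints

end QPForced

theorem theorem2p3
    {E : Type*} [NormedAddCommGroup E] [NormedSpace ℝ E] [FiniteDimensional ℝ E]
    {M : Type*} [MetricSpace M] [CompactSpace M] [ChartedSpace E M] [IsManifold 𝓘(ℝ, E) ∞ M]
    [Bundle.RiemannianBundle (fun x : M => TangentSpace 𝓘(ℝ, E) x)]
    [IsContMDiffRiemannianBundle 𝓘(ℝ, E) ∞ E (fun x : M => TangentSpace 𝓘(ℝ, E) x)]
    [MeasurableSpace M] [BorelSpace M]
    {Ω : Type*} [MetricSpace Ω] [CompactSpace Ω] [MeasurableSpace Ω] [BorelSpace Ω]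
    (θ : Ω ≃ₜ Ω) (hθ : QPForced.IsEquicontinuous θ)
    (f : Ω → M ≃ₘ^2⟮𝓘(ℝ, E), 𝓘(ℝ, E)⟯ M) (hf : Continuous f)
    (htrans : QPForced.IsTransitive (QPForced.skewProduct f θ))
    (hanosov : QPForced.IsAnosovOnFibers f θ)
    (g : C(Ω, M)) (ε : ℝ) (hε : 0 < ε) :
    ∃ g' : Ω → M, Measurable g' ∧
      QPForced.IsFullRandomPeriodicPoint (QPForced.skewProduct f θ) (QPForced.graph g') ∧
      ∀ w : Ω, dist (g w) (g' w) ≤ ε := by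
  obtain ⟨p, hp⟩ := htrans
  have : Nonempty M := ⟨p.1⟩
  have : Nonempty Ω := ⟨p.2⟩
  -- A nonzero unstable space makes `M` of positive dimension, so `M × Ω` has no isolated points and
  -- the dense two-sided orbit yields forward transitivity.
  have : Nontrivial E := by
    obtain ⟨Eu, Es, lam, -, -, -, h⟩ := hanosov
    have : Nontrivial (Eu p.1 p.2) := Module.nontrivial_of_finrank_pos (h p.1 p.2).2.1
    obtain ⟨v, hv⟩ := exists_ne (0 : Eu p.1 p.2)
    exact ⟨(v : TangentSpace 𝓘(ℝ, E) p.1), (0 : TangentSpace 𝓘(ℝ, E) p.1),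
      fun h => hv (Subtype.ext h)⟩
  have hΦ : ∀ q, QPForced.skewHomeomorph θ f hf q = ((fun w x => f w x) q.2 q.1, θ q.2) :=
    fun q => rfl
  have hp' : Dense (Set.range fun n : ℤ => (QPForced.skewHomeomorph θ f hf ^ n) p) := by
    simpa only [QPForced.skewHomeomorph_zpow_apply] using hp
  have hbase : Dense (Set.range fun n : ℤ => (θ ^ n) p.2) := by
    have h := (Prod.snd_surjective (α := M) (β := Ω)).denseRange.dense_image continuous_snd hp'
    rw [← Set.range_comp] at h
    simpa only [Function.comp_def, QPForced.zpow_skew_snd (f := fun w x => f w x) hΦ] using h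
  obtain ⟨χ, P, C, D, ν, hatlas⟩ :=
    QPForced.IsAnosovOnFibers.exists_isHyperbolicAtlas (f := f) (θ := θ) hf hanosov
  obtain ⟨ε₁, hε₁, hexp⟩ := hatlas.exists_expansive
  -- With `ε₁ / 2`, two orbits shadowing the same pseudo-orbit are `ε₁`-close, within the range of
  -- expansivity.
  obtain ⟨δ, hδ, hshadow⟩ := hatlas.exists_shadowing
    (show 0 < min ε (ε₁ / 2) from lt_min hε (half_pos hε₁))
  obtain ⟨n, x, hn, hx, hx0, hper, hjump⟩ := QPForced.exists_periodic_pseudo_orbit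
    (f := fun w x => f w x) (QPForced.continuous_apply hf) hθ
    (QPForced.exists_simultaneous_closed_chains hΦ hθ hp' hbase
      fun W => QPForced.infinite_of_isOpen_prod (E := E)) g hδ
  obtain ⟨y, hy, hyper, hinv, hyx⟩ := QPForced.exists_periodic_orbit_of_pseudo_orbit hΦ
    (fun w y y' h h' hd => hexp w y y' h h' fun k =>
      (hd k).trans (by linarith [min_le_right ε (ε₁ / 2)])) hshadow hx hper hjump
  refine ⟨y 0, hy 0, QPForced.isFullRandomPeriodicPoint_of_periodic hn hy hyper hinv, fun w => ?_⟩
  rw [dist_comm, ← hx0]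
  exact (hyx 0 w).trans (min_le_left _ _)
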